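/- Let $m\ge 1$ and let $X_1,\dots,X_m$ be independent $N\times N$ real random matrices, each with independent standard Gaussian entries; put $P_m=X_1X_2\cdots X_m$. Define the real weight \[ w_r(\lambda)=\int_{\mathbb R^m}\prod_{j=1}^m e^{-(\lambda^{(j)})^2/2}\,\delta\big(\lambda-\lambda^{(1)}\cdots\lambda^{(m)}\big)\,d\lambda^{(1)}\cdots d\lambda^{(m)}, \] i.e. the density of the image of the measure $\prod_j e^{-(\lambda^{(j)})^2/2}d\lambda^{(j)}$ under multiplication (pointwise, the delta function is used to integrate out $\lambda^{(m)}$). For $\lambda\ne0$ it is finite and is the Meijer $G$-function \[ w_r(\lambda)=G^{m,0}_{0,m}\Big(\begin{matrix}-\\0,\dots,0\end{matrix}\Big|\frac{\lambda^2}{2^m}\Big)=\frac1{2\pi i}\int_{c-i\infty}^{c+i\infty}\Gamma(-s)^m\Big(\frac{\lambda^2}{2^m}\Big)^s ds \] for every $c<0$, the integral being absolutely convergent. Let, for real $2\times2$ matrices $G$, \[ W(G)=\int\prod_{l=1}^m\frac{e^{-\frac12\operatorname{tr}G^{(l)}G^{(l)T}}}{\sqrt{2\pi^3}}\;\delta\big(G-G^{(1)}\cdots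 G^{(m)}\big)\,dG^{(1)}\cdots dG^{(m)}, \] which is likewise the density of the image of the product measure under matrix multiplication (pointwise, the delta function is used to integrate out $G^{(m)}$), and define the complex weight \[ w_c(x,y)=2\pi\int_{-\infty}^{\infty}\frac{|\delta|}{\sqrt{\delta^2+4y^2}}\,W\Big(\begin{bmatrix}\mu_+&0\\0&\mu_-\end{bmatrix}\Big)d\delta,\qquad \mu_\pm=\tfrac12\Big(\pm|\delta|+\sqrt{\delta^2+4(x^2+y^2)}\Big). \] Put $Z_N=2^{N(N+1)/4}\prod_{l=1}^N\Gamma(l/2)$ and $\Delta(z_1,\dots,z_n)=\prod_{j<l}(z_l-z_j)$. Then, for every $0\le k\le N$ of the same parity as $N$, on the event that $P_m$ has exactly $k$ real eigenvalues $\lambda_1,\dots,\lambda_k$ and $(N-k)/2$ complex conjugate pairs $x_j\pm iy_j$ with $y_j>0$, the (unlabelled) eigenvalues have the joint density \[ \frac{1}{k!\,((N-k)/2)!}\,\frac1{Z_N^m}\,\Big|\Delta\big(\{\lambda_l\}_{l=1}^k\cup\{x_j\pm iy_j\}_{j=1}^{(N-k)/2}\big)\Big|\prod_{j=1}^k w_r(\lambda_j)\prod_{j=1}^{(N-k)/2}w_c(x_j,y_j)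 \] with respect to Lebesgue measure $\prod_j d\lambda_j\prod_j dx_j\,dy_j$ on $\mathbb R^k\times(\mathbb R\times\mathbb R_+)^{(N-k)/2}$: for each measurable set $B$ of configurations that is invariant under permutations of the $\lambda_j$ and of the pairs $(x_j,y_j)$, the integral of this function over $B$ is the probability that $P_m$ has exactly $k$ real eigenvalues and that its eigenvalue configuration lies in $B$. (In particular its total integral is the probability that there are exactly $k$ real eigenvalues; it is not normalised to 1.) -/

import Mathlib

open MeasureTheory ProbabilityTheory
open scoped ENNReal Matrix Nat

noncomputable section

/-! ### The Meijer G-function -/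

/-- The integrand of the Mellin-Barnes integral of the Meijer G-function
`G^{m,n}_{p,q}(a₁,…,a_p; b₁,…,b_q | z)`. -/
def meijerIntegrand {p q : ℕ} (m n : ℕ) (a : Fin p → ℂ) (b : Fin q → ℂ) (z s : ℂ) : ℂ :=
  ((∏ j : Fin q with j.1 < m, Complex.Gamma (b j - s)) *
      (∏ j : Fin p with j.1 < n, Complex.Gamma (1 - a j + s))) /
    ((∏ j : Fin q with m ≤ j.1, Complex.Gamma (1 - b j + s)) *
      (∏ j : Fin p with n ≤ j.1, Complex.Gamma (a j - s))) * z ^ s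

/-- The Meijer G-function `G^{m,n}_{p,q}(a; b | z)` as the contour integral
`(1 / 2πi) ∫_γ … ds`, where `γ` is the vertical line `Re s = c`, oriented upwards. -/
def meijerG {p q : ℕ} (m n : ℕ) (a : Fin p → ℂ) (b : Fin q → ℂ) (c : ℝ) (z : ℂ) : ℂ :=
  1 / (2 * Real.pi * Complex.I) *
    ∫ t : ℝ, meijerIntegrand m n a b z (c + t * Complex.I) * Complex.I

/-! ### The real (one-point) weight -/

/-- The weight `e^{-t²/2}` of one scalar. -/
def scalarGauss (t : ℝ) : ℝ≥0∞ := ENNReal.ofReal (Real.exp (-t ^ 2 / 2))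

/-- The real weight, for `m ≥ 1`:
`∫ ∏_{j ≤ m} e^{-t_j²/2} δ(x - t₁ ⋯ t_m) dt₁ ⋯ dt_m`,
where the delta function has been used to integrate out `t_m`: with `p = t₁ ⋯ t_{m-1}`,
`δ(x - p t_m)` puts `t_m = x / p` and contributes the factor `1 / |p|`. -/
def realWeight (m : ℕ) (x : ℝ) : ℝ≥0∞ :=
  ∫⁻ t : Fin (m - 1) → ℝ,
    (∏ l, scalarGauss (t l)) * scalarGauss (x / ∏ l, t l) * (ENNReal.ofReal |∏ l, t l|)⁻¹

/-! ### The complex (two-point) weight -/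

/-- The weight `e^{-tr(G Gᵀ)/2} / √(2π³)` of one real `2 × 2` matrix. -/
def matrixGauss (G : Matrix (Fin 2) (Fin 2) ℝ) : ℝ≥0∞ :=
  ENNReal.ofReal (Real.exp (-(G * Gᵀ).trace / 2) / Real.sqrt (2 * Real.pi ^ 3))

/-- The ordered product `G₁ ⋯ G_n` of real `2 × 2` matrices, given by their entries. -/
def prodTwo {n : ℕ} (H : Fin n → Fin 2 → Fin 2 → ℝ) : Matrix (Fin 2) (Fin 2) ℝ :=
  (List.ofFn fun l => Matrix.of (H l)).prod

/-- The matrix weight `W`, for `m ≥ 1`: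
`∫ ∏_{l ≤ m} (e^{-tr(G_l G_lᵀ)/2} / √(2π³)) δ(G - G₁ ⋯ G_m) dG₁ ⋯ dG_m`,
where the delta function has been used to integrate out `G_m`: with `Q = G₁ ⋯ G_{m-1}`,
`δ(G - Q G_m)` puts `G_m = Q⁻¹ G` and contributes the factor `1 / |det Q|²`. -/
def matrixWeight (m : ℕ) (G : Matrix (Fin 2) (Fin 2) ℝ) : ℝ≥0∞ :=
  ∫⁻ H : Fin (m - 1) → Fin 2 → Fin 2 → ℝ,
    (∏ l, matrixGauss (Matrix.of (H l))) * matrixGauss ((prodTwo H)⁻¹ * G) *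
      (ENNReal.ofReal (|(prodTwo H).det| ^ 2))⁻¹

/-- The larger singular value `μ₊`. -/
def muPlus (x y d : ℝ) : ℝ := (|d| + Real.sqrt (d ^ 2 + 4 * (x ^ 2 + y ^ 2))) / 2

/-- The smaller singular value `μ₋`. -/
def muMinus (x y d : ℝ) : ℝ := (-|d| + Real.sqrt (d ^ 2 + 4 * (x ^ 2 + y ^ 2))) / 2

/-- The complex weight `w_c(x, y) = 2π ∫ |δ| / √(δ² + 4y²) W(diag(μ₊, μ₋)) dδ`. -/
def complexWeight (m : ℕ) (x y : ℝ) : ℝ≥0∞ :=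
  ENNReal.ofReal (2 * Real.pi) *
    ∫⁻ d : ℝ, ENNReal.ofReal (|d| / Real.sqrt (d ^ 2 + 4 * y ^ 2)) *
      matrixWeight m !![muPlus x y d, 0; 0, muMinus x y d]

/-! ### The joint density and the eigenvalues -/

/-- The normalisation `Z_N = 2^{N(N+1)/4} ∏_{l=1}^N Γ(l/2)`. -/
def ginibreZ (N : ℕ) : ℝ :=
  (2 : ℝ) ^ ((N : ℝ) * (N + 1) / 4) * ∏ l ∈ Finset.Icc 1 N, Real.Gamma ((l : ℝ) / 2)

/-- `Δ(z₁, …, z_n) = ∏_{j < l} (z_l - z_j)`. -/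
def vandermondeProd {n : ℕ} (z : Fin n → ℂ) : ℂ :=
  ∏ j, ∏ l ∈ Finset.Ioi j, (z l - z j)

/-- The eigenvalue coordinates: `p.1 j = λ_j` for `j` in `Fin k`, and `p.2 j = (x_j, y_j)` for
`j` in `Fin K`. -/
abbrev EigCoord (k K : ℕ) : Type := (Fin k → ℝ) × (Fin K → ℝ × ℝ)

/-- The list `λ₁, …, λ_k, x₁ + i y₁, …, x_K + i y_K, x₁ - i y₁, …, x_K - i y_K`. -/
def eigList {k K : ℕ} (p : EigCoord k K) : Fin (k + K + K) → ℂ :=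
  Fin.append
    (Fin.append (fun j => ((p.1 j : ℝ) : ℂ))
      (fun j => ((p.2 j).1 : ℂ) + ((p.2 j).2 : ℂ) * Complex.I))
    (fun j => ((p.2 j).1 : ℂ) - ((p.2 j).2 : ℂ) * Complex.I)

/-- The coordinates for which all `(x_j, y_j)` lie in the open upper half-plane. -/
def upperCoord (k K : ℕ) : Set (EigCoord k K) := {p | ∀ j, 0 < (p.2 j).2}

/-- `A` has exactly `k` real eigenvalues `λ_j` and `K` complex conjugate pairs of non-real
eigenvalues `x_j ± i y_j`, `y_j > 0` (counted with algebraic multiplicity), and `p` is a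
labelling of them. -/
def IsEigCoord {N k K : ℕ} (A : Matrix (Fin N) (Fin N) ℝ) (p : EigCoord k K) : Prop :=
  p ∈ upperCoord k K ∧
    (A.map (algebraMap ℝ ℂ)).charpoly.roots = Finset.univ.val.map (eigList p)

/-- The function
`(1 / (k! K!)) (1 / Z_N)^m |Δ(λ ∪ {x ± iy})| ∏ w_r(λ_j) ∏ w_c(x_j, y_j)`. -/
def jointDensity (m N k K : ℕ) (p : EigCoord k K) : ℝ≥0∞ :=
  ENNReal.ofReal
      (1 / ((k ! : ℝ) * (K ! : ℝ)) * (1 / ginibreZ N) ^ m * ‖vandermondeProd (eigList p)‖) *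
    (∏ j, realWeight m (p.1 j)) * ∏ j, complexWeight m (p.2 j).1 (p.2 j).2

/-- A set of labelled eigenvalue configurations that does not depend on the labelling. -/
def LabelInvariant {k K : ℕ} (B : Set (EigCoord k K)) : Prop :=
  ∀ (σ : Equiv.Perm (Fin k)) (τ : Equiv.Perm (Fin K)) (p : EigCoord k K),
    p ∈ B → ((fun j => p.1 (σ j), fun j => p.2 (τ j)) : EigCoord k K) ∈ B

end

/-! The proof is an induction on the eigenvalues: one real eigenvalue, or one conjugate pair, is
split off all the factors simultaneously. Write each factor in blocks `A_l, B_l, C_l, D_l`, the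
first block having size 1 or 2. The graphs spanned by the columns of `(1, U_l)` are carried into
each other, `X_l` mapping the graph of `U_{l+1}` into that of `U_l`, exactly when `C_l = U_l (A_l +
B_l U_{l+1}) - D_l U_{l+1}`. For fixed `A, B, D` this cyclic Riccati equation makes `C` a function
of `U`, and serves as a change of variables. Its derivative is a cyclic Sylvester operator in the
diagonal blocks `A_l + B_l U_{l+1}` and `D_l - U_l B_l` of the deflated factors. If `G` and `P`
denote the products of these blocks, its determinant is that of `v ↦ v G - P v`, in absolute value
`|det χ_G(P)|` with `χ_G` the characteristic polynomial of `G` (`det_cyclicSylvester`,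
`Matrix.abs_det_sylvester`). This is the interaction between the eigenvalues split off and the
remaining ones in the Vandermonde product.

The change of variables is not injective. Almost surely the number of solutions `U` is the number of
real eigenvalues of the product in block size 1, and the number of conjugate pairs in block size 2
when `G` is required to have non-real eigenvalues (`encard_invariantGraphs_one`,
`encard_invariantGraphs_two`). This rests on simple eigenvalues and on eigenvectors in general
position; the exceptional sets are zero loci of polynomials. The area formula with constant
multiplicity (`lintegral_abs_det_fderiv_mul_of_encard_eq`) therefore applies, and the multiplicities
`k + 1` and `K + 1` build up the factorials.

In the new coordinates the Gaussian weight is handled by replacing unipotent lower triangular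
factors by upper triangular ones with the same Gram matrix (`gaussWeight_deflation`). The
off-diagonal blocks `B` become affine Gaussian variables and are integrated out; the Cholesky
factors act on the diagonal blocks by a cyclic conjugation, which preserves Lebesgue measure and all
spectral data. Hence `U` separates off, and its integral is a constant, computed in
`lintegral_graphWeight_mul`. What remains are independent Gaussian sequences of sizes 1 or 2 and `n`
(`lintegral_deflation`).

The product of the small blocks has density `w_r` in size 1 and, up to a constant, `W` in size 2. In
size 2, conformal coordinates and the orthogonal invariance of `W` leave the integral over the
eigenvalue, with weight `2 y w_c(x, y)`, where `2 y` is the distance of the two conjugate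
eigenvalues (`lintegral_nonrealTwo`).

Labels are avoided by testing only against functions of the characteristic polynomial, encoded by
its values at the natural numbers (`HasJointDensity`); a label-invariant set of configurations
corresponds to a Borel set of such sequences. The Meijer function is obtained separately, by
inserting the Mellin inversion formula for the last exponential and applying Fubini. -/

set_option linter.unusedSectionVars false
set_option linter.unusedSimpArgs false
set_option linter.unusedVariables false

/-! ### Product measures, the area formula with multiplicity, and null sets. -/

section MeasureGeneralities

theorem lintegral_fin_prod_eq_prod {α : Type*} [MeasurableSpace α] {μ : Measure α}
    [SigmaFinite μ] : ∀ {n : ℕ} {f : Fin n → α → ℝ≥0∞}, (∀ i, Measurable (f i)) →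
      ∫⁻ x : Fin n → α, ∏ i, f i (x i) ∂(Measure.pi fun _ => μ) = ∏ i, ∫⁻ t, f i t ∂μ
  | 0, f, hf => by simp
  | n + 1, f, hf => by
    rw [← ((measurePreserving_piFinSuccAbove (fun _ : Fin (n + 1) => μ) 0).symm _).lintegral_comp_emb
      (MeasurableEquiv.measurableEmbedding _)]
    simp only [MeasurableEquiv.piFinSuccAbove_symm_apply, Fin.insertNthEquiv, Fin.zero_succAbove,
      Equiv.coe_fn_mk, Fin.insertNth_zero', Fin.prod_univ_succ, Fin.cons_zero, Fin.cons_succ]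
    rw [lintegral_prod_mul (f := f 0) (g := fun y : Fin n → α => ∏ i : Fin n, f i.succ (y i))
      (hf 0).aemeasurable (Finset.measurable_fun_prod _ fun i _ =>
        (hf i.succ).comp (measurable_pi_apply i)).aemeasurable,
      lintegral_fin_prod_eq_prod fun i => hf i.succ]

theorem lintegral_fintype_prod_eq_prod {ι α : Type*} [Fintype ι] [MeasurableSpace α]
    {μ : Measure α} [SigmaFinite μ] {f : ι → α → ℝ≥0∞} (hf : ∀ i, Measurable (f i)) :
    ∫⁻ x : ι → α, ∏ i, f i (x i) ∂(Measure.pi fun _ => μ) = ∏ i, ∫⁻ t, f i t ∂μ := by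
  have e := (Fintype.equivFin ι).symm
  rw [← (measurePreserving_piCongrLeft (fun _ : ι => μ) e).lintegral_comp_emb
    (MeasurableEquiv.measurableEmbedding _), ← Equiv.prod_comp e,
    ← lintegral_fin_prod_eq_prod fun i => hf (e i)]
  refine lintegral_congr fun x => ?_
  rw [← Equiv.prod_comp e]
  refine Finset.prod_congr rfl fun i _ => ?_
  rw [MeasurableEquiv.piCongrLeft, MeasurableEquiv.coe_mk, Equiv.piCongrLeft_apply_apply]

theorem pi_withDensity {ι α : Type*} [Fintype ι] [MeasurableSpace α]
    {μ : Measure α} [SigmaFinite μ] {f : α → ℝ≥0∞} (hf : Measurable f)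
    [SigmaFinite (μ.withDensity f)] :
    (Measure.pi fun _ : ι => μ.withDensity f) =
      (Measure.pi fun _ : ι => μ).withDensity fun x => ∏ i, f (x i) := by
  refine Measure.pi_eq fun s hs => ?_
  rw [withDensity_apply _ (MeasurableSet.univ_pi hs), ← lintegral_indicator (MeasurableSet.univ_pi hs)]
  have h : ∀ x : ι → α, (Set.univ.pi s).indicator (fun x => ∏ i, f (x i)) x =
      ∏ i, (s i).indicator f (x i) := by
    intro x
    classical
    by_cases hx : ∀ i, x i ∈ s i
    · rw [Set.indicator_of_mem (by simpa using hx)]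
      exact Finset.prod_congr rfl fun i _ => (Set.indicator_of_mem (hx i) _).symm
    · rw [Set.indicator_of_notMem (by simpa using hx)]
      push Not at hx
      obtain ⟨i, hi⟩ := hx
      exact (Finset.prod_eq_zero (Finset.mem_univ i) (Set.indicator_of_notMem hi _)).symm
  simp_rw [h]
  rw [lintegral_fintype_prod_eq_prod fun i => hf.indicator (hs i)]
  refine Finset.prod_congr rfl fun i _ => ?_
  rw [withDensity_apply _ (hs i), lintegral_indicator (hs i)]

section Linear

variable {E : Type*} [NormedAddCommGroup E] [NormedSpace ℝ E] [MeasurableSpace E] [BorelSpace E]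
  [FiniteDimensional ℝ E] (μ : Measure E) [μ.IsAddHaarMeasure]

/-- An invertible linear map is a homeomorphism, hence a measurable embedding; for this reason no
measurability of `f` is needed. -/
theorem lintegral_comp_linearMap (L : E →ₗ[ℝ] E) (hL : LinearMap.det L ≠ 0) (f : E → ℝ≥0∞) :
    ENNReal.ofReal |LinearMap.det L| * ∫⁻ x, f (L x) ∂μ = ∫⁻ x, f x ∂μ := by
  let e := (L.equivOfDetNeZero hL).toContinuousLinearEquiv.toHomeomorph
  have he : ∀ x, e x = L x := fun x => rfl
  have h1 : ∫⁻ x, f (L x) ∂μ = ∫⁻ x, f x ∂(Measure.map L μ) :=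
    (e.toMeasurableEquiv.measurableEmbedding.lintegral_map (μ := μ) f).symm
  rw [h1, Measure.map_linearMap_addHaar_eq_smul_addHaar _ hL, lintegral_smul_measure, smul_eq_mul,
    ← mul_assoc, ← ENNReal.ofReal_mul (abs_nonneg _), ← abs_mul, mul_inv_cancel₀ hL]
  simp

/-- The area formula for maps between spaces of the same dimension, in the case that the number
of preimages is constant wherever the integrand does not vanish. -/
theorem lintegral_abs_det_fderiv_mul_of_encard_eq {f : E → E} {f' : E → E →L[ℝ] E}
    (hf : ∀ x, HasFDerivAt f (f' x) x) (hf' : Continuous f') {s : Set E} (hs : MeasurableSet s)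
    {g : E → ℝ≥0∞} (hg : Measurable g) {c : ℕ}
    (hc : ∀ᵐ y ∂μ, g y ≠ 0 → {x | x ∈ s ∧ f x = y}.encard = c) :
    ∫⁻ x in s, ENNReal.ofReal |(f' x).det| * g (f x) ∂μ = c * ∫⁻ y, g y ∂μ := by
  classical
  have hdet : Continuous fun x => (f' x).det := ContinuousLinearMap.continuous_det.comp hf'
  set s' : Set E := s ∩ {x | (f' x).det ≠ 0} with hs'
  have hs'm : MeasurableSet s' := hs.inter (hdet.measurable (measurableSet_singleton 0).compl)
  have h1 : ∫⁻ x in s, ENNReal.ofReal |(f' x).det| * g (f x) ∂μ =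
      ∫⁻ x in s', ENNReal.ofReal |(f' x).det| * g (f x) ∂μ := by
    rw [← lintegral_indicator hs, ← lintegral_indicator hs'm]
    refine lintegral_congr fun x => ?_
    by_cases hx : x ∈ s <;> by_cases hx' : (f' x).det = 0 <;>
      simp [Set.indicator, hs', hx, hx']
  -- Approximation of an invertible `A` within half the reciprocal norm of its inverse forces
  -- injectivity. The value 1 in the other cases only keeps `r` non-zero.
  let r : (E →L[ℝ] E) → NNReal := fun A =>
    if h : A.det ≠ 0 then
      if Subsingleton E then 1 else
        ‖((A.toContinuousLinearEquivOfDetNeZero h).symm : E →L[ℝ] E)‖₊⁻¹ / 2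
    else 1
  have hr : ∀ A, r A ≠ 0 := by
    intro A
    simp only [r]
    split_ifs with h h'
    · exact one_ne_zero
    · have : Nontrivial E := not_subsingleton_iff_nontrivial.1 h'
      have := (A.toContinuousLinearEquivOfDetNeZero h).nnnorm_symm_pos
      positivity
    · exact one_ne_zero
  obtain ⟨t, A, htd, htm, hst, hap, hA⟩ := exists_partition_approximatesLinearOn_of_hasFDerivWithinAt
    f s' f' (fun x _ => (hf x).hasFDerivWithinAt) r hr
  have hinj : ∀ n, Set.InjOn f (s' ∩ t n) := by
    intro n
    rcases s'.eq_empty_or_nonempty with h | h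
    · simp [h]
    obtain ⟨y, hy, hAy⟩ := hA h n
    have hdy : (A n).det ≠ 0 := by rw [hAy]; exact hy.2
    have hn := hap n
    have := ApproximatesLinearOn.injOn
      (f' := (A n).toContinuousLinearEquivOfDetNeZero hdy) (c := r (A n)) (s := s' ∩ t n) (f := f)
      (by simpa using hn)
    refine this ?_
    by_cases hE : Subsingleton E
    · exact Or.inl hE
    right
    have : Nontrivial E := not_subsingleton_iff_nontrivial.1 hE
    have hp := ((A n).toContinuousLinearEquivOfDetNeZero hdy).nnnorm_symm_pos
    simp only [r, dif_pos hdy, if_neg hE]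
    exact NNReal.half_lt_self (inv_ne_zero hp.ne')
  have hmt : ∀ n, MeasurableSet (s' ∩ t n) := fun n => hs'm.inter (htm n)
  have hs'u : s' = ⋃ n, s' ∩ t n := by
    rw [← Set.inter_iUnion, Set.inter_eq_left.2 hst]
  have himm : ∀ n, MeasurableSet (f '' (s' ∩ t n)) := fun n =>
    measurable_image_of_fderivWithin (hmt n) (fun x _ => (hf x).hasFDerivWithinAt) (hinj n)
  -- Sard: almost every `y` has only regular preimages.
  have hcrit : μ (f '' {x | (f' x).det = 0}) = 0 :=
    addHaar_image_eq_zero_of_det_fderivWithin_eq_zero μ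
      (fun x _ => (hf x).hasFDerivWithinAt) fun x hx => hx
  rw [h1]
  calc ∫⁻ x in s', ENNReal.ofReal |(f' x).det| * g (f x) ∂μ
      = ∑' n, ∫⁻ x in s' ∩ t n, ENNReal.ofReal |(f' x).det| * g (f x) ∂μ := by
        conv_lhs => rw [hs'u]
        refine lintegral_iUnion hmt (fun i j hij => ?_) _
        exact (htd hij).mono Set.inter_subset_right Set.inter_subset_right
    _ = ∑' n, ∫⁻ y in f '' (s' ∩ t n), g y ∂μ := by
        refine tsum_congr fun n => ?_
        exact (lintegral_image_eq_lintegral_abs_det_fderiv_mul μ (hmt n)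
          (fun x _ => (hf x).hasFDerivWithinAt) (hinj n) g).symm
    _ = ∑' n, ∫⁻ y, (f '' (s' ∩ t n)).indicator g y ∂μ := by
        refine tsum_congr fun n => ?_
        rw [lintegral_indicator (himm n)]
    _ = ∫⁻ y, ∑' n, (f '' (s' ∩ t n)).indicator g y ∂μ :=
        (lintegral_tsum fun n => (hg.indicator (himm n)).aemeasurable).symm
    _ = ∫⁻ y, c * g y ∂μ := by
        refine lintegral_congr_ae ?_
        filter_upwards [hc, compl_mem_ae_iff.2 hcrit] with y hy hyc
        by_cases hgy : g y = 0
        · simp [hgy, Set.indicator]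
        have hcard := hy hgy
        have hset : {x | x ∈ s ∧ f x = y} = {x | x ∈ s' ∧ f x = y} := by
          ext x
          refine ⟨fun hx => ⟨⟨hx.1, fun h0 => hyc ⟨x, h0, hx.2⟩⟩, hx.2⟩, fun hx => ⟨hx.1.1, hx.2⟩⟩
        rw [hset] at hcard
        -- Each piece contains at most one preimage of `y`, so the indicator of its image is a sum
        -- over the preimages. Exchanging the two sums counts the preimages.
        have hind : ∀ n, (f '' (s' ∩ t n)).indicator g y =
            (∑' x : {x | x ∈ s' ∧ f x = y}, (t n).indicator (fun _ => (1 : ℝ≥0∞)) x.1) * g y := by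
          intro n
          by_cases hn : y ∈ f '' (s' ∩ t n)
          · obtain ⟨x, hx, hxy⟩ := hn
            rw [Set.indicator_of_mem (Set.mem_image_of_mem f hx |> fun h => by rwa [hxy] at h),
              tsum_eq_single (⟨x, hx.1, hxy⟩ : {x | x ∈ s' ∧ f x = y})]
            · rw [Set.indicator_of_mem hx.2, one_mul]
            · rintro ⟨x', hx', hxy'⟩ hne
              refine Set.indicator_of_notMem (fun hx't => hne ?_) _
              exact Subtype.ext (hinj n ⟨hx', hx't⟩ hx (hxy'.trans hxy.symm))
          · rw [Set.indicator_of_notMem hn]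
            symm
            rw [mul_eq_zero]; left
            rw [ENNReal.tsum_eq_zero]
            rintro ⟨x, hx, hxy⟩
            exact Set.indicator_of_notMem (fun hxt => hn ⟨x, ⟨hx, hxt⟩, hxy⟩) _
        simp_rw [hind]
        rw [ENNReal.tsum_mul_right, ENNReal.tsum_comm]
        congr 1
        have h2 : ∀ x : {x | x ∈ s' ∧ f x = y},
            ∑' n, (t n).indicator (fun _ => (1 : ℝ≥0∞)) x.1 = 1 := by
          rintro ⟨x, hx, -⟩
          obtain ⟨n, hn⟩ := Set.mem_iUnion.1 (hst hx)
          rw [tsum_eq_single n, Set.indicator_of_mem hn]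
          intro k hk
          exact Set.indicator_of_notMem (fun hk' => Set.disjoint_left.1 (htd hk) hk' hn) _
        simp_rw [h2]
        rw [ENNReal.tsum_set_one, hcard]
        simp
    _ = c * ∫⁻ y, g y ∂μ := lintegral_const_mul _ hg

/-- A measurable set meeting every line through a point in a countable set, or not containing
that point and meeting such lines in countable sets, is null. -/
theorem measure_eq_zero_of_countable_line {s : Set E} (hs : MeasurableSet s) (a : E)
    (h : ∀ x : E, {t : ℝ | a + t • x ∈ s}.Countable) : μ s = 0 := by
  have hm : Measurable fun p : E × ℝ => a + p.2 • p.1 := by fun_prop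
  -- Fubini in one order uses the countable lines; in the other order it yields some `t ≠ 0` whose
  -- slice, a homothetic copy of `s`, is null.
  have h0 : (μ.prod (volume : Measure ℝ)) ((fun p : E × ℝ => a + p.2 • p.1) ⁻¹' s) = 0 := by
    rw [Measure.measure_prod_null (hm hs)]
    exact Filter.Eventually.of_forall fun x => (h x).measure_zero _
  rw [← Measure.prod_swap, Measure.map_apply measurable_swap (hm hs),
    Measure.measure_prod_null (measurable_swap (hm hs))] at h0
  obtain ⟨t, ht, ht0⟩ : ∃ t : ℝ, μ ((fun x : E => a + t • x) ⁻¹' s) = 0 ∧ t ≠ 0 := by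
    have h2 : ∀ᵐ t : ℝ, t ≠ 0 := by simp [ae_iff]
    obtain ⟨t, ht⟩ := (h0.and h2).exists
    exact ⟨t, ht.1, ht.2⟩
  have h3 : (fun x : E => a + t • x) ⁻¹' s = (fun x => t • x) ⁻¹' ((fun x => a + x) ⁻¹' s) := rfl
  rw [h3, Measure.addHaar_preimage_smul μ ht0, measure_preimage_add] at ht
  simpa [ht0] using ht

/-- On each line through `a` the function is a polynomial that is non-zero at parameter 0, so it has
finitely many zeros there. -/
theorem measure_zeroLocus_eq_zero {f : E → ℝ} (hf : Continuous f) (a : E) (ha : f a ≠ 0)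
    (hp : ∀ x : E, ∃ q : Polynomial ℝ, ∀ t : ℝ, f (a + t • x) = q.eval t) :
    μ {x | f x = 0} = 0 := by
  refine measure_eq_zero_of_countable_line μ (hf.measurable (measurableSet_singleton 0)) a
    fun x => ?_
  obtain ⟨q, hq⟩ := hp x
  have hq0 : q ≠ 0 := by
    rintro rfl
    have := hq 0
    simp at this
    exact ha this
  refine (Polynomial.finite_setOfPred_isRoot hq0).countable.mono fun t ht => ?_
  simpa [Polynomial.IsRoot, ← hq] using ht

end Linear

end MeasureGeneralities

/-! ### Determinants of linear operators on spaces of matrices. -/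

section MatrixDeterminants

variable {ι κ : Type*} [Fintype ι] [Fintype κ] [DecidableEq ι] [DecidableEq κ]

/-- The linear map `v ↦ A v B` on matrices. -/
def Matrix.twoSidedMul (A : Matrix κ κ ℝ) (B : Matrix ι ι ℝ) :
    Matrix κ ι ℝ →ₗ[ℝ] Matrix κ ι ℝ where
  toFun v := A * v * B
  map_add' v w := by rw [Matrix.mul_add, Matrix.add_mul]
  map_smul' c v := by simp

/-- The Sylvester operator `v ↦ v G - P v`. -/
def Matrix.sylvester (G : Matrix ι ι ℝ) (P : Matrix κ κ ℝ) :
    Matrix κ ι ℝ →ₗ[ℝ] Matrix κ ι ℝ where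
  toFun v := v * G - P * v
  map_add' v w := by rw [Matrix.mul_add, Matrix.add_mul]; abel
  map_smul' c v := by simp [smul_sub]

@[simp] theorem Matrix.twoSidedMul_apply (A : Matrix κ κ ℝ) (B : Matrix ι ι ℝ)
    (v : Matrix κ ι ℝ) : Matrix.twoSidedMul A B v = A * v * B := rfl

@[simp] theorem Matrix.sylvester_apply (G : Matrix ι ι ℝ) (P : Matrix κ κ ℝ)
    (v : Matrix κ ι ℝ) : Matrix.sylvester G P v = v * G - P * v := rfl

/-- The entries of a matrix as a vector, by columns. -/
def matrixVecEquiv (κ ι : Type*) : Matrix κ ι ℝ ≃ₗ[ℝ] (ι × κ → ℝ) where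
  toFun v p := v p.2 p.1
  invFun w := Matrix.of fun a i => w (i, a)
  map_add' _ _ := rfl
  map_smul' _ _ := rfl
  left_inv _ := rfl
  right_inv _ := rfl

/-- Vectorised by columns, the operator is the Kronecker product of `Bᵀ` and `A`. -/
theorem Matrix.det_twoSidedMul (A : Matrix κ κ ℝ) (B : Matrix ι ι ℝ) :
    LinearMap.det (Matrix.twoSidedMul A B) = A.det ^ Fintype.card ι * B.det ^ Fintype.card κ := by
  rw [← LinearMap.det_conj _ (matrixVecEquiv κ ι)]
  have h : (matrixVecEquiv κ ι : Matrix κ ι ℝ →ₗ[ℝ] _) ∘ₗ Matrix.twoSidedMul A B ∘ₗ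
      ((matrixVecEquiv κ ι).symm : _ →ₗ[ℝ] Matrix κ ι ℝ) =
      Matrix.toLin' (Matrix.kronecker Bᵀ A) := by
    refine LinearMap.ext fun w => funext fun p => ?_
    change (A * Matrix.of (fun a i => w (i, a)) * B) p.2 p.1 = _
    simp only [Matrix.mul_apply, Matrix.toLin'_apply,
      Matrix.mulVec, dotProduct, Matrix.kroneckerMap_apply, Matrix.transpose_apply,
      Fintype.sum_prod_type, Finset.sum_mul, Matrix.of_apply, Matrix.kronecker]
    refine Finset.sum_congr rfl fun j _ => Finset.sum_congr rfl fun b _ => ?_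
    ring
  rw [h, LinearMap.det_toLin', Matrix.kronecker, Matrix.det_kronecker, Matrix.det_transpose, mul_comm]

/-- Vectorised by columns, the operator is the negative characteristic matrix of `Gᵀ` with `P`
substituted for the variable. Its blocks are polynomials in `P` and commute, so its determinant is
the determinant of the block determinant, which is the characteristic polynomial of `G` at `P` up to
sign. -/
theorem Matrix.abs_det_sylvester (G : Matrix ι ι ℝ) (P : Matrix κ κ ℝ) :
    |LinearMap.det (Matrix.sylvester G P)| = |(Polynomial.aeval P G.charpoly).det| := by
  rw [← LinearMap.det_conj _ (matrixVecEquiv κ ι)]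
  let f : Polynomial ℝ →+* Matrix κ κ ℝ := (Polynomial.aeval P : Polynomial ℝ →ₐ[ℝ] _).toRingHom
  have h : (matrixVecEquiv κ ι : Matrix κ ι ℝ →ₗ[ℝ] _) ∘ₗ Matrix.sylvester G P ∘ₗ
      ((matrixVecEquiv κ ι).symm : _ →ₗ[ℝ] Matrix κ ι ℝ) =
      Matrix.toLin' (((-(Matrix.charmatrix Gᵀ)).map f).comp ι ι κ κ ℝ) := by
    refine LinearMap.ext fun w => funext fun p => ?_
    have hf : ∀ i j, f ((-(Matrix.charmatrix Gᵀ)) i j) = G j i • (1 : Matrix κ κ ℝ) -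
        if i = j then P else 0 := by
      intro i j
      by_cases hij : i = j
      · subst hij
        simp [f, Matrix.charmatrix_apply_eq, Algebra.algebraMap_eq_smul_one]
      · simp [f, Matrix.charmatrix_apply_ne _ _ _ (Ne.symm hij), hij, Algebra.algebraMap_eq_smul_one]
    change (Matrix.of (fun a i => w (i, a)) * G - P * Matrix.of (fun a i => w (i, a))) p.2 p.1 = _
    simp only [Matrix.mul_apply, Matrix.toLin'_apply,
      Matrix.mulVec, dotProduct, Matrix.comp_apply, Matrix.map_apply, hf,
      Fintype.sum_prod_type, Matrix.of_apply, Matrix.sub_apply,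
      Matrix.smul_apply, Matrix.one_apply, sub_mul, Finset.sum_sub_distrib]
    congr 1
    · refine Finset.sum_congr rfl fun j _ => ?_
      simp [mul_comm]
    · rw [Finset.sum_eq_single p.1]
      · simp
      · intro j _ hj
        simp [hj.symm]
      · simp
  rw [h, LinearMap.det_toLin', ← Matrix.det_det, Matrix.det_neg]
  rcases Nat.even_or_odd (Fintype.card ι) with h | h
  · rw [h.neg_one_pow, one_mul, ← Matrix.charpoly, Matrix.charpoly_transpose]; rfl
  · rw [h.neg_one_pow, neg_one_mul, map_neg, Matrix.det_neg, abs_mul, ← Matrix.charpoly,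
      Matrix.charpoly_transpose]
    simp; rfl

theorem LinearMap.det_one_sub_comp_comm {V W : Type*} [AddCommGroup V] [Module ℝ V]
    [AddCommGroup W] [Module ℝ W] [Module.Free ℝ V] [Module.Finite ℝ V] [Module.Free ℝ W]
    [Module.Finite ℝ W] (f : V →ₗ[ℝ] W) (g : W →ₗ[ℝ] V) :
    LinearMap.det (LinearMap.id - f ∘ₗ g) = LinearMap.det (LinearMap.id - g ∘ₗ f) := by
  classical
  let b := Module.Free.chooseBasis ℝ V
  let c := Module.Free.chooseBasis ℝ W
  rw [← LinearMap.det_toMatrix b, ← LinearMap.det_toMatrix c, map_sub, map_sub,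
    LinearMap.toMatrix_comp c b c, LinearMap.toMatrix_comp b c b, LinearMap.toMatrix_id,
    LinearMap.toMatrix_id, Matrix.det_one_sub_mul_comm]

theorem LinearMap.det_pi_of_triangular {m : ℕ} {V : Type*} [AddCommGroup V] [Module ℝ V]
    [Module.Free ℝ V] [Module.Finite ℝ V] (T : (Fin m → V) →ₗ[ℝ] (Fin m → V))
    (a : Fin m → V →ₗ[ℝ] V) (hd : ∀ l v, T (Pi.single l v) l = a l v)
    (hT : ∀ j l v, j < l → T (Pi.single j v) l = 0) :
    LinearMap.det T = ∏ l, LinearMap.det (a l) := by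
  classical
  let b := Module.Free.chooseBasis ℝ V
  let B := Pi.basis fun _ : Fin m => b
  rw [← LinearMap.det_toMatrix B]
  have htri : (LinearMap.toMatrix B B T).BlockTriangular Sigma.fst := by
    rintro ⟨l, i⟩ ⟨j, k⟩ hlt
    rw [LinearMap.toMatrix_apply, Pi.basis_repr, Pi.basis_apply, hT _ _ _ hlt]
    simp
  rw [htri.det_fintype]
  refine Finset.prod_congr rfl fun l _ => ?_
  rw [← LinearMap.det_toMatrix b]
  let e : Module.Free.ChooseBasisIndex ℝ V ≃
      {p : (_ : Fin m) × Module.Free.ChooseBasisIndex ℝ V // p.1 = l} :=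
    { toFun := fun i => ⟨⟨l, i⟩, rfl⟩
      invFun := fun p => p.1.2
      left_inv := fun _ => rfl
      right_inv := by rintro ⟨⟨j, i⟩, rfl⟩; rfl }
  rw [← Matrix.det_submatrix_equiv_self e]
  congr 1
  ext i j
  simp only [Matrix.submatrix_apply, Matrix.toSquareBlock_def, Matrix.of_apply, e, Equiv.coe_fn_mk,
    LinearMap.toMatrix_apply]
  rw [Pi.basis_repr, Pi.basis_apply, hd]

end MatrixDeterminants

/-! ### Partial products of a sequence. -/

section TailProducts

/-- The ordered product of all factors from position `i` on. -/
def tailProd {M : Type*} [Monoid M] {m : ℕ} (X : Fin m → M) (i : ℕ) : M :=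
  ((List.ofFn X).drop i).prod

variable {M : Type*} [Monoid M] {m : ℕ} (X : Fin m → M)

theorem tailProd_zero : tailProd X 0 = (List.ofFn X).prod := rfl

theorem tailProd_of_le {i : ℕ} (h : m ≤ i) : tailProd X i = 1 := by
  rw [tailProd, List.drop_eq_nil_of_le (by simpa using h), List.prod_nil]

theorem tailProd_fin (l : Fin m) : tailProd X l = X l * tailProd X (l + 1) := by
  rw [tailProd, List.drop_eq_getElem_cons (by simp), List.prod_cons, tailProd]
  simp

end TailProducts

/-! ### Reduction of the cyclic Sylvester determinant to the products. -/

section CyclicDeterminant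

variable {ι κ : Type*} [Fintype ι] [Fintype κ] [DecidableEq ι] [DecidableEq κ]

/-- The cyclic Sylvester operator `u ↦ (u_l G_l - X_l u_{l+1})_l`. -/
def cyclicSylvester {r : ℕ} (G : Fin (r + 1) → Matrix ι ι ℝ) (X : Fin (r + 1) → Matrix κ κ ℝ) :
    (Fin (r + 1) → Matrix κ ι ℝ) →ₗ[ℝ] (Fin (r + 1) → Matrix κ ι ℝ) where
  toFun u l := u l * G l - X l * u (l + 1)
  map_add' u v := by
    funext l
    simp only [Pi.add_apply, Matrix.mul_add, Matrix.add_mul]; abel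
  map_smul' c u := by
    funext l
    simp [smul_sub]

theorem det_tailProd_ne_zero {m : ℕ} {G : Fin m → Matrix ι ι ℝ} (hG : ∀ l, (G l).det ≠ 0) (i : ℕ) :
    (tailProd G i).det ≠ 0 := by
  induction h : m - i generalizing i with
  | zero => rw [tailProd_of_le G (by omega)]; simp
  | succ k ih =>
    have hi : i < m := by omega
    have := tailProd_fin G ⟨i, hi⟩
    simp only at this
    rw [this, Matrix.det_mul]
    exact mul_ne_zero (hG _) (ih (i + 1) (by omega))

/-- Dropping the wrap-around term leaves a block triangular operator `T`. The wrap-around term is `T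
W u₀`, where `W` propagates the value at position 0 around the cycle; this is where the `G_l` must
be invertible. The identity for `det (1 - f g)` and `det (1 - g f)` reduces the perturbation to the
single block `v ↦ v - P v G⁻¹`, with `G` and `P` the products, and the diagonal of `T` supplies the
determinant of right multiplication by `G`. -/
theorem det_cyclicSylvester {r : ℕ} (G : Fin (r + 1) → Matrix ι ι ℝ)
    (X : Fin (r + 1) → Matrix κ κ ℝ) (hG : ∀ l, (G l).det ≠ 0) :
    LinearMap.det (cyclicSylvester G X) =
      LinearMap.det (Matrix.sylvester (List.ofFn G).prod (List.ofFn X).prod) := by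
  classical
  let T : (Fin (r + 1) → Matrix κ ι ℝ) →ₗ[ℝ] (Fin (r + 1) → Matrix κ ι ℝ) :=
    { toFun := fun u l => u l * G l - if l = Fin.last r then 0 else X l * u (l + 1)
      map_add' := fun u v => by
        funext l
        simp only [Pi.add_apply, Matrix.mul_add, Matrix.add_mul]
        split_ifs <;> abel
      map_smul' := fun c u => by
        funext l
        simp only [Pi.smul_apply, RingHom.id_apply, Matrix.mul_smul, Matrix.smul_mul, smul_sub]
        split_ifs <;> simp }
  let W : Matrix κ ι ℝ →ₗ[ℝ] (Fin (r + 1) → Matrix κ ι ℝ) :=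
    LinearMap.pi fun l => Matrix.twoSidedMul (tailProd X l) (tailProd G l)⁻¹
  have hinv : ∀ l : Fin (r + 1), (tailProd G (l : ℕ))⁻¹ * G l = (tailProd G (l + 1))⁻¹ := by
    intro l
    rw [tailProd_fin, Matrix.mul_inv_rev, Matrix.mul_assoc,
      Matrix.nonsing_inv_mul _ (hG l).isUnit, Matrix.mul_one]
  have hJ : cyclicSylvester G X = T ∘ₗ (LinearMap.id - W ∘ₗ LinearMap.proj 0) := by
    refine LinearMap.ext fun u => funext fun l => ?_
    simp only [cyclicSylvester, T, W, LinearMap.coe_mk, AddHom.coe_mk, LinearMap.comp_apply,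
      LinearMap.sub_apply, LinearMap.id_apply, Pi.sub_apply, LinearMap.pi_apply,
      LinearMap.proj_apply, Matrix.twoSidedMul_apply, Matrix.sub_mul, Matrix.mul_sub]
    rw [Matrix.mul_assoc _ _ (G l), hinv, tailProd_fin X l]
    by_cases hl : l = Fin.last r
    · subst hl
      rw [if_pos rfl, Fin.last_add_one, tailProd_of_le X (by simp), tailProd_of_le G (by simp)]
      simp
    · rw [if_neg hl]
      have hval : ((l + 1 : Fin (r + 1)) : ℕ) = l + 1 := Fin.val_add_one_of_lt (Fin.lt_last_iff_ne_last.2 hl)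
      rw [hval]
      simp only [Matrix.mul_assoc]
      abel
  have hT : LinearMap.det T = ∏ l, (G l).det ^ Fintype.card κ := by
    rw [LinearMap.det_pi_of_triangular T fun l => Matrix.twoSidedMul 1 (G l)]
    · simp [Matrix.det_twoSidedMul]
    · intro l v
      simp only [T, LinearMap.coe_mk, AddHom.coe_mk, Pi.single_eq_same, Matrix.twoSidedMul_apply,
        Matrix.one_mul]
      -- The cyclic successor of `l` is `l` itself only if `r = 0`, and then `l` is the last index.
      by_cases hl : l = Fin.last r
      · simp [hl]
      · have : l + 1 ≠ l := by
          intro h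
          have hval : ((l + 1 : Fin (r + 1)) : ℕ) = l + 1 :=
            Fin.val_add_one_of_lt (Fin.lt_last_iff_ne_last.2 hl)
          rw [h] at hval; omega
        simp [hl, this]
    · intro j l v hjl
      simp only [T, LinearMap.coe_mk, AddHom.coe_mk]
      rw [Pi.single_eq_of_ne hjl.ne', Matrix.zero_mul, zero_sub, neg_eq_zero]
      split_ifs with hl
      · rfl
      · have hval : ((l + 1 : Fin (r + 1)) : ℕ) = l + 1 :=
            Fin.val_add_one_of_lt (Fin.lt_last_iff_ne_last.2 hl)
        rw [Pi.single_eq_of_ne, Matrix.mul_zero]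
        intro h
        rw [← h] at hjl
        have := Fin.lt_def.1 hjl
        omega
  have hΓ : (∏ l, (G l).det ^ Fintype.card κ) =
      LinearMap.det (Matrix.twoSidedMul (κ := κ) 1 (List.ofFn G).prod) := by
    rw [Matrix.det_twoSidedMul, Matrix.det_one, one_pow, one_mul, Finset.prod_pow]
    congr 1
    rw [← Matrix.coe_detMonoidHom, map_list_prod, List.map_ofFn, List.prod_ofFn]
    rfl
  rw [hJ, LinearMap.det_comp, LinearMap.det_one_sub_comp_comm, hT, hΓ, ← LinearMap.det_comp]
  congr 1
  refine LinearMap.ext fun v => ?_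
  simp only [LinearMap.comp_apply, LinearMap.sub_apply, LinearMap.id_apply, LinearMap.proj_apply, W,
    LinearMap.pi_apply, Matrix.twoSidedMul_apply, Matrix.sylvester_apply, Matrix.one_mul,
    Matrix.sub_mul, Fin.val_zero, tailProd_zero]
  rw [Matrix.mul_assoc _ _ (List.ofFn G).prod, Matrix.nonsing_inv_mul, Matrix.mul_one]
  exact (det_tailProd_ne_zero hG 0).isUnit

end CyclicDeterminant

/-! ### Lebesgue measure and Gaussian weights on matrices. -/

section MatrixMeasure

/-- Lebesgue measure on real matrices. -/
@[reducible] noncomputable def matrixMeasureSpace (α β : Type*) [Fintype α] [Fintype β] :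
    MeasureSpace (Matrix α β ℝ) :=
  (inferInstance : MeasureSpace (α → β → ℝ))

attribute [local instance] matrixMeasureSpace

variable {α β γ ι κ : Type*} [Fintype α] [Fintype β] [Fintype γ] [Fintype ι] [Fintype κ]
  [DecidableEq α] [DecidableEq β] [DecidableEq ι] [DecidableEq κ]

theorem matrix_borelSpace (α β : Type*) [Fintype α] [Fintype β] : BorelSpace (Matrix α β ℝ) :=
  (inferInstance : BorelSpace (α → β → ℝ))

theorem matrix_isAddHaarMeasure (α β : Type*) [Fintype α] [Fintype β] :
    (volume : Measure (Matrix α β ℝ)).IsAddHaarMeasure :=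
  Measure.instIsAddHaarMeasureForallVolumeOfMeasurableAddOfSigmaFinite (G := fun _ : α => β → ℝ)

theorem matrix_sigmaFinite (α β : Type*) [Fintype α] [Fintype β] :
    SigmaFinite (volume : Measure (Matrix α β ℝ)) :=
  (inferInstance : SigmaFinite (volume : Measure (α → β → ℝ)))

theorem matrix_secondCountable (α β : Type*) [Fintype α] [Fintype β] :
    SecondCountableTopology (Matrix α β ℝ) :=
  (inferInstance : SecondCountableTopology (α → β → ℝ))

attribute [local instance] matrix_borelSpace matrix_isAddHaarMeasure matrix_sigmaFinite
  matrix_secondCountable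


/-- The lower left block is the outermost coordinate because it is the one exchanged for the graph
variable while the other three are fixed. -/
theorem volume_preserving_blocks : MeasurePreserving
    (fun p : ((Matrix ι ι ℝ × Matrix κ κ ℝ) × Matrix ι κ ℝ) × Matrix κ ι ℝ =>
      Matrix.fromBlocks p.1.1.1 p.1.2 p.2 p.1.1.2) := by
  have h1 : MeasurePreserving (fun p : ((ι → ℝ) × (κ → ℝ)) =>
      (MeasurableEquiv.sumPiEquivProdPi (fun _ : ι ⊕ κ => ℝ)).symm p) volume volume :=
    volume_measurePreserving_sumPiEquivProdPi_symm (fun _ : ι ⊕ κ => ℝ)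
  have h2 : MeasurePreserving (fun (p : (ι → ι → ℝ) × (ι → κ → ℝ)) (i : ι) =>
      (MeasurableEquiv.sumPiEquivProdPi (fun _ : ι ⊕ κ => ℝ)).symm (p.1 i, p.2 i)) :=
    (volume_preserving_pi (fun _ : ι => h1)).comp
      (volume_measurePreserving_arrowProdEquivProdArrow (ι → ℝ) (κ → ℝ) ι).symm
  have h2' : MeasurePreserving (fun (p : (κ → ι → ℝ) × (κ → κ → ℝ)) (i : κ) =>
      (MeasurableEquiv.sumPiEquivProdPi (fun _ : ι ⊕ κ => ℝ)).symm (p.1 i, p.2 i)) :=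
    (volume_preserving_pi (fun _ : κ => h1)).comp
      (volume_measurePreserving_arrowProdEquivProdArrow (ι → ℝ) (κ → ℝ) κ).symm
  have h3 := (volume_measurePreserving_sumPiEquivProdPi_symm
    (fun _ : ι ⊕ κ => (ι ⊕ κ → ℝ))).comp (h2.prod h2')
  have h4 : MeasurePreserving
      (fun p : (((ι → ι → ℝ) × (κ → κ → ℝ)) × (ι → κ → ℝ)) × (κ → ι → ℝ) =>
        ((p.1.1.1, p.1.2), (p.2, p.1.1.2))) := by
    have s1 : MeasurePreserving (fun p : (((ι → ι → ℝ) × (κ → κ → ℝ)) × (ι → κ → ℝ)) × (κ → ι → ℝ) =>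
        ((p.1.1.1, (p.1.1.2, p.1.2)), p.2)) :=
      (volume_preserving_prodAssoc).prod (MeasurePreserving.id _)
    have s2 : MeasurePreserving (fun p : ((ι → ι → ℝ) × ((κ → κ → ℝ) × (ι → κ → ℝ))) × (κ → ι → ℝ) =>
        ((p.1.1, (p.1.2.2, p.1.2.1)), p.2)) :=
      ((MeasurePreserving.id _).prod Measure.measurePreserving_swap).prod (MeasurePreserving.id _)
    have s3 : MeasurePreserving (fun p : ((ι → ι → ℝ) × ((ι → κ → ℝ) × (κ → κ → ℝ))) × (κ → ι → ℝ) =>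
        (((p.1.1, p.1.2.1), p.1.2.2), p.2)) :=
      (volume_preserving_prodAssoc.symm).prod (MeasurePreserving.id _)
    have s4 : MeasurePreserving (fun p : (((ι → ι → ℝ) × (ι → κ → ℝ)) × (κ → κ → ℝ)) × (κ → ι → ℝ) =>
        ((p.1.1, (p.1.2, p.2)))) := volume_preserving_prodAssoc
    have s5 : MeasurePreserving (fun p : ((ι → ι → ℝ) × (ι → κ → ℝ)) × ((κ → κ → ℝ) × (κ → ι → ℝ)) =>
        (p.1, p.2.swap)) := (MeasurePreserving.id _).prod Measure.measurePreserving_swap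
    exact s5.comp (s4.comp (s3.comp (s2.comp s1)))
  have h5 := h3.comp h4
  obtain ⟨f, hf, hfe⟩ : ∃ f : (((ι → ι → ℝ) × (κ → κ → ℝ)) × (ι → κ → ℝ)) × (κ → ι → ℝ) →
      (ι ⊕ κ → ι ⊕ κ → ℝ), MeasurePreserving f volume volume ∧
      ∀ p, f p = Matrix.fromBlocks p.1.1.1 p.1.2 p.2 p.1.1.2 :=
    ⟨_, h5, fun p => by funext i j; rcases i with i | i <;> rcases j with j | j <;> rfl⟩
  rw [funext hfe] at hf
  exact hf

theorem volume_preserving_seq_blocks (m : ℕ) : MeasurePreserving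
    (fun (p : (((Fin m → Matrix ι ι ℝ) × (Fin m → Matrix κ κ ℝ)) × (Fin m → Matrix ι κ ℝ)) ×
      (Fin m → Matrix κ ι ℝ)) (l : Fin m) =>
      Matrix.fromBlocks (p.1.1.1 l) (p.1.2 l) (p.2 l) (p.1.1.2 l)) := by
  have h1 := volume_preserving_pi (fun _ : Fin m => volume_preserving_blocks (ι := ι) (κ := κ))
  have s1 := (volume_measurePreserving_arrowProdEquivProdArrow
    ((Matrix ι ι ℝ × Matrix κ κ ℝ) × Matrix ι κ ℝ) (Matrix κ ι ℝ) (Fin m)).symm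
  have s2 := (volume_measurePreserving_arrowProdEquivProdArrow
    (Matrix ι ι ℝ × Matrix κ κ ℝ) (Matrix ι κ ℝ) (Fin m)).symm
  have s3 := (volume_measurePreserving_arrowProdEquivProdArrow
    (Matrix ι ι ℝ) (Matrix κ κ ℝ) (Fin m)).symm
  exact h1.comp (s1.comp ((s2.comp (s3.prod (MeasurePreserving.id _))).prod
    (MeasurePreserving.id _)))

/-- The sum of the squares of the entries. -/
def Matrix.frobSq (M : Matrix α β ℝ) : ℝ := ∑ i, ∑ j, M i j ^ 2

theorem Matrix.frobSq_eq_trace (M : Matrix α β ℝ) : M.frobSq = (M * Mᵀ).trace := by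
  simp [frobSq, Matrix.trace, Matrix.mul_apply, sq]

theorem Matrix.frobSq_eq_trace' (M : Matrix α β ℝ) : M.frobSq = (Mᵀ * M).trace := by
  rw [frobSq_eq_trace, Matrix.trace_mul_comm]

theorem Matrix.frobSq_fromBlocks (A : Matrix ι ι ℝ) (B : Matrix ι κ ℝ) (C : Matrix κ ι ℝ)
    (D : Matrix κ κ ℝ) :
    (Matrix.fromBlocks A B C D).frobSq = A.frobSq + B.frobSq + C.frobSq + D.frobSq := by
  simp only [frobSq, Fintype.sum_sum_type, Matrix.fromBlocks_apply₁₁, Matrix.fromBlocks_apply₁₂,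
    Matrix.fromBlocks_apply₂₁, Matrix.fromBlocks_apply₂₂, Finset.sum_add_distrib]
  ring

/-- The unnormalised Gaussian weight of a matrix. -/
noncomputable def gaussWeight (M : Matrix α β ℝ) : ℝ≥0∞ :=
  ENNReal.ofReal (Real.exp (-M.frobSq / 2))

theorem continuous_frobSq : Continuous (Matrix.frobSq : Matrix α β ℝ → ℝ) := by
  unfold Matrix.frobSq
  fun_prop

theorem measurable_gaussWeight : Measurable (gaussWeight : Matrix α β ℝ → ℝ≥0∞) := by
  unfold gaussWeight
  have := (continuous_frobSq (α := α) (β := β)).measurable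
  fun_prop

theorem lintegral_gauss_real :
    ∫⁻ t : ℝ, ENNReal.ofReal (Real.exp (-t ^ 2 / 2)) = ENNReal.ofReal (Real.sqrt (2 * Real.pi)) := by
  have h := integral_gaussian (1 / 2)
  have hi := integrable_exp_neg_mul_sq (b := 1 / 2) (by norm_num)
  have he : ∀ t : ℝ, Real.exp (-t ^ 2 / 2) = Real.exp (-(1 / 2) * t ^ 2) := fun t => by
    congr 1; ring
  simp_rw [he]
  rw [← ofReal_integral_eq_lintegral_ofReal hi (Filter.Eventually.of_forall fun t =>
    (Real.exp_pos _).le), h]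
  congr 2; ring

theorem lintegral_gaussWeight : ∫⁻ M : Matrix α β ℝ, gaussWeight M =
    ENNReal.ofReal (Real.sqrt (2 * Real.pi)) ^ (Fintype.card α * Fintype.card β) := by
  have h : ∀ M : α → β → ℝ, gaussWeight (Matrix.of M) =
      ∏ i, ∏ j, ENNReal.ofReal (Real.exp (-M i j ^ 2 / 2)) := by
    intro M
    simp_rw [← ENNReal.ofReal_prod_of_nonneg fun _ _ => (Real.exp_pos _).le, ← Real.exp_sum]
    rw [gaussWeight, ← ENNReal.ofReal_prod_of_nonneg fun _ _ => (Real.exp_pos _).le, ← Real.exp_sum]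
    simp [Matrix.frobSq, Finset.sum_div, Finset.sum_neg_distrib, neg_div]
  change ∫⁻ M : α → β → ℝ, gaussWeight (Matrix.of M) = _
  simp_rw [h]
  have hm : Measurable fun t : ℝ => ENNReal.ofReal (Real.exp (-t ^ 2 / 2)) := by fun_prop
  rw [volume_pi, lintegral_fintype_prod_eq_prod (f := fun (_ : α) (v : β → ℝ) =>
    ∏ j, ENNReal.ofReal (Real.exp (-v j ^ 2 / 2))) (fun _ => by fun_prop)]
  rw [volume_pi, lintegral_fintype_prod_eq_prod (f := fun (_ : β) (t : ℝ) =>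
    ENNReal.ofReal (Real.exp (-t ^ 2 / 2))) (fun _ => hm), lintegral_gauss_real]
  simp [← pow_mul, mul_comm]

theorem lintegral_twoSidedMul {A : Matrix κ κ ℝ} {B : Matrix ι ι ℝ} (hA : A.det ≠ 0)
    (hB : B.det ≠ 0) (f : Matrix κ ι ℝ → ℝ≥0∞) :
    ENNReal.ofReal (|A.det| ^ Fintype.card ι * |B.det| ^ Fintype.card κ) *
      ∫⁻ X : Matrix κ ι ℝ, f (A * X * B) = ∫⁻ X : Matrix κ ι ℝ, f X := by
  have hd : LinearMap.det (Matrix.twoSidedMul A B) ≠ 0 := by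
    rw [Matrix.det_twoSidedMul]; positivity
  have h := lintegral_comp_linearMap (E := κ → ι → ℝ) volume (Matrix.twoSidedMul A B) hd f
  have h2 : LinearMap.det (M := κ → ι → ℝ) (Matrix.twoSidedMul A B) = _ :=
    Matrix.det_twoSidedMul A B
  have h3 : |LinearMap.det (M := κ → ι → ℝ) (Matrix.twoSidedMul A B)| =
      |A.det| ^ Fintype.card ι * |B.det| ^ Fintype.card κ := by
    rw [← abs_pow, ← abs_pow, ← abs_mul]; exact congrArg abs h2
  exact (congrArg (fun c => ENNReal.ofReal c * ∫⁻ X : Matrix κ ι ℝ, f (A * X * B)) h3).symm.trans h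

end MatrixMeasure

/-! ### The Riccati change of variables. -/

section Deflation

attribute [local instance] matrixMeasureSpace matrix_borelSpace matrix_isAddHaarMeasure
  matrix_sigmaFinite matrix_secondCountable

variable {ι κ : Type*} [Fintype ι] [Fintype κ] [DecidableEq ι] [DecidableEq κ] {r : ℕ}

/-- The right-hand side of the cyclic Riccati equation for invariant subspaces. -/
def riccati (A : Fin (r + 1) → Matrix ι ι ℝ) (B : Fin (r + 1) → Matrix ι κ ℝ)
    (D : Fin (r + 1) → Matrix κ κ ℝ) (U : Fin (r + 1) → Matrix κ ι ℝ) :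
    Fin (r + 1) → Matrix κ ι ℝ :=
  fun l => U l * (A l + B l * U (l + 1)) - D l * U (l + 1)

/-- The Riccati map on functions of three indices. -/
def riccatiFun (A : Fin (r + 1) → Matrix ι ι ℝ) (B : Fin (r + 1) → Matrix ι κ ℝ)
    (D : Fin (r + 1) → Matrix κ κ ℝ) (U : Fin (r + 1) → κ → ι → ℝ) :
    Fin (r + 1) → κ → ι → ℝ :=
  riccati A B D (fun l => Matrix.of (U l))

theorem isAddHaarMeasure_pi_pi (κ ι : Type*) [Fintype κ] [Fintype ι] :
    (volume : Measure (κ → ι → ℝ)).IsAddHaarMeasure :=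
  Measure.instIsAddHaarMeasureForallVolumeOfMeasurableAddOfSigmaFinite (G := fun _ : κ => ι → ℝ)

theorem isAddHaarMeasure_pi_pi_pi (m : ℕ) (κ ι : Type*) [Fintype κ] [Fintype ι] :
    (volume : Measure (Fin m → κ → ι → ℝ)).IsAddHaarMeasure :=
  haveI := isAddHaarMeasure_pi_pi κ ι
  Measure.instIsAddHaarMeasureForallVolumeOfMeasurableAddOfSigmaFinite
    (G := fun _ : Fin m => κ → ι → ℝ)

theorem isAddHaarMeasure_seq (m : ℕ) (κ ι : Type*) [Fintype κ] [Fintype ι] :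
    (volume : Measure (Fin m → Matrix κ ι ℝ)).IsAddHaarMeasure :=
  Measure.instIsAddHaarMeasureForallVolumeOfMeasurableAddOfSigmaFinite
    (G := fun _ : Fin m => Matrix κ ι ℝ)

theorem isAddHaarMeasure_seq_prod (m : ℕ) (κ ι : Type*) [Fintype κ] [Fintype ι] :
    (volume : Measure ((Fin m → Matrix ι ι ℝ) × (Fin m → Matrix κ κ ℝ))).IsAddHaarMeasure :=
  haveI := isAddHaarMeasure_seq m ι ι
  haveI := isAddHaarMeasure_seq m κ κ
  Measure.prod.instIsAddHaarMeasure volume volume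

attribute [local instance] isAddHaarMeasure_pi_pi_pi isAddHaarMeasure_seq isAddHaarMeasure_seq_prod

theorem contDiff_riccati (A : Fin (r + 1) → Matrix ι ι ℝ) (B : Fin (r + 1) → Matrix ι κ ℝ)
    (D : Fin (r + 1) → Matrix κ κ ℝ) :
    ContDiff ℝ 1 (riccatiFun A B D) := by
  refine contDiff_pi.2 fun l => contDiff_pi.2 fun a => contDiff_pi.2 fun i => ?_
  simp only [riccatiFun, riccati, Matrix.sub_apply, Matrix.mul_apply, Matrix.add_apply, Matrix.of_apply]
  fun_prop

/-- The map is quadratic in `U`, so on a line it is a quadratic polynomial in the parameter, whose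
linear coefficient is the cyclic Sylvester operator of the deflated blocks. -/
theorem fderiv_riccati (A : Fin (r + 1) → Matrix ι ι ℝ) (B : Fin (r + 1) → Matrix ι κ ℝ)
    (D : Fin (r + 1) → Matrix κ κ ℝ) (U h : Fin (r + 1) → κ → ι → ℝ) :
    fderiv ℝ (riccatiFun A B D) U h =
    cyclicSylvester (fun l => A l + B l * Matrix.of (U (l + 1)))
      (fun l => D l - Matrix.of (U l) * B l) (fun l => Matrix.of (h l)) := by
  have hd := ((contDiff_riccati A B D).differentiable one_ne_zero U)
  rw [← hd.lineDeriv_eq_fderiv, lineDeriv]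
  refine HasDerivAt.deriv ?_
  set J := cyclicSylvester (fun l => A l + B l * Matrix.of (U (l + 1)))
      (fun l => D l - Matrix.of (U l) * B l) (fun l => Matrix.of (h l)) with hJ
  set c0 := riccati A B D (fun l => Matrix.of (U l))
  let Q : Fin (r + 1) → Matrix κ ι ℝ := fun l => Matrix.of (h l) * (B l * Matrix.of (h (l + 1)))
  have key : ∀ t : ℝ, (riccati A B D (fun l => Matrix.of ((U + t • h) l))) =
      fun l => c0 l + t • J l + (t ^ 2) • Q l := by
    intro t
    funext l
    have e1 : ∀ l, Matrix.of ((U + t • h) l) = Matrix.of (U l) + t • Matrix.of (h l) := fun _ => rfl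
    simp only [riccati, c0, hJ, cyclicSylvester, LinearMap.coe_mk, AddHom.coe_mk, Q, e1]
    simp only [Matrix.mul_add, Matrix.add_mul, Matrix.sub_mul, Matrix.mul_smul, Matrix.smul_mul,
      smul_add, smul_sub, smul_smul, Matrix.mul_assoc, sq]
    abel
  refine hasDerivAt_pi.2 fun l => hasDerivAt_pi.2 fun a => hasDerivAt_pi.2 fun i => ?_
  have e2 : (fun t : ℝ => riccati A B D (fun l => Matrix.of ((U + t • h) l)) l a i) =
      fun t => c0 l a i + t * J l a i + t ^ 2 * Q l a i := by
    funext t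
    rw [key t]
    rfl
  change HasDerivAt (fun t : ℝ => riccati A B D (fun l => Matrix.of ((U + t • h) l)) l a i) _ _
  rw [e2]
  have := (((hasDerivAt_id (0 : ℝ)).mul_const (J l a i)).const_add (c0 l a i)).add
    (((hasDerivAt_id (0 : ℝ)).pow 2).mul_const (Q l a i))
  simp only [id_eq, one_mul, ne_eq, OfNat.ofNat_ne_zero, not_false_eq_true] at this
  convert! this using 1
  simp

theorem det_fderiv_riccati (A : Fin (r + 1) → Matrix ι ι ℝ) (B : Fin (r + 1) → Matrix ι κ ℝ)
    (D : Fin (r + 1) → Matrix κ κ ℝ) (U : Fin (r + 1) → κ → ι → ℝ) :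
    (fderiv ℝ (riccatiFun A B D) U).det =
    LinearMap.det (cyclicSylvester (fun l => A l + B l * Matrix.of (U (l + 1)))
      (fun l => D l - Matrix.of (U l) * B l)) := by
  have h : ((fderiv ℝ (riccatiFun A B D) U) :
      (Fin (r + 1) → κ → ι → ℝ) →ₗ[ℝ] (Fin (r + 1) → κ → ι → ℝ)) =
      cyclicSylvester (fun l => A l + B l * Matrix.of (U (l + 1)))
      (fun l => D l - Matrix.of (U l) * B l) :=
    LinearMap.ext fun h => fderiv_riccati A B D U h
  exact congrArg LinearMap.det h

theorem continuous_det_cyclicSylvester : Continuous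
    fun p : (Fin (r + 1) → Matrix ι ι ℝ) × (Fin (r + 1) → Matrix κ κ ℝ) =>
      LinearMap.det (cyclicSylvester p.1 p.2) := by
  let b := Module.finBasis ℝ (Fin (r + 1) → Matrix κ ι ℝ)
  simp_rw [← LinearMap.det_toMatrix b]
  refine Continuous.matrix_det (continuous_matrix fun i j => ?_)
  simp_rw [LinearMap.toMatrix_apply]
  have h1 : Continuous (b.coord i) := LinearMap.continuous_of_finiteDimensional _
  refine h1.comp ?_
  simp only [cyclicSylvester, LinearMap.coe_mk, AddHom.coe_mk]
  fun_prop

theorem lintegral_riccati (A : Fin (r + 1) → Matrix ι ι ℝ) (B : Fin (r + 1) → Matrix ι κ ℝ)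
    (D : Fin (r + 1) → Matrix κ κ ℝ) {s : Set (Fin (r + 1) → Matrix κ ι ℝ)} (hs : MeasurableSet s)
    {g : (Fin (r + 1) → Matrix κ ι ℝ) → ℝ≥0∞} (hg : Measurable g) {c : ℕ}
    (hc : ∀ᵐ C, g C ≠ 0 → {U | U ∈ s ∧ riccati A B D U = C}.encard = c) :
    ∫⁻ U in s, ENNReal.ofReal |LinearMap.det (cyclicSylvester (fun l => A l + B l * U (l + 1))
        (fun l => D l - U l * B l))| * g (riccati A B D U) = c * ∫⁻ C, g C := by
  have h := lintegral_abs_det_fderiv_mul_of_encard_eq (E := Fin (r + 1) → κ → ι → ℝ) volume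
    (f := riccatiFun A B D)
    (f' := fderiv ℝ (riccatiFun A B D))
    (fun U => ((contDiff_riccati A B D).differentiable one_ne_zero U).hasFDerivAt)
    ((contDiff_riccati A B D).continuous_fderiv one_ne_zero) hs hg hc
  refine Eq.trans (lintegral_congr fun U => ?_) h
  exact congrArg (fun d => ENNReal.ofReal |d| * g (riccati A B D U))
    (det_fderiv_riccati A B D U).symm

/-- The matrices `L_l T_l L_{l+1}⁻¹` with `L_l` unipotent lower triangular with lower left block
`U_l`, and `T_l` upper block triangular with blocks `G_l`, `B_l`, `X_l`. -/
def deflationBlocks (U : Fin (r + 1) → Matrix κ ι ℝ) (B : Fin (r + 1) → Matrix ι κ ℝ)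
    (p : (Fin (r + 1) → Matrix ι ι ℝ) × (Fin (r + 1) → Matrix κ κ ℝ)) :
    Fin (r + 1) → Matrix (ι ⊕ κ) (ι ⊕ κ) ℝ :=
  fun l => Matrix.fromBlocks (p.1 l - B l * U (l + 1)) (B l)
    (U l * p.1 l - (p.2 l + U l * B l) * U (l + 1)) (p.2 l + U l * B l)

/-- The graphs that are cyclically invariant under a sequence of matrices. -/
def invariantGraphs (S : Set (Fin (r + 1) → Matrix ι ι ℝ))
    (X : Fin (r + 1) → Matrix (ι ⊕ κ) (ι ⊕ κ) ℝ) : Set (Fin (r + 1) → Matrix κ ι ℝ) :=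
  {U | (fun l => (X l).toBlocks₁₁ + (X l).toBlocks₁₂ * U (l + 1)) ∈ S ∧
    riccati (fun l => (X l).toBlocks₁₁) (fun l => (X l).toBlocks₁₂) (fun l => (X l).toBlocks₂₂) U =
      fun l => (X l).toBlocks₂₁}

/-- For fixed `A, B, D` the area formula trades `C` for `U`, with the invariant graphs as preimages.
For fixed `U` and `B`, a translation of `A` and `D` then makes the diagonal blocks of the deflated
factors the variables of integration. -/
theorem lintegral_eq_deflationBlocks {S : Set (Fin (r + 1) → Matrix ι ι ℝ)} (hS : MeasurableSet S)
    {f : (Fin (r + 1) → Matrix (ι ⊕ κ) (ι ⊕ κ) ℝ) → ℝ≥0∞} (hf : Measurable f) {c : ℕ}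
    (hc : ∀ᵐ X, f X ≠ 0 → (invariantGraphs S X).encard = c) :
    c * ∫⁻ X, f X = ∫⁻ U : Fin (r + 1) → Matrix κ ι ℝ, ∫⁻ B : Fin (r + 1) → Matrix ι κ ℝ,
      ∫⁻ p : (Fin (r + 1) → Matrix ι ι ℝ) × (Fin (r + 1) → Matrix κ κ ℝ),
        ENNReal.ofReal |LinearMap.det (cyclicSylvester (κ := κ) p.1 p.2)| *
          S.indicator (fun _ => 1) p.1 * f (deflationBlocks U B p) := by
  have hmp := volume_preserving_seq_blocks (ι := ι) (κ := κ) (r + 1)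
  have hc' := Measure.ae_ae_of_ae_prod (hmp.quasiMeasurePreserving.ae hc)
  let F : (((Fin (r + 1) → Matrix ι ι ℝ) × (Fin (r + 1) → Matrix κ κ ℝ)) ×
      (Fin (r + 1) → Matrix ι κ ℝ)) × (Fin (r + 1) → Matrix κ ι ℝ) → ℝ≥0∞ := fun q =>
    ENNReal.ofReal |LinearMap.det (cyclicSylvester
      (fun l => q.1.1.1 l + q.1.2 l * q.2 (l + 1)) (fun l => q.1.1.2 l - q.2 l * q.1.2 l))| *
      S.indicator (fun _ => 1) (fun l => q.1.1.1 l + q.1.2 l * q.2 (l + 1)) *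
      f (fun l => Matrix.fromBlocks (q.1.1.1 l) (q.1.2 l)
        (riccati q.1.1.1 q.1.2 q.1.1.2 q.2 l) (q.1.1.2 l))
  have hGm : Continuous fun q : (((Fin (r + 1) → Matrix ι ι ℝ) × (Fin (r + 1) → Matrix κ κ ℝ)) ×
      (Fin (r + 1) → Matrix ι κ ℝ)) × (Fin (r + 1) → Matrix κ ι ℝ) =>
      (fun l => q.1.1.1 l + q.1.2 l * q.2 (l + 1)) := by fun_prop
  have hXm : Continuous fun q : (((Fin (r + 1) → Matrix ι ι ℝ) × (Fin (r + 1) → Matrix κ κ ℝ)) ×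
      (Fin (r + 1) → Matrix ι κ ℝ)) × (Fin (r + 1) → Matrix κ ι ℝ) =>
      (fun l => q.1.1.2 l - q.2 l * q.1.2 l) := by fun_prop
  have hRm : Continuous fun q : (((Fin (r + 1) → Matrix ι ι ℝ) × (Fin (r + 1) → Matrix κ κ ℝ)) ×
      (Fin (r + 1) → Matrix ι κ ℝ)) × (Fin (r + 1) → Matrix κ ι ℝ) =>
      (fun l => Matrix.fromBlocks (q.1.1.1 l) (q.1.2 l)
        (riccati q.1.1.1 q.1.2 q.1.1.2 q.2 l) (q.1.1.2 l)) := by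
    unfold riccati
    refine continuous_pi fun l => Continuous.matrix_fromBlocks ?_ ?_ ?_ ?_ <;> fun_prop
  have hFm : Measurable F := by
    refine Measurable.mul (Measurable.mul ?_ ?_) (hf.comp hRm.measurable)
    · exact (ENNReal.continuous_ofReal.comp (continuous_abs.comp
        (continuous_det_cyclicSylvester.comp (hGm.prodMk hXm)))).measurable
    · exact (measurable_const.indicator hS).comp hGm.measurable
  calc c * ∫⁻ X, f X
      = c * ∫⁻ z : ((Fin (r + 1) → Matrix ι ι ℝ) × (Fin (r + 1) → Matrix κ κ ℝ)) ×
          (Fin (r + 1) → Matrix ι κ ℝ),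
        ∫⁻ C : Fin (r + 1) → Matrix κ ι ℝ, f (fun l => Matrix.fromBlocks (z.1.1 l) (z.2 l) (C l) (z.1.2 l)) := by
        rw [← hmp.lintegral_comp hf, Measure.volume_eq_prod, lintegral_prod]
        exact (hf.comp hmp.measurable).aemeasurable
    _ = ∫⁻ z : ((Fin (r + 1) → Matrix ι ι ℝ) × (Fin (r + 1) → Matrix κ κ ℝ)) ×
          (Fin (r + 1) → Matrix ι κ ℝ),
        c * ∫⁻ C : Fin (r + 1) → Matrix κ ι ℝ, f (fun l => Matrix.fromBlocks (z.1.1 l) (z.2 l) (C l) (z.1.2 l)) := by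
        rw [lintegral_const_mul]
        exact Measurable.lintegral_prod_right' (hf.comp hmp.measurable)
    _ = ∫⁻ z, ∫⁻ U, F (z, U) := by
        refine lintegral_congr_ae ?_
        filter_upwards [hc'] with z hz
        have hsm : MeasurableSet {U : Fin (r + 1) → Matrix κ ι ℝ |
            (fun l => z.1.1 l + z.2 l * U (l + 1)) ∈ S} := by
          have : Continuous fun U : Fin (r + 1) → Matrix κ ι ℝ =>
            (fun l => z.1.1 l + z.2 l * U (l + 1)) := by fun_prop
          exact this.measurable hS
        have hgm : Measurable fun C : Fin (r + 1) → Matrix κ ι ℝ =>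
            f (fun l => Matrix.fromBlocks (z.1.1 l) (z.2 l) (C l) (z.1.2 l)) :=
          hf.comp (hmp.measurable.comp measurable_prodMk_left)
        rw [← lintegral_riccati z.1.1 z.2 z.1.2 hsm hgm, ← lintegral_indicator hsm]
        · refine lintegral_congr fun U => ?_
          by_cases hU : (fun l => z.1.1 l + z.2 l * U (l + 1)) ∈ S
          · rw [Set.indicator_of_mem (by exact hU)]
            simp only [F]
            rw [Set.indicator_of_mem hU, mul_one]
          · rw [Set.indicator_of_notMem (by exact hU)]
            simp only [F]
            rw [Set.indicator_of_notMem hU]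
            simp
        · filter_upwards [hz] with C hC hne
          rw [← hC hne]
          simp [invariantGraphs]
    _ = ∫⁻ U, ∫⁻ z, F (z, U) := lintegral_lintegral_swap hFm.aemeasurable
    _ = _ := by
        refine lintegral_congr fun U => ?_
        have hFU : Measurable fun z => F (z, U) := hFm.comp measurable_prodMk_right
        rw [Measure.volume_eq_prod, lintegral_prod_symm _ hFU.aemeasurable]
        refine lintegral_congr fun B => ?_
        rw [← lintegral_sub_right_eq_self _
          ((fun l => B l * U (l + 1), fun l => -(U l * B l)) :
            (Fin (r + 1) → Matrix ι ι ℝ) × (Fin (r + 1) → Matrix κ κ ℝ))]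
        refine lintegral_congr fun p => ?_
        have e1 : ∀ l, p.1 l - B l * U (l + 1) + B l * U (l + 1) = p.1 l := fun l => by abel
        have e2 : ∀ l, p.2 l + U l * B l - U l * B l = p.2 l := fun l => by abel
        simp only [F, deflationBlocks, riccati, Prod.fst_sub, Prod.snd_sub, Pi.sub_apply,
          sub_neg_eq_add, e1, e2]
        rfl

end Deflation

/-! ### Separation of the graph variables from the Gaussian weight. -/

section GaussianDeflation

attribute [local instance] matrixMeasureSpace matrix_borelSpace matrix_isAddHaarMeasure
  matrix_sigmaFinite matrix_secondCountable isAddHaarMeasure_pi_pi_pi isAddHaarMeasure_seq isAddHaarMeasure_seq_prod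

variable {ι κ : Type*} [Fintype ι] [Fintype κ] [DecidableEq ι] [DecidableEq κ] {r : ℕ}

open scoped MatrixOrder Matrix.Norms.L2Operator in
theorem Matrix.PosDef.exists_transpose_mul_self {M : Matrix ι ι ℝ} (hM : M.PosDef) :
    ∃ r : Matrix ι ι ℝ, rᵀ * r = M := by
  obtain ⟨B, hB⟩ := CStarAlgebra.nonneg_iff_eq_star_mul_self.mp hM.posSemidef.nonneg
  exact ⟨B, by rw [hB, Matrix.star_eq_conjTranspose, Matrix.conjTranspose_eq_transpose_of_trivial]⟩

theorem Matrix.posDef_one_add_transpose_mul_self (U : Matrix κ ι ℝ) : (1 + Uᵀ * U).PosDef := by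
  have h := Matrix.posSemidef_conjTranspose_mul_self U
  rw [Matrix.conjTranspose_eq_transpose_of_trivial] at h
  exact Matrix.PosDef.one.add_posSemidef h

/-- The block Cholesky factorisation of `Lᵀ L` for `L` unipotent lower block triangular. -/
theorem Matrix.exists_block_cholesky (U : Matrix κ ι ℝ) :
    ∃ (r : Matrix ι ι ℝ) (t : Matrix ι κ ℝ) (s : Matrix κ κ ℝ), rᵀ * r = 1 + Uᵀ * U ∧
      rᵀ * t = Uᵀ ∧ tᵀ * t + sᵀ * s = 1 ∧ r.det ≠ 0 ∧ |r.det| * |s.det| = 1 ∧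
      |r.det| = Real.sqrt (1 + Uᵀ * U).det := by
  obtain ⟨r, hr⟩ := (posDef_one_add_transpose_mul_self U).exists_transpose_mul_self
  -- The inverse of `1 + U Uᵀ` is the Schur complement of the block `1 + Uᵀ U` in `Lᵀ L`.
  obtain ⟨s, hs⟩ := (posDef_one_add_transpose_mul_self Uᵀ).inv.exists_transpose_mul_self
  rw [Matrix.transpose_transpose] at hs
  have hdr : r.det * r.det = (1 + Uᵀ * U).det := by rw [← hr, Matrix.det_mul, Matrix.det_transpose]
  have hds : s.det * s.det = (1 + U * Uᵀ).det⁻¹ := by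
    have h := congrArg Matrix.det hs
    rwa [Matrix.det_mul, Matrix.det_transpose, Matrix.det_nonsing_inv, Ring.inverse_eq_inv'] at h
  have hpos := (posDef_one_add_transpose_mul_self U).det_pos
  have hr0 : r.det ≠ 0 := by
    intro h
    rw [h, mul_zero] at hdr
    exact hpos.ne hdr
  have hrt : IsUnit rᵀ.det := by rw [Matrix.det_transpose]; exact hr0.isUnit
  have hpos' : IsUnit (1 + U * Uᵀ).det := by
    rw [← Matrix.det_one_add_mul_comm]; exact hpos.ne'.isUnit
  refine ⟨r, rᵀ⁻¹ * Uᵀ, s, hr, ?_, ?_, hr0, ?_, ?_⟩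
  · rw [← Matrix.mul_assoc, Matrix.mul_nonsing_inv _ hrt, Matrix.one_mul]
  · have h1 : (rᵀ⁻¹ * Uᵀ)ᵀ * (rᵀ⁻¹ * Uᵀ) = U * (1 + Uᵀ * U)⁻¹ * Uᵀ := by
      rw [Matrix.transpose_mul, Matrix.transpose_transpose, Matrix.transpose_nonsing_inv,
        Matrix.transpose_transpose, ← hr, Matrix.mul_inv_rev]
      simp only [Matrix.mul_assoc]
    rw [h1, hs]
    have hu : IsUnit (1 + Uᵀ * U).det := hpos.ne'.isUnit
    have h2 : (U * (1 + Uᵀ * U)⁻¹ * Uᵀ + (1 + U * Uᵀ)⁻¹) * (1 + U * Uᵀ) = 1 * (1 + U * Uᵀ) := by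
      rw [Matrix.add_mul, Matrix.nonsing_inv_mul _ hpos', Matrix.one_mul]
      have h3 : Uᵀ * (1 + U * Uᵀ) = (1 + Uᵀ * U) * Uᵀ := by
        simp only [Matrix.mul_add, Matrix.add_mul, Matrix.mul_one, Matrix.one_mul, Matrix.mul_assoc]
      rw [Matrix.mul_assoc, h3, Matrix.mul_assoc, ← Matrix.mul_assoc (1 + Uᵀ * U)⁻¹,
        Matrix.nonsing_inv_mul _ hu, Matrix.one_mul, add_comm]
    exact ((Matrix.isUnit_iff_isUnit_det _).2 hpos').mul_right_cancel h2
  · have h : (|r.det| * |s.det|) ^ 2 = 1 := by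
      rw [mul_pow, sq_abs, sq_abs, sq, sq, hdr, hds, Matrix.det_one_add_mul_comm]
      exact mul_inv_cancel₀ (by rw [Matrix.det_one_add_mul_comm] at hpos; exact hpos.ne')
    nlinarith [mul_nonneg (abs_nonneg r.det) (abs_nonneg s.det)]
  · rw [← hdr, Real.sqrt_mul_self_eq_abs]

/-- Replacing the unipotent factors by triangular ones does not change the Frobenius norm. -/
theorem Matrix.frobSq_conj_eq {ν : Type*} [Fintype ν] [DecidableEq ν]
    {L R L' R' Li Ri : Matrix ν ν ℝ} (T : Matrix ν ν ℝ) (h : Lᵀ * L = Rᵀ * R)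
    (h' : L'ᵀ * L' = R'ᵀ * R') (hL : L' * Li = 1) (hR : R' * Ri = 1) :
    (L * T * Li).frobSq = (R * T * Ri).frobSq := by
  have hLi : Li * L' = 1 := mul_eq_one_comm.1 hL
  have hRi : Ri * R' = 1 := mul_eq_one_comm.1 hR
  have e1 : Li * Liᵀ * (L'ᵀ * L') = 1 := by
    rw [Matrix.mul_assoc, ← Matrix.mul_assoc Liᵀ, ← Matrix.transpose_mul, hL, Matrix.transpose_one,
      Matrix.one_mul, hLi]
  have e2 : Ri * Riᵀ * (L'ᵀ * L') = 1 := by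
    rw [h', Matrix.mul_assoc, ← Matrix.mul_assoc Riᵀ, ← Matrix.transpose_mul, hR,
      Matrix.transpose_one, Matrix.one_mul, hRi]
  have e3 : Li * Liᵀ = Ri * Riᵀ := by
    have := mul_eq_one_comm.1 e2
    calc Li * Liᵀ = Li * Liᵀ * ((L'ᵀ * L') * (Ri * Riᵀ)) := by rw [this, Matrix.mul_one]
      _ = Ri * Riᵀ := by rw [← Matrix.mul_assoc, e1, Matrix.one_mul]
  -- The left factor enters only through `Aᵀ A` and the right factor only through `B Bᵀ`.
  have key : ∀ A B : Matrix ν ν ℝ, (A * T * B).frobSq = ((Aᵀ * A) * (T * (B * Bᵀ) * Tᵀ)).trace := by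
    intro A B
    rw [frobSq_eq_trace, Matrix.transpose_mul, Matrix.transpose_mul, Matrix.mul_assoc Aᵀ,
      Matrix.trace_mul_comm Aᵀ]
    simp only [Matrix.mul_assoc]
  rw [key, key, h, e3]

/-- The block matrix is `L T L'⁻¹` with `T` upper block triangular. Exchanging `L` and `L'` for the
upper block triangular matrices with the same Gram matrices keeps the Frobenius norm and makes the
whole product upper block triangular, so the norm splits into two diagonal blocks and one
off-diagonal block that is affine in `B`. -/
theorem gaussWeight_deflation {U U' : Matrix κ ι ℝ} {r r' : Matrix ι ι ℝ} {t t' : Matrix ι κ ℝ}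
    {s s' : Matrix κ κ ℝ} (h1 : rᵀ * r = 1 + Uᵀ * U) (h2 : rᵀ * t = Uᵀ)
    (h3 : tᵀ * t + sᵀ * s = 1) (h1' : r'ᵀ * r' = 1 + U'ᵀ * U') (h2' : r'ᵀ * t' = U'ᵀ)
    (h3' : t'ᵀ * t' + s'ᵀ * s' = 1) (hr' : r'.det ≠ 0) (hs' : s'.det ≠ 0)
    (G : Matrix ι ι ℝ) (B : Matrix ι κ ℝ) (X : Matrix κ κ ℝ) :
    gaussWeight (Matrix.fromBlocks (G - B * U') B (U * G - (X + U * B) * U') (X + U * B)) =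
      gaussWeight (r * G * r'⁻¹) * gaussWeight (s * X * s'⁻¹) *
        gaussWeight (r * B * s'⁻¹ + (t * X * s'⁻¹ - r * G * r'⁻¹ * t' * s'⁻¹)) := by
  have hT : Matrix.fromBlocks (G - B * U') B (U * G - (X + U * B) * U') (X + U * B) =
      Matrix.fromBlocks 1 0 U 1 * Matrix.fromBlocks G B 0 X * Matrix.fromBlocks 1 0 (-U') 1 := by
    simp only [Matrix.fromBlocks_multiply, Matrix.one_mul, Matrix.zero_mul, Matrix.mul_zero,
      Matrix.mul_one, add_zero, zero_add, Matrix.mul_neg]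
    congr 1 <;> first | abel1 | (rw [add_comm X]; abel1)
  have hgram : ∀ {U : Matrix κ ι ℝ} {r : Matrix ι ι ℝ} {t : Matrix ι κ ℝ} {s : Matrix κ κ ℝ},
      rᵀ * r = 1 + Uᵀ * U → rᵀ * t = Uᵀ → tᵀ * t + sᵀ * s = 1 →
      (Matrix.fromBlocks 1 0 U 1)ᵀ * Matrix.fromBlocks 1 0 U (1 : Matrix κ κ ℝ) =
        (Matrix.fromBlocks r t 0 s)ᵀ * Matrix.fromBlocks r t 0 s := by
    intro U r t s h1 h2 h3
    have h2t : tᵀ * r = U := by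
      rw [← Matrix.transpose_transpose U, ← h2, Matrix.transpose_mul, Matrix.transpose_transpose]
    simp only [Matrix.fromBlocks_transpose, Matrix.fromBlocks_multiply, Matrix.transpose_one,
      Matrix.transpose_zero, Matrix.one_mul, Matrix.mul_one, Matrix.zero_mul, Matrix.mul_zero,
      zero_add, add_zero, h1, h2, h3, h2t]
  rw [gaussWeight, hT, Matrix.frobSq_conj_eq _ (hgram h1 h2 h3) (hgram h1' h2' h3')
    (Ri := Matrix.fromBlocks r'⁻¹ (-(r'⁻¹ * t' * s'⁻¹)) 0 s'⁻¹)]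
  · have e : Matrix.fromBlocks r t 0 s * Matrix.fromBlocks G B 0 X *
        Matrix.fromBlocks r'⁻¹ (-(r'⁻¹ * t' * s'⁻¹)) 0 s'⁻¹ =
        Matrix.fromBlocks (r * G * r'⁻¹)
          (r * B * s'⁻¹ + (t * X * s'⁻¹ - r * G * r'⁻¹ * t' * s'⁻¹)) 0 (s * X * s'⁻¹) := by
      simp only [Matrix.fromBlocks_multiply, Matrix.mul_zero, Matrix.zero_mul, add_zero, zero_add,
        Matrix.mul_neg, Matrix.add_mul, Matrix.mul_assoc, neg_zero]
      congr 1
      abel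
    rw [e, Matrix.frobSq_fromBlocks, gaussWeight, gaussWeight, gaussWeight,
      ← ENNReal.ofReal_mul (Real.exp_pos _).le, ← Real.exp_add,
      ← ENNReal.ofReal_mul (Real.exp_pos _).le, ← Real.exp_add]
    congr 2
    have h0 : (0 : Matrix κ ι ℝ).frobSq = 0 := by simp [Matrix.frobSq]
    rw [h0]; ring
  · simp only [Matrix.fromBlocks_multiply, Matrix.one_mul, Matrix.mul_one, Matrix.zero_mul,
      Matrix.mul_zero, add_zero, zero_add, add_neg_cancel, Matrix.fromBlocks_one]
  · simp only [Matrix.fromBlocks_multiply, Matrix.mul_zero, Matrix.zero_mul, add_zero, zero_add,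
      Matrix.mul_neg, ← Matrix.mul_assoc, Matrix.mul_nonsing_inv _ hr'.isUnit, Matrix.one_mul,
      Matrix.mul_nonsing_inv _ hs'.isUnit, neg_add_cancel, neg_zero, Matrix.fromBlocks_one]

theorem lintegral_gaussWeight_affine {r : Matrix ι ι ℝ} {s : Matrix κ κ ℝ} (hr : r.det ≠ 0)
    (hs : s.det ≠ 0) (a : Matrix ι κ ℝ) :
    ∫⁻ B : Matrix ι κ ℝ, gaussWeight (r * B * s⁻¹ + a) =
      ENNReal.ofReal ((|r.det| ^ Fintype.card κ)⁻¹ * |s.det| ^ Fintype.card ι) *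
        ENNReal.ofReal (Real.sqrt (2 * Real.pi)) ^ (Fintype.card ι * Fintype.card κ) := by
  have hs' : (s⁻¹).det ≠ 0 := by
    rw [Matrix.det_nonsing_inv, Ring.inverse_eq_inv']; exact inv_ne_zero hs
  have h := lintegral_twoSidedMul hr hs' (fun X => gaussWeight (X + a))
  have h2 := lintegral_add_right_eq_self (μ := (volume : Measure (Matrix ι κ ℝ))) gaussWeight a
  rw [h2, lintegral_gaussWeight] at h
  rw [← h, ← mul_assoc, ← ENNReal.ofReal_mul (by positivity), Matrix.det_nonsing_inv,
    Ring.inverse_eq_inv', abs_inv]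
  have hr2 := abs_pos.2 hr
  have hs2 := abs_pos.2 hs
  have : (|r.det| ^ Fintype.card κ)⁻¹ * |s.det| ^ Fintype.card ι *
      (|r.det| ^ Fintype.card κ * |s.det|⁻¹ ^ Fintype.card ι) = 1 := by
    rw [inv_pow]
    field_simp
  rw [this, ENNReal.ofReal_one, one_mul]

theorem lintegral_seq_twoSidedMul {m : ℕ} {A : Fin m → Matrix κ κ ℝ} {B : Fin m → Matrix ι ι ℝ}
    (hA : ∀ l, (A l).det ≠ 0) (hB : ∀ l, (B l).det ≠ 0)
    (f : (Fin m → Matrix κ ι ℝ) → ℝ≥0∞) :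
    ENNReal.ofReal (∏ l, (|(A l).det| ^ Fintype.card ι * |(B l).det| ^ Fintype.card κ)) *
      ∫⁻ X : Fin m → Matrix κ ι ℝ, f (fun l => A l * X l * B l) =
    ∫⁻ X : Fin m → Matrix κ ι ℝ, f X := by
  let T : (Fin m → Matrix κ ι ℝ) →ₗ[ℝ] (Fin m → Matrix κ ι ℝ) :=
    LinearMap.pi fun l => Matrix.twoSidedMul (A l) (B l) ∘ₗ LinearMap.proj l
  have hdet : LinearMap.det T = ∏ l, ((A l).det ^ Fintype.card ι * (B l).det ^ Fintype.card κ) := by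
    rw [LinearMap.det_pi]
    exact Finset.prod_congr rfl fun l _ => Matrix.det_twoSidedMul _ _
  have habs : |LinearMap.det T| =
      ∏ l, (|(A l).det| ^ Fintype.card ι * |(B l).det| ^ Fintype.card κ) := by
    rw [hdet, Finset.abs_prod]
    exact Finset.prod_congr rfl fun l _ => by rw [abs_mul, abs_pow, abs_pow]
  have hd : LinearMap.det T ≠ 0 := by
    rw [hdet]
    exact Finset.prod_ne_zero_iff.2 fun l _ => mul_ne_zero (pow_ne_zero _ (hA l)) (pow_ne_zero _ (hB l))
  have h := lintegral_comp_linearMap (E := Fin m → κ → ι → ℝ) volume T hd f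
  refine Eq.trans ?_ h
  exact congrArg (fun c => ENNReal.ofReal c *
    ∫⁻ X : Fin m → Matrix κ ι ℝ, f (fun l => A l * X l * B l)) habs.symm

/-- Around the cycle each `g l` acts once from the left and once, inverted, from the right, so the
Jacobian telescopes to 1. -/
theorem lintegral_seq_cyclic_conj {g : Fin (r + 1) → Matrix ι ι ℝ} (hg : ∀ l, (g l).det ≠ 0)
    (f : (Fin (r + 1) → Matrix ι ι ℝ) → ℝ≥0∞) :
    ∫⁻ X : Fin (r + 1) → Matrix ι ι ℝ, f (fun l => g l * X l * (g (l + 1))⁻¹) =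
    ∫⁻ X : Fin (r + 1) → Matrix ι ι ℝ, f X := by
  have hg' : ∀ l, (g (l + 1))⁻¹.det ≠ 0 := fun l => by
    rw [Matrix.det_nonsing_inv, Ring.inverse_eq_inv']; exact inv_ne_zero (hg _)
  rw [← lintegral_seq_twoSidedMul hg hg' f]
  have h1 : ∏ l, (|(g l).det| ^ Fintype.card ι * |(g (l + 1))⁻¹.det| ^ Fintype.card ι) = 1 := by
    rw [Finset.prod_mul_distrib]
    have := Equiv.prod_comp (Equiv.addRight (1 : Fin (r + 1)))
      (fun l => |((g l)⁻¹).det| ^ Fintype.card ι)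
    simp only [Equiv.coe_addRight] at this
    rw [this, ← Finset.prod_mul_distrib]
    refine Finset.prod_eq_one fun l _ => ?_
    rw [Matrix.det_nonsing_inv, Ring.inverse_eq_inv', ← mul_pow, ← abs_mul,
      mul_inv_cancel₀ (hg l), abs_one, one_pow]
  rw [h1, ENNReal.ofReal_one, one_mul]

/-- The density of the graph coordinates of a random subspace, not normalised. -/
noncomputable def graphWeight (U : Matrix κ ι ℝ) : ℝ≥0∞ :=
  ENNReal.ofReal ((Real.sqrt (1 + Uᵀ * U).det ^ (Fintype.card κ + Fintype.card ι))⁻¹)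

theorem continuous_det_one_add_transpose_mul_self :
    Continuous fun U : Matrix κ ι ℝ => (1 + Uᵀ * U).det :=
  (continuous_const.add (continuous_id.matrix_transpose.matrix_mul continuous_id)).matrix_det

theorem measurable_graphWeight : Measurable (graphWeight : Matrix κ ι ℝ → ℝ≥0∞) :=
  (((continuous_det_one_add_transpose_mul_self.measurable.sqrt).pow_const _).inv).ennreal_ofReal

-- The Cholesky factors depend on `U` alone. Integrating out `B` produces powers of their
-- determinants; the measure-preserving cyclic conjugation removes them from the weights of `G` and
-- `X`, and `hinv` removes them from `K`. Only the product of the graph weights still depends on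
-- `U`.
set_option maxHeartbeats 1000000 in
theorem lintegral_deflation_gaussWeight (U : Fin (r + 1) → Matrix κ ι ℝ)
    {K : (Fin (r + 1) → Matrix ι ι ℝ) × (Fin (r + 1) → Matrix κ κ ℝ) → ℝ≥0∞} (hK : Measurable K)
    (hinv : ∀ (g : Fin (r + 1) → Matrix ι ι ℝ) (h : Fin (r + 1) → Matrix κ κ ℝ),
      (∀ l, (g l).det ≠ 0) → (∀ l, (h l).det ≠ 0) → ∀ G X,
      K (fun l => g l * G l * (g (l + 1))⁻¹, fun l => h l * X l * (h (l + 1))⁻¹) = K (G, X)) :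
    ∫⁻ B : Fin (r + 1) → Matrix ι κ ℝ,
      ∫⁻ p : (Fin (r + 1) → Matrix ι ι ℝ) × (Fin (r + 1) → Matrix κ κ ℝ),
        K p * ∏ l, gaussWeight (deflationBlocks U B p l) =
    (∏ l, graphWeight (U l)) *
      ENNReal.ofReal (Real.sqrt (2 * Real.pi)) ^ ((r + 1) * (Fintype.card ι * Fintype.card κ)) *
      ∫⁻ G : Fin (r + 1) → Matrix ι ι ℝ, ∫⁻ X : Fin (r + 1) → Matrix κ κ ℝ,
        K (G, X) * (∏ l, gaussWeight (G l)) * ∏ l, gaussWeight (X l) := by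
  choose g t s h1 h2 h3 hg hgs hsq using fun l => Matrix.exists_block_cholesky (U l)
  have hs : ∀ l, (s l).det ≠ 0 := by
    intro l h0
    have := hgs l
    rw [h0] at this
    simp at this
  let c : ℝ≥0∞ := (∏ l, graphWeight (U l)) *
      ENNReal.ofReal (Real.sqrt (2 * Real.pi)) ^ ((r + 1) * (Fintype.card ι * Fintype.card κ))
  have hm : Measurable fun q : (Fin (r + 1) → Matrix ι κ ℝ) ×
      ((Fin (r + 1) → Matrix ι ι ℝ) × (Fin (r + 1) → Matrix κ κ ℝ)) =>
      K q.2 * ∏ l, gaussWeight (deflationBlocks U q.1 q.2 l) := by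
    refine (hK.comp measurable_snd).mul (Finset.measurable_fun_prod _ fun l _ => ?_)
    refine measurable_gaussWeight.comp (Continuous.measurable ?_)
    unfold deflationBlocks
    refine Continuous.matrix_fromBlocks ?_ ?_ ?_ ?_ <;> fun_prop
  -- The determinants of `s l` and `g l` are reciprocal in absolute value. Undoing the cyclic shift
  -- pairs them at the same index and adds the exponents `|κ|` and `|ι|`.
  have hconst : ∏ l, (ENNReal.ofReal ((|(g l).det| ^ Fintype.card κ)⁻¹ *
      |(s (l + 1)).det| ^ Fintype.card ι) *
        ENNReal.ofReal (Real.sqrt (2 * Real.pi)) ^ (Fintype.card ι * Fintype.card κ)) = c := by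
    rw [Finset.prod_mul_distrib, Finset.prod_const, Finset.card_univ, Fintype.card_fin, ← pow_mul,
      mul_comm (Fintype.card ι * Fintype.card κ)]
    congr 1
    simp_rw [ENNReal.ofReal_mul (inv_nonneg.2 (pow_nonneg (abs_nonneg _) _))]
    rw [Finset.prod_mul_distrib]
    have := Equiv.prod_comp (Equiv.addRight (1 : Fin (r + 1)))
      (fun l => ENNReal.ofReal (|(s l).det| ^ Fintype.card ι))
    simp only [Equiv.coe_addRight] at this
    rw [this, ← Finset.prod_mul_distrib]
    refine Finset.prod_congr rfl fun l _ => ?_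
    rw [← ENNReal.ofReal_mul (by positivity), graphWeight, ← hsq l]
    have e : |(s l).det| = |(g l).det|⁻¹ := (eq_inv_of_mul_eq_one_right (hgs l))
    rw [e, inv_pow, ← mul_inv, pow_add]
  rw [lintegral_lintegral_swap hm.aemeasurable]
  calc ∫⁻ p : (Fin (r + 1) → Matrix ι ι ℝ) × (Fin (r + 1) → Matrix κ κ ℝ),
        ∫⁻ B : Fin (r + 1) → Matrix ι κ ℝ, K p * ∏ l, gaussWeight (deflationBlocks U B p l)
      = ∫⁻ p : (Fin (r + 1) → Matrix ι ι ℝ) × (Fin (r + 1) → Matrix κ κ ℝ),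
        c * (K p * (∏ l, gaussWeight (g l * p.1 l * (g (l + 1))⁻¹)) *
          ∏ l, gaussWeight (s l * p.2 l * (s (l + 1))⁻¹)) := by
        refine lintegral_congr fun p => ?_
        simp only [deflationBlocks]
        simp_rw [fun (B : Fin (r + 1) → Matrix ι κ ℝ) (l : Fin (r + 1)) =>
          gaussWeight_deflation (h1 l) (h2 l) (h3 l) (h1 (l + 1)) (h2 (l + 1)) (h3 (l + 1))
            (hg (l + 1)) (hs (l + 1)) (p.1 l) (B l) (p.2 l)]
        simp_rw [Finset.prod_mul_distrib, ← mul_assoc]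
        rw [lintegral_const_mul, volume_pi, lintegral_fintype_prod_eq_prod
          (f := fun (l : Fin (r + 1)) (B : Matrix ι κ ℝ) => gaussWeight (g l * B * (s (l + 1))⁻¹ +
            (t l * p.2 l * (s (l + 1))⁻¹ - g l * p.1 l * (g (l + 1))⁻¹ * t (l + 1) *
              (s (l + 1))⁻¹)))]
        · simp_rw [lintegral_gaussWeight_affine (hg _) (hs _)]
          rw [hconst]
          ring
        · intro l
          refine measurable_gaussWeight.comp (Continuous.measurable ?_)
          fun_prop
        · refine Finset.measurable_fun_prod _ fun l _ => ?_
          refine measurable_gaussWeight.comp (Continuous.measurable ?_)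
          fun_prop
    _ = c * ∫⁻ p : (Fin (r + 1) → Matrix ι ι ℝ) × (Fin (r + 1) → Matrix κ κ ℝ),
        (K p * (∏ l, gaussWeight (g l * p.1 l * (g (l + 1))⁻¹)) *
          ∏ l, gaussWeight (s l * p.2 l * (s (l + 1))⁻¹)) := by
        refine lintegral_const_mul _ ?_
        refine (hK.mul (Finset.measurable_fun_prod _ fun l _ => ?_)).mul
          (Finset.measurable_fun_prod _ fun l _ => ?_) <;>
        · refine measurable_gaussWeight.comp (Continuous.measurable ?_)
          fun_prop
    _ = c * ∫⁻ G : Fin (r + 1) → Matrix ι ι ℝ, ∫⁻ X : Fin (r + 1) → Matrix κ κ ℝ,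
        K (fun l => g l * G l * (g (l + 1))⁻¹, fun l => s l * X l * (s (l + 1))⁻¹) *
          (∏ l, gaussWeight (g l * G l * (g (l + 1))⁻¹)) *
          ∏ l, gaussWeight (s l * X l * (s (l + 1))⁻¹) := by
        rw [Measure.volume_eq_prod, lintegral_prod]
        · simp_rw [hinv g s hg hs]
        · refine Measurable.aemeasurable ?_
          refine (hK.mul (Finset.measurable_fun_prod _ fun l _ => ?_)).mul
            (Finset.measurable_fun_prod _ fun l _ => ?_) <;>
          · refine measurable_gaussWeight.comp (Continuous.measurable ?_)
            fun_prop
    _ = _ := by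
        congr 1
        rw [lintegral_seq_cyclic_conj hg (fun G => ∫⁻ X : Fin (r + 1) → Matrix κ κ ℝ,
          K (G, fun l => s l * X l * (s (l + 1))⁻¹) * (∏ l, gaussWeight (G l)) *
          ∏ l, gaussWeight (s l * X l * (s (l + 1))⁻¹))]
        refine lintegral_congr fun G => ?_
        exact lintegral_seq_cyclic_conj hs (fun X =>
          K (G, X) * (∏ l, gaussWeight (G l)) * ∏ l, gaussWeight (X l))

end GaussianDeflation

/-! ### Polynomial conditions that hold almost everywhere. -/

section LinePolynomials

attribute [local instance] matrixMeasureSpace matrix_borelSpace matrix_isAddHaarMeasure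
  matrix_sigmaFinite matrix_secondCountable isAddHaarMeasure_pi_pi_pi isAddHaarMeasure_seq isAddHaarMeasure_seq_prod

/-- Continuous functions that are polynomial on every line. -/
def PolyOnLines {E : Type*} [TopologicalSpace E] [AddCommGroup E] [Module ℝ E] (f : E → ℝ) : Prop :=
  Continuous f ∧ ∀ a x : E, ∃ q : Polynomial ℝ, ∀ t : ℝ, f (a + t • x) = q.eval t

namespace PolyOnLines

variable {E : Type*} [TopologicalSpace E] [AddCommGroup E] [Module ℝ E] {f g : E → ℝ}
  {ι κ ν : Type*}

theorem const (c : ℝ) : PolyOnLines fun _ : E => c :=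
  ⟨continuous_const, fun _ _ => ⟨Polynomial.C c, fun t => by simp⟩⟩

theorem add (hf : PolyOnLines f) (hg : PolyOnLines g) : PolyOnLines fun x => f x + g x := by
  refine ⟨hf.1.add hg.1, fun a x => ?_⟩
  obtain ⟨p, hp⟩ := hf.2 a x
  obtain ⟨q, hq⟩ := hg.2 a x
  exact ⟨p + q, fun t => by simp only [hp, hq, Polynomial.eval_add]⟩

theorem mul (hf : PolyOnLines f) (hg : PolyOnLines g) : PolyOnLines fun x => f x * g x := by
  refine ⟨hf.1.mul hg.1, fun a x => ?_⟩
  obtain ⟨p, hp⟩ := hf.2 a x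
  obtain ⟨q, hq⟩ := hg.2 a x
  exact ⟨p * q, fun t => by simp only [hp, hq, Polynomial.eval_mul]⟩

theorem sum {s : Finset ι} {f : ι → E → ℝ} (hf : ∀ i ∈ s, PolyOnLines (f i)) :
    PolyOnLines fun x => ∑ i ∈ s, f i x := by
  classical
  induction s using Finset.induction_on with
  | empty => simpa using const 0
  | insert i s hi ih =>
    simp_rw [Finset.sum_insert hi]
    exact (hf i (Finset.mem_insert_self _ _)).add
      (ih fun j hj => hf j (Finset.mem_insert_of_mem hj))

theorem prod {s : Finset ι} {f : ι → E → ℝ} (hf : ∀ i ∈ s, PolyOnLines (f i)) :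
    PolyOnLines fun x => ∏ i ∈ s, f i x := by
  classical
  induction s using Finset.induction_on with
  | empty => simpa using const 1
  | insert i s hi ih =>
    simp_rw [Finset.prod_insert hi]
    exact (hf i (Finset.mem_insert_self _ _)).mul
      (ih fun j hj => hf j (Finset.mem_insert_of_mem hj))

theorem det [Fintype ι] [DecidableEq ι] {M : E → Matrix ι ι ℝ}
    (hM : ∀ i j, PolyOnLines fun x => M x i j) : PolyOnLines fun x => (M x).det := by
  simp_rw [Matrix.det_apply']
  exact sum fun σ _ => (const _).mul (prod fun i _ => hM _ _)

theorem matrix_mul [Fintype κ] {M : E → Matrix ι κ ℝ} {M' : E → Matrix κ ν ℝ}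
    (hM : ∀ i j, PolyOnLines fun x => M x i j) (hM' : ∀ i j, PolyOnLines fun x => M' x i j)
    (i : ι) (j : ν) : PolyOnLines fun x => (M x * M' x) i j := by
  simp_rw [Matrix.mul_apply]
  exact sum fun k _ => (hM _ _).mul (hM' _ _)

theorem matrix_pow [Fintype ι] [DecidableEq ι] {M : E → Matrix ι ι ℝ}
    (hM : ∀ i j, PolyOnLines fun x => M x i j) (n : ℕ) :
    ∀ (i j : ι), PolyOnLines fun x => (M x ^ n) i j := by
  induction n with
  | zero => intro i j; simp_rw [pow_zero]; exact const _
  | succ n ih => intro i j; simp_rw [pow_succ]; exact matrix_mul ih hM i j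

theorem adjugate [Fintype ι] [DecidableEq ι] {M : E → Matrix ι ι ℝ}
    (hM : ∀ i j, PolyOnLines fun x => M x i j) (i j : ι) :
    PolyOnLines fun x => (M x).adjugate i j := by
  simp_rw [Matrix.adjugate_apply]
  refine det fun k l => ?_
  simp_rw [Matrix.updateRow_apply]
  split_ifs
  · exact const _
  · exact hM _ _

theorem entry {m : ℕ} (l : Fin m) (i : ι) (j : κ) :
    PolyOnLines fun X : Fin m → Matrix ι κ ℝ => X l i j :=
  ⟨by fun_prop, fun a x => ⟨Polynomial.C (a l i j) + Polynomial.X * Polynomial.C (x l i j),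
    fun t => by simp; ring⟩⟩

theorem ae_ne_zero [Fintype ι] [Fintype κ] {m : ℕ} {f : (Fin m → Matrix ι κ ℝ) → ℝ}
    (hf : PolyOnLines f) (a : Fin m → Matrix ι κ ℝ) (ha : f a ≠ 0) : ∀ᵐ X, f X ≠ 0 := by
  have := measure_zeroLocus_eq_zero (E := Fin m → ι → κ → ℝ) volume hf.1 a ha (hf.2 a)
  rw [ae_iff]
  simp only [ne_eq, not_not]
  exact this

end PolyOnLines

theorem ae_det_ne_zero {ι : Type*} [Fintype ι] [DecidableEq ι] (m : ℕ) :
    ∀ᵐ X : Fin m → Matrix ι ι ℝ, ∀ l, (X l).det ≠ 0 :=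
  ae_all_iff.2 fun l => (PolyOnLines.det fun i j => PolyOnLines.entry l i j).ae_ne_zero
    (fun _ => 1) (by simp)

end LinePolynomials

/-! ### The deflation identity for functions of the characteristic polynomial. -/

section ProductIntegrals

attribute [local instance] matrixMeasureSpace matrix_borelSpace matrix_isAddHaarMeasure
  matrix_sigmaFinite matrix_secondCountable isAddHaarMeasure_pi_pi_pi isAddHaarMeasure_seq isAddHaarMeasure_seq_prod

variable {ι κ : Type*} [Fintype ι] [Fintype κ] [DecidableEq ι] [DecidableEq κ] {r m : ℕ}

/-- The values of the characteristic polynomial at the natural numbers. -/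
noncomputable def Matrix.charEval (P : Matrix ι ι ℝ) : ℕ → ℝ := fun j => P.charpoly.eval (j : ℝ)

theorem measurable_charEval : Measurable (Matrix.charEval : Matrix ι ι ℝ → ℕ → ℝ) := by
  refine measurable_pi_iff.2 fun j => ?_
  simp_rw [Matrix.charEval, Matrix.eval_charpoly]
  apply Continuous.measurable
  fun_prop

theorem continuous_ofFn_prod (m : ℕ) :
    Continuous fun X : Fin m → Matrix ι ι ℝ => (List.ofFn X).prod := by
  induction m with
  | zero => simp_rw [List.ofFn_zero, List.prod_nil]; exact continuous_const
  | succ m ih =>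
    simp_rw [List.ofFn_succ, List.prod_cons]
    exact (continuous_apply 0).matrix_mul
      (ih.comp (continuous_pi fun l => continuous_apply l.succ))

/-- The product of the Gaussian weights of a sequence of matrices. -/
noncomputable def seqWeight (X : Fin m → Matrix ι ι ℝ) : ℝ≥0∞ := ∏ l, gaussWeight (X l)

theorem measurable_seqWeight : Measurable (seqWeight : (Fin m → Matrix ι ι ℝ) → ℝ≥0∞) :=
  Finset.measurable_fun_prod _ fun l _ => measurable_gaussWeight.comp (measurable_pi_apply l)

theorem Matrix.continuous_det_sylvester : Continuous fun p : Matrix ι ι ℝ × Matrix κ κ ℝ =>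
    LinearMap.det (Matrix.sylvester p.1 p.2) := by
  let b := Module.finBasis ℝ (Matrix κ ι ℝ)
  simp_rw [← LinearMap.det_toMatrix b]
  refine Continuous.matrix_det (continuous_matrix fun i j => ?_)
  simp_rw [LinearMap.toMatrix_apply]
  have h1 : Continuous (b.coord i) := LinearMap.continuous_of_finiteDimensional _
  refine h1.comp ?_
  simp only [Matrix.sylvester_apply]
  fun_prop

/-- Products of matrices that are cyclically intertwined. -/
theorem tailProd_intertwine {X : Fin (r + 1) → Matrix κ κ ℝ} {Γ : Fin (r + 1) → Matrix ι ι ℝ}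
    {M : Fin (r + 1) → Matrix κ ι ℝ} (h : ∀ l, X l * M (l + 1) = M l * Γ l) (l : Fin (r + 1)) :
    tailProd X l * M 0 = M l * tailProd Γ l := by
  induction l using Fin.reverseInduction with
  | last =>
    rw [tailProd_fin, tailProd_fin, tailProd_of_le _ (by simp), tailProd_of_le _ (by simp),
      Matrix.mul_one, Matrix.mul_one, ← h, Fin.last_add_one]
  | cast l ih =>
    rw [tailProd_fin, tailProd_fin, Matrix.mul_assoc]
    have e : ((l.castSucc : Fin (r + 1)) : ℕ) + 1 = (l.succ : Fin (r + 1)) := by simp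
    have e' : (l.castSucc : Fin (r + 1)) + 1 = l.succ := Fin.coeSucc_eq_succ
    rw [e, ih, ← Matrix.mul_assoc, ← e', h, Matrix.mul_assoc]

theorem ofFn_prod_intertwine {X : Fin (r + 1) → Matrix κ κ ℝ} {Γ : Fin (r + 1) → Matrix ι ι ℝ}
    {M : Fin (r + 1) → Matrix κ ι ℝ} (h : ∀ l, X l * M (l + 1) = M l * Γ l) :
    (List.ofFn X).prod * M 0 = M 0 * (List.ofFn Γ).prod := by
  simpa [tailProd_zero] using tailProd_intertwine h 0

theorem Matrix.charpoly_eq_of_intertwine {A B M : Matrix ι ι ℝ} (hM : M.det ≠ 0)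
    (h : A * M = M * B) : A.charpoly = B.charpoly := by
  have e : A = M * B * M⁻¹ := by
    rw [← h, Matrix.mul_assoc, Matrix.mul_nonsing_inv _ hM.isUnit, Matrix.mul_one]
  rw [e, Matrix.mul_assoc, Matrix.charpoly_mul_comm, Matrix.mul_assoc,
    Matrix.nonsing_inv_mul _ hM.isUnit, Matrix.mul_one]

theorem Matrix.charEval_eq_of_intertwine {A B M : Matrix ι ι ℝ} (hM : M.det ≠ 0)
    (h : A * M = M * B) : A.charEval = B.charEval := by
  unfold Matrix.charEval
  rw [Matrix.charpoly_eq_of_intertwine hM h]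

theorem Matrix.det_aeval_eq_of_intertwine {A B M : Matrix ι ι ℝ} (hM : M.det ≠ 0)
    (h : A * M = M * B) (q : Polynomial ℝ) :
    (Polynomial.aeval A q).det = (Polynomial.aeval B q).det := by
  have hq : Polynomial.aeval A q * M = M * Polynomial.aeval B q := by
    induction q using Polynomial.induction_on' with
    | add p q hp hq => rw [map_add, map_add, Matrix.add_mul, Matrix.mul_add, hp, hq]
    | monomial n a =>
      have hn : ∀ n : ℕ, A ^ n * M = M * B ^ n := fun n => by
        induction n with
        | zero => simp
        | succ n ih => rw [pow_succ, Matrix.mul_assoc, h, ← Matrix.mul_assoc, ih,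
            Matrix.mul_assoc, ← pow_succ]
      rw [Polynomial.aeval_monomial, Polynomial.aeval_monomial, Algebra.algebraMap_eq_smul_one,
        Matrix.smul_mul, Matrix.one_mul, Matrix.smul_mul, hn,
        Matrix.smul_mul, Matrix.one_mul, Matrix.mul_smul]
  have := congrArg Matrix.det hq
  rw [Matrix.det_mul, Matrix.det_mul, mul_comm] at this
  exact mul_left_cancel₀ hM this

theorem exists_ofFn_fromBlocks_prod (G : Fin m → Matrix ι ι ℝ) (B : Fin m → Matrix ι κ ℝ)
    (X : Fin m → Matrix κ κ ℝ) : ∃ B', (List.ofFn fun l => Matrix.fromBlocks (G l) (B l) 0 (X l)).prod =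
      Matrix.fromBlocks (List.ofFn G).prod B' 0 (List.ofFn X).prod := by
  induction m with
  | zero => exact ⟨0, by simp [Matrix.fromBlocks_one]⟩
  | succ m ih =>
    obtain ⟨B', hB'⟩ := ih (fun l => G l.succ) (fun l => B l.succ) (fun l => X l.succ)
    refine ⟨G 0 * B' + B 0 * (List.ofFn fun l => X l.succ).prod, ?_⟩
    rw [List.ofFn_succ, List.prod_cons, hB', Matrix.fromBlocks_multiply]
    simp only [List.ofFn_succ, List.prod_cons, Matrix.mul_zero, Matrix.zero_mul, add_zero, zero_add]

theorem deflationBlocks_intertwine (U : Fin (r + 1) → Matrix κ ι ℝ)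
    (B : Fin (r + 1) → Matrix ι κ ℝ)
    (p : (Fin (r + 1) → Matrix ι ι ℝ) × (Fin (r + 1) → Matrix κ κ ℝ)) (l : Fin (r + 1)) :
    deflationBlocks U B p l * Matrix.fromBlocks 1 0 (U (l + 1)) 1 =
      Matrix.fromBlocks 1 0 (U l) 1 * Matrix.fromBlocks (p.1 l) (B l) 0 (p.2 l) := by
  simp only [deflationBlocks, Matrix.fromBlocks_multiply, Matrix.one_mul, Matrix.zero_mul,
    Matrix.mul_zero, Matrix.mul_one, add_zero, zero_add]
  congr 1 <;> abel1

/-- The unipotent factors intertwine the product with a block triangular one, whose characteristic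
polynomial factors. -/
theorem charEval_deflationBlocks (U : Fin (r + 1) → Matrix κ ι ℝ)
    (B : Fin (r + 1) → Matrix ι κ ℝ)
    (p : (Fin (r + 1) → Matrix ι ι ℝ) × (Fin (r + 1) → Matrix κ κ ℝ)) :
    (List.ofFn (deflationBlocks U B p)).prod.charEval =
      (List.ofFn p.1).prod.charEval * (List.ofFn p.2).prod.charEval := by
  have h := ofFn_prod_intertwine (M := fun l => Matrix.fromBlocks 1 0 (U l) 1)
    (deflationBlocks_intertwine U B p)
  obtain ⟨B', hB'⟩ := exists_ofFn_fromBlocks_prod p.1 B p.2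
  rw [hB'] at h
  funext j
  simp only [Matrix.charEval, Pi.mul_apply]
  rw [Matrix.charpoly_eq_of_intertwine (by simp) h, Matrix.charpoly_fromBlocks_zero₂₁,
    Polynomial.eval_mul]

theorem ofFn_prod_conj {g : Fin (r + 1) → Matrix ι ι ℝ} (hg : ∀ l, (g l).det ≠ 0)
    (G : Fin (r + 1) → Matrix ι ι ℝ) :
    (List.ofFn fun l => g l * G l * (g (l + 1))⁻¹).prod * g 0 = g 0 * (List.ofFn G).prod :=
  ofFn_prod_intertwine (M := g) fun l => by
    rw [Matrix.mul_assoc, Matrix.nonsing_inv_mul _ (hg _).isUnit, Matrix.mul_one]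

/-- The spectral part of the integrand after deflation. -/
noncomputable def deflationKernel (S : Set (Matrix ι ι ℝ)) (h : (ℕ → ℝ) → ℝ≥0∞)
    (G : Matrix ι ι ℝ) (P : Matrix κ κ ℝ) : ℝ≥0∞ :=
  ENNReal.ofReal |LinearMap.det (Matrix.sylvester G P)| * S.indicator (fun _ => 1) G *
    h (G.charEval * P.charEval)

theorem measurable_deflationKernel {S : Set (Matrix ι ι ℝ)} (hS : MeasurableSet S)
    {h : (ℕ → ℝ) → ℝ≥0∞} (hh : Measurable h) :
    Measurable fun p : Matrix ι ι ℝ × Matrix κ κ ℝ => deflationKernel S h p.1 p.2 := by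
  refine Measurable.mul (Measurable.mul ?_ ?_) ?_
  · exact (ENNReal.continuous_ofReal.comp (continuous_abs.comp
      Matrix.continuous_det_sylvester)).measurable
  · exact (measurable_const.indicator hS).comp measurable_fst
  · exact hh.comp ((measurable_charEval.comp measurable_fst).mul
      (measurable_charEval.comp measurable_snd))

theorem measurable_deflationKernel_prod {S : Set (Matrix ι ι ℝ)} (hS : MeasurableSet S)
    {h : (ℕ → ℝ) → ℝ≥0∞} (hh : Measurable h) :
    Measurable fun p : (Fin m → Matrix ι ι ℝ) × (Fin m → Matrix κ κ ℝ) =>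
      deflationKernel S h (List.ofFn p.1).prod (List.ofFn p.2).prod := by
  have h1 : Continuous fun p : (Fin m → Matrix ι ι ℝ) × (Fin m → Matrix κ κ ℝ) =>
      ((List.ofFn p.1).prod, (List.ofFn p.2).prod) :=
    ((continuous_ofFn_prod m).comp continuous_fst).prodMk
      ((continuous_ofFn_prod m).comp continuous_snd)
  have h2 := (measurable_deflationKernel (κ := κ) hS hh).comp h1.measurable
  exact h2

/-- By `Matrix.abs_det_sylvester` the Jacobian is unchanged when `G` and `P` are conjugated
separately. This is the invariance that `lintegral_deflation_gaussWeight` requires. -/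
theorem deflationKernel_conj {S : Set (Matrix ι ι ℝ)}
    (hSinv : ∀ g G : Matrix ι ι ℝ, g.det ≠ 0 → (g * G * g⁻¹ ∈ S ↔ G ∈ S))
    (h : (ℕ → ℝ) → ℝ≥0∞) {g G' G : Matrix ι ι ℝ} {k P' P : Matrix κ κ ℝ} (hg : g.det ≠ 0)
    (hk : k.det ≠ 0) (hG : G' * g = g * G) (hP : P' * k = k * P) :
    deflationKernel S h G' P' = deflationKernel S h G P := by
  have e1 : G' = g * G * g⁻¹ := by
    rw [← hG, Matrix.mul_assoc, Matrix.mul_nonsing_inv _ hg.isUnit, Matrix.mul_one]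
  have e2 : S.indicator (fun _ => (1 : ℝ≥0∞)) G' = S.indicator (fun _ => 1) G := by
    classical
    rw [Set.indicator_apply, Set.indicator_apply]
    refine if_congr ?_ rfl rfl
    rw [e1]
    exact hSinv _ _ hg
  rw [deflationKernel, deflationKernel, Matrix.abs_det_sylvester, Matrix.abs_det_sylvester, e2,
    Matrix.charpoly_eq_of_intertwine hg hG, Matrix.charEval_eq_of_intertwine hg hG,
    Matrix.charEval_eq_of_intertwine hk hP, Matrix.det_aeval_eq_of_intertwine hk hP]

/-- The small blocks are almost surely invertible, so the cyclic Jacobian may be replaced by the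
Sylvester determinant of the two products. Then everything except the weights depends on the
products alone, and the graph variables separate, giving one constant for each factor. -/
theorem lintegral_deflation {S : Set (Matrix ι ι ℝ)} (hS : MeasurableSet S)
    (hSinv : ∀ g G : Matrix ι ι ℝ, g.det ≠ 0 → (g * G * g⁻¹ ∈ S ↔ G ∈ S))
    {h : (ℕ → ℝ) → ℝ≥0∞} (hh : Measurable h) {c : ℕ}
    (hc : ∀ᵐ X : Fin (r + 1) → Matrix (ι ⊕ κ) (ι ⊕ κ) ℝ, h (List.ofFn X).prod.charEval ≠ 0 →
      (invariantGraphs {G | (List.ofFn G).prod ∈ S} X).encard = c) :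
    c * ∫⁻ X : Fin (r + 1) → Matrix (ι ⊕ κ) (ι ⊕ κ) ℝ,
        h (List.ofFn X).prod.charEval * seqWeight X =
      (ENNReal.ofReal (Real.sqrt (2 * Real.pi)) ^ (Fintype.card ι * Fintype.card κ) *
        ∫⁻ U : Matrix κ ι ℝ, graphWeight U) ^ (r + 1) *
      ∫⁻ G : Fin (r + 1) → Matrix ι ι ℝ, ∫⁻ X : Fin (r + 1) → Matrix κ κ ℝ,
        deflationKernel S h (List.ofFn G).prod (List.ofFn X).prod * seqWeight G * seqWeight X := by
  let K : (Fin (r + 1) → Matrix ι ι ℝ) × (Fin (r + 1) → Matrix κ κ ℝ) → ℝ≥0∞ := fun p =>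
    deflationKernel S h (List.ofFn p.1).prod (List.ofFn p.2).prod
  have hK : Measurable K := measurable_deflationKernel_prod hS hh
  have hinv : ∀ (g : Fin (r + 1) → Matrix ι ι ℝ) (k : Fin (r + 1) → Matrix κ κ ℝ),
      (∀ l, (g l).det ≠ 0) → (∀ l, (k l).det ≠ 0) → ∀ G X,
      K (fun l => g l * G l * (g (l + 1))⁻¹, fun l => k l * X l * (k (l + 1))⁻¹) = K (G, X) :=
    fun g k hg hk G X => deflationKernel_conj hSinv h (hg 0) (hk 0) (ofFn_prod_conj hg G)
      (ofFn_prod_conj hk X)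
  have hSm : MeasurableSet {G : Fin (r + 1) → Matrix ι ι ℝ | (List.ofFn G).prod ∈ S} :=
    (continuous_ofFn_prod _).measurable hS
  have hf : Measurable fun X : Fin (r + 1) → Matrix (ι ⊕ κ) (ι ⊕ κ) ℝ =>
      h (List.ofFn X).prod.charEval * seqWeight X :=
    ((hh.comp measurable_charEval).comp (continuous_ofFn_prod _).measurable).mul
      measurable_seqWeight
  rw [lintegral_eq_deflationBlocks hSm hf
    (hc.mono fun X hX hne => hX fun h0 => hne (by rw [h0, zero_mul]))]
  calc _ = ∫⁻ U : Fin (r + 1) → Matrix κ ι ℝ, ∫⁻ B : Fin (r + 1) → Matrix ι κ ℝ,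
      ∫⁻ p : (Fin (r + 1) → Matrix ι ι ℝ) × (Fin (r + 1) → Matrix κ κ ℝ),
        K p * ∏ l, gaussWeight (deflationBlocks U B p l) := by
        refine lintegral_congr fun U => lintegral_congr fun B => lintegral_congr_ae ?_
        have hae : ∀ᵐ p : (Fin (r + 1) → Matrix ι ι ℝ) × (Fin (r + 1) → Matrix κ κ ℝ),
            ∀ l, (p.1 l).det ≠ 0 :=
          Measure.quasiMeasurePreserving_fst.ae (ae_det_ne_zero (r + 1))
        filter_upwards [hae] with p hp
        rw [det_cyclicSylvester _ _ hp, charEval_deflationBlocks]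
        simp only [K, deflationKernel, seqWeight, ← mul_assoc]
        rfl
    _ = ∫⁻ U : Fin (r + 1) → Matrix κ ι ℝ, (∏ l, graphWeight (U l)) *
      (ENNReal.ofReal (Real.sqrt (2 * Real.pi)) ^ ((r + 1) * (Fintype.card ι * Fintype.card κ)) *
      ∫⁻ G : Fin (r + 1) → Matrix ι ι ℝ, ∫⁻ X : Fin (r + 1) → Matrix κ κ ℝ,
        K (G, X) * (∏ l, gaussWeight (G l)) * ∏ l, gaussWeight (X l)) :=
        lintegral_congr fun U => by rw [lintegral_deflation_gaussWeight U hK hinv, mul_assoc]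
    _ = _ := by
        rw [lintegral_mul_const, volume_pi, lintegral_fintype_prod_eq_prod
          (f := fun (_ : Fin (r + 1)) (U : Matrix κ ι ℝ) => graphWeight U)
          fun _ => measurable_graphWeight]
        · rw [Finset.prod_const, Finset.card_univ, Fintype.card_fin, mul_pow, ← pow_mul,
            mul_comm (Fintype.card ι * Fintype.card κ), ← mul_assoc]
          congr 1
          rw [mul_comm]
        · exact Finset.measurable_fun_prod _ fun l _ =>
            measurable_graphWeight.comp (measurable_pi_apply l)

end ProductIntegrals

/-! ### Polar coordinates and Gaussian moments. -/

section PolarAndMoments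

theorem lintegral_comp_abs (f : ℝ → ℝ≥0∞) :
    ∫⁻ x : ℝ, f |x| = 2 * ∫⁻ x in Set.Ioi (0 : ℝ), f x := by
  have h1 : ∫⁻ x in Set.Ioi (0 : ℝ), f |x| = ∫⁻ x in Set.Ioi (0 : ℝ), f x :=
    setLIntegral_congr_fun measurableSet_Ioi fun x hx => by
      have : (0 : ℝ) < x := hx
      simp only [abs_of_pos this]
  have h2 : ∫⁻ x in Set.Iio (0 : ℝ), f |x| = ∫⁻ x in Set.Ioi (0 : ℝ), f x := by
    rw [← h1]
    have := (Measure.measurePreserving_neg (volume : Measure ℝ)).setLIntegral_comp_preimage_emb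
      (MeasurableEquiv.neg ℝ).measurableEmbedding (fun x => f |x|) (Set.Ioi (0 : ℝ))
    simpa using this
  have h3 : (Set.Ioi (0 : ℝ))ᶜ = Set.Iic 0 := by ext; simp
  rw [← lintegral_add_compl (fun x => f |x|) (measurableSet_Ioi (a := (0 : ℝ))), h3,
    setLIntegral_congr (Iio_ae_eq_Iic (a := (0 : ℝ)) (μ := volume)).symm, h1, h2, two_mul]

/-- Integrals of radial functions on the plane. -/
theorem lintegral_radial {f : ℝ → ℝ≥0∞} (hf : Measurable f) :
    ∫⁻ p : ℝ × ℝ, f (Real.sqrt (p.1 ^ 2 + p.2 ^ 2)) =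
      ENNReal.ofReal Real.pi * ∫⁻ x : ℝ, ENNReal.ofReal |x| * f |x| := by
  rw [← lintegral_comp_polarCoord_symm, lintegral_comp_abs (fun x => ENNReal.ofReal x * f x)]
  have hset : ∀ p ∈ polarCoord.target, ENNReal.ofReal p.1 • f (Real.sqrt
      ((polarCoord.symm p).1 ^ 2 + (polarCoord.symm p).2 ^ 2)) = ENNReal.ofReal p.1 * f p.1 := by
    rintro ⟨a, t⟩ hp
    have ha : 0 < a := by
      simp only [polarCoord_target, Set.mem_prod, Set.mem_Ioi] at hp
      exact hp.1
    simp only [polarCoord_symm_apply, smul_eq_mul]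
    rw [show (a * Real.cos t) ^ 2 + (a * Real.sin t) ^ 2 = a ^ 2 by
      rw [mul_pow, mul_pow, ← mul_add, Real.cos_sq_add_sin_sq, mul_one], Real.sqrt_sq ha.le]
  rw [setLIntegral_congr_fun polarCoord.open_target.measurableSet hset, polarCoord_target,
    Measure.volume_eq_prod, ← Measure.prod_restrict]
  have h := lintegral_prod_mul (μ := (volume : Measure ℝ).restrict (Set.Ioi 0))
    (ν := (volume : Measure ℝ).restrict (Set.Ioo (-Real.pi) Real.pi))
    (f := fun x => ENNReal.ofReal x * f x) (g := fun _ => 1)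
    (ENNReal.measurable_ofReal.mul hf).aemeasurable aemeasurable_const
  simp only [mul_one] at h
  rw [h, lintegral_const, Measure.restrict_apply_univ, one_mul, Real.volume_Ioo, sub_neg_eq_add,
    ← two_mul, ENNReal.ofReal_mul (by norm_num), ENNReal.ofReal_ofNat]
  ring

/-- The normalisation constant `M_n = 2^{(n+1)/2} Γ((n+1)/2)` of `|t|^n e^{-t²/2}`. -/
noncomputable def gaussMoment (n : ℕ) : ℝ :=
  2 ^ (((n : ℝ) + 1) / 2) * Real.Gamma (((n : ℝ) + 1) / 2)

theorem gaussMoment_pos (n : ℕ) : 0 < gaussMoment n := by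
  have : 0 < Real.Gamma (((n : ℝ) + 1) / 2) := Real.Gamma_pos_of_pos (by positivity)
  unfold gaussMoment
  positivity

theorem lintegral_abs_pow_mul_gauss (n : ℕ) :
    ∫⁻ t : ℝ, ENNReal.ofReal (|t| ^ n) * ENNReal.ofReal (Real.exp (-t ^ 2 / 2)) =
      ENNReal.ofReal (2 ^ (((n : ℝ) + 1) / 2) * Real.Gamma (((n : ℝ) + 1) / 2)) := by
  have h := lintegral_comp_abs fun t =>
    ENNReal.ofReal (t ^ n) * ENNReal.ofReal (Real.exp (-t ^ 2 / 2))
  simp only [sq_abs] at h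
  have hn : (-1 : ℝ) < n := by have := n.cast_nonneg (α := ℝ); linarith
  have he : ∀ t ∈ Set.Ioi (0 : ℝ), ENNReal.ofReal (t ^ n) * ENNReal.ofReal (Real.exp (-t ^ 2 / 2)) =
      ENNReal.ofReal (t ^ (n : ℝ) * Real.exp (-(1 / 2) * t ^ (2 : ℝ))) := by
    intro t ht
    have : (0 : ℝ) < t := ht
    rw [← ENNReal.ofReal_mul (by positivity), Real.rpow_natCast, Real.rpow_two]
    congr 3
    ring
  rw [h, setLIntegral_congr_fun measurableSet_Ioi he,
    ← ofReal_integral_eq_lintegral_ofReal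
      (integrableOn_rpow_mul_exp_neg_mul_rpow hn (by norm_num) (by norm_num)),
    integral_rpow_mul_exp_neg_mul_rpow (by norm_num) hn (by norm_num)]
  · rw [show (2 : ℝ≥0∞) = ENNReal.ofReal 2 by simp, ← ENNReal.ofReal_mul (by norm_num)]
    congr 1
    rw [one_div, Real.inv_rpow (by norm_num), ← Real.rpow_neg (by norm_num)]
    ring_nf
  · refine (ae_restrict_mem measurableSet_Ioi).mono fun t ht => ?_
    have : (0 : ℝ) < t := ht
    simp only [Pi.zero_apply]
    positivity

theorem ginibreZ_succ (N : ℕ) : ginibreZ (N + 1) =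
    ginibreZ N * gaussMoment N := by
  rw [ginibreZ, ginibreZ, gaussMoment, Finset.prod_Icc_succ_top (by omega)]
  have : ((N + 1 : ℕ) : ℝ) * ((N + 1 : ℕ) + 1) / 4 = (N : ℝ) * (N + 1) / 4 + ((N : ℝ) + 1) / 2 := by
    push_cast; ring
  rw [this, Real.rpow_add (by norm_num)]
  push_cast
  ring

theorem ginibreZ_pos (N : ℕ) : 0 < ginibreZ N := by
  induction N with
  | zero => simp [ginibreZ]
  | succ n ih =>
    rw [ginibreZ_succ]
    exact mul_pos ih (gaussMoment_pos n)

end PolarAndMoments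

/-! ### Evaluation of the constant of one deflation step. -/

section Constants

attribute [local instance] matrixMeasureSpace matrix_borelSpace matrix_isAddHaarMeasure
  matrix_sigmaFinite matrix_secondCountable isAddHaarMeasure_pi_pi_pi isAddHaarMeasure_seq isAddHaarMeasure_seq_prod

variable {ι κ : Type*} [Fintype ι] [Fintype κ] [DecidableEq ι] [DecidableEq κ] {r m : ℕ}

theorem ae_matrix_det_ne_zero : ∀ᵐ A : Matrix ι ι ℝ, A.det ≠ 0 := by
  have := volume_preserving_funUnique (Fin 1) (Matrix ι ι ℝ)
  have h := this.symm.quasiMeasurePreserving.ae (ae_det_ne_zero (ι := ι) 1)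
  filter_upwards [h] with A hA
  exact hA 0

theorem lintegral_matrix_mul_right {A : Matrix ι ι ℝ} (hA : A.det ≠ 0)
    (f : Matrix κ ι ℝ → ℝ≥0∞) :
    ENNReal.ofReal (|A.det| ^ Fintype.card κ) * ∫⁻ X : Matrix κ ι ℝ, f (X * A) =
      ∫⁻ X : Matrix κ ι ℝ, f X := by
  have := lintegral_twoSidedMul (A := (1 : Matrix κ κ ℝ)) (by simp) hA f
  simpa using this

theorem lintegral_matrix_mul_left {A : Matrix κ κ ℝ} (hA : A.det ≠ 0)
    (f : Matrix κ ι ℝ → ℝ≥0∞) :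
    ENNReal.ofReal (|A.det| ^ Fintype.card ι) * ∫⁻ X : Matrix κ ι ℝ, f (A * X) =
      ∫⁻ X : Matrix κ ι ℝ, f X := by
  have := lintegral_twoSidedMul (B := (1 : Matrix ι ι ℝ)) hA (by simp) f
  simpa using this

-- Both sides are the Gaussian integral over pairs of a top block `A` and a bottom block `C`. The
-- substitution `C = U A` contributes a power of `|det A|`; for fixed `U` the substitution `g A`
-- with `gᵀ g = 1 + Uᵀ U` restores the standard weight and produces `graphWeight`. No Stiefel or
-- Grassmann volumes are needed.
variable (ι κ) in
theorem lintegral_graphWeight_mul :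
    (∫⁻ U : Matrix κ ι ℝ, graphWeight U) *
      ∫⁻ A : Matrix ι ι ℝ, ENNReal.ofReal (|A.det| ^ Fintype.card κ) * gaussWeight A =
    ENNReal.ofReal (Real.sqrt (2 * Real.pi)) ^
      (Fintype.card ι * (Fintype.card ι + Fintype.card κ)) := by
  have hdm : Measurable fun A : Matrix ι ι ℝ => ENNReal.ofReal (|A.det| ^ Fintype.card κ) := by
    refine (Continuous.measurable ?_).ennreal_ofReal
    exact (continuous_abs.comp continuous_id.matrix_det).pow _
  have hm : Measurable fun p : Matrix ι ι ℝ × Matrix κ ι ℝ =>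
      ENNReal.ofReal (|p.1.det| ^ Fintype.card κ) * (gaussWeight p.1 * gaussWeight (p.2 * p.1)) := by
    refine (hdm.comp measurable_fst).mul ((measurable_gaussWeight.comp measurable_fst).mul
      (measurable_gaussWeight.comp (Continuous.measurable ?_)))
    exact continuous_snd.matrix_mul continuous_fst
  calc _ = ∫⁻ U : Matrix κ ι ℝ, graphWeight U *
        ∫⁻ A : Matrix ι ι ℝ, ENNReal.ofReal (|A.det| ^ Fintype.card κ) * gaussWeight A := by
        rw [lintegral_mul_const _ measurable_graphWeight]
    _ = ∫⁻ U : Matrix κ ι ℝ, ∫⁻ A : Matrix ι ι ℝ,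
        ENNReal.ofReal (|A.det| ^ Fintype.card κ) * (gaussWeight A * gaussWeight (U * A)) := by
        refine lintegral_congr fun U => ?_
        obtain ⟨g, t, s, h1, -, -, hg, -, hsq⟩ := Matrix.exists_block_cholesky U
        rw [← lintegral_matrix_mul_left hg, ← mul_assoc, graphWeight, ← hsq,
          ← ENNReal.ofReal_mul (by positivity), ← lintegral_const_mul']
        · refine lintegral_congr fun A => ?_
          have e : gaussWeight (g * A) = gaussWeight A * gaussWeight (U * A) := by
            rw [gaussWeight, gaussWeight, gaussWeight, ← ENNReal.ofReal_mul (Real.exp_pos _).le,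
              ← Real.exp_add, Matrix.frobSq_eq_trace', Matrix.frobSq_eq_trace',
              Matrix.frobSq_eq_trace', Matrix.transpose_mul, Matrix.mul_assoc,
              ← Matrix.mul_assoc gᵀ, h1, Matrix.transpose_mul, Matrix.mul_assoc Aᵀ,
              Matrix.add_mul, Matrix.mul_add, Matrix.trace_add, Matrix.one_mul]
            simp only [Matrix.mul_assoc]
            congr 2
            ring
          have hg0 := abs_pos.2 hg
          rw [e, ← mul_assoc, ← ENNReal.ofReal_mul (by positivity), Matrix.det_mul, abs_mul, mul_pow,
            pow_add]
          congr 2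
          field_simp
        · exact ENNReal.ofReal_ne_top
    _ = ∫⁻ A : Matrix ι ι ℝ, ∫⁻ U : Matrix κ ι ℝ,
        ENNReal.ofReal (|A.det| ^ Fintype.card κ) * (gaussWeight A * gaussWeight (U * A)) :=
        (lintegral_lintegral_swap hm.aemeasurable).symm
    _ = ∫⁻ A : Matrix ι ι ℝ, gaussWeight A * ∫⁻ C : Matrix κ ι ℝ, gaussWeight C := by
        refine lintegral_congr_ae ?_
        filter_upwards [ae_matrix_det_ne_zero] with A hA
        rw [← lintegral_matrix_mul_right hA gaussWeight, lintegral_const_mul',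
          lintegral_const_mul', ← mul_assoc, ← mul_assoc, mul_comm (gaussWeight A)]
        · exact ENNReal.ofReal_ne_top
        · exact ENNReal.ofReal_ne_top
    _ = _ := by
        rw [lintegral_mul_const _ measurable_gaussWeight, lintegral_gaussWeight,
          lintegral_gaussWeight, ← pow_add]
        congr 1
        ring

theorem volume_preserving_matrix_one :
    MeasurePreserving (fun t : ℝ => !![t]) := by
  have h2 := (volume_preserving_funUnique (Fin 1) (Fin 1 → ℝ)).symm.comp
    (volume_preserving_funUnique (Fin 1) ℝ).symm
  obtain ⟨f, hf, hfe⟩ : ∃ f : ℝ → (Fin 1 → Fin 1 → ℝ),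
      MeasurePreserving f volume volume ∧ ∀ t, f t = !![t] :=
    ⟨_, h2, fun p => by funext i j; fin_cases i; fin_cases j; rfl⟩
  rw [funext hfe] at hf
  exact hf

theorem volume_preserving_matrix_two :
    MeasurePreserving (fun p : (ℝ × ℝ) × (ℝ × ℝ) => !![p.1.1, p.1.2; p.2.1, p.2.2]) := by
  have h1 := (volume_preserving_finTwoArrow ℝ).symm
  have h2 := (volume_preserving_finTwoArrow (Fin 2 → ℝ)).symm.comp (h1.prod h1)
  obtain ⟨f, hf, hfe⟩ : ∃ f : (ℝ × ℝ) × (ℝ × ℝ) → (Fin 2 → Fin 2 → ℝ),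
      MeasurePreserving f volume volume ∧ ∀ p, f p = !![p.1.1, p.1.2; p.2.1, p.2.2] :=
    ⟨_, h2, fun p => by funext i j; fin_cases i <;> fin_cases j <;> rfl⟩
  rw [funext hfe] at hf
  exact hf

theorem lintegral_abs_det_pow_one (n : ℕ) :
    ∫⁻ A : Matrix (Fin 1) (Fin 1) ℝ, ENNReal.ofReal (|A.det| ^ n) * gaussWeight A =
      ENNReal.ofReal (gaussMoment n) := by
  have hm : Measurable fun A : Matrix (Fin 1) (Fin 1) ℝ =>
      ENNReal.ofReal (|A.det| ^ n) * gaussWeight A := by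
    refine (Continuous.measurable ?_).ennreal_ofReal.mul measurable_gaussWeight
    exact (continuous_abs.comp continuous_id.matrix_det).pow _
  rw [← volume_preserving_matrix_one.lintegral_comp hm, gaussMoment, ← lintegral_abs_pow_mul_gauss]
  refine lintegral_congr fun t => ?_
  simp [gaussWeight, Matrix.frobSq]

/-- A rotation in `b` turns the linear form into the length of `a` times one coordinate. -/
theorem lintegral_linear_form (n : ℕ) (a : ℝ × ℝ) (ha : 0 < a.1 ^ 2 + a.2 ^ 2) :
    ∫⁻ b : ℝ × ℝ, ENNReal.ofReal (|a.1 * b.2 - a.2 * b.1| ^ n) *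
      ENNReal.ofReal (Real.exp (-(b.1 ^ 2 + b.2 ^ 2) / 2)) =
    ENNReal.ofReal (Real.sqrt (a.1 ^ 2 + a.2 ^ 2) ^ n) *
      (ENNReal.ofReal (Real.sqrt (2 * Real.pi)) * ENNReal.ofReal (gaussMoment n)) := by
  set R := Real.sqrt (a.1 ^ 2 + a.2 ^ 2) with hR
  have hR0 : 0 < R := Real.sqrt_pos.2 ha
  have hR2 : R ^ 2 = a.1 ^ 2 + a.2 ^ 2 := Real.sq_sqrt ha.le
  let L : ℝ × ℝ →ₗ[ℝ] ℝ × ℝ := Matrix.toLin (Module.Basis.finTwoProd ℝ) (Module.Basis.finTwoProd ℝ)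
    !![a.1 / R, -(a.2 / R); a.2 / R, a.1 / R]
  have hLa : ∀ c, L c = (a.1 / R * c.1 + -(a.2 / R) * c.2, a.2 / R * c.1 + a.1 / R * c.2) :=
    fun c => Matrix.toLin_finTwoProd_apply _ _ _ _ _
  have hdet : LinearMap.det L = 1 := by
    rw [LinearMap.det_toLin, Matrix.det_fin_two_of]
    field_simp
    rw [hR2]; ring
  have h := lintegral_comp_linearMap volume L (by rw [hdet]; exact one_ne_zero) fun b : ℝ × ℝ =>
    ENNReal.ofReal (|a.1 * b.2 - a.2 * b.1| ^ n) *
      ENNReal.ofReal (Real.exp (-(b.1 ^ 2 + b.2 ^ 2) / 2))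
  rw [hdet, abs_one, ENNReal.ofReal_one, one_mul] at h
  rw [← h]
  have he : ∀ c : ℝ × ℝ, ENNReal.ofReal (|a.1 * (L c).2 - a.2 * (L c).1| ^ n) *
      ENNReal.ofReal (Real.exp (-((L c).1 ^ 2 + (L c).2 ^ 2) / 2)) =
      ENNReal.ofReal (R ^ n) * (ENNReal.ofReal (Real.exp (-c.1 ^ 2 / 2)) *
        (ENNReal.ofReal (|c.2| ^ n) * ENNReal.ofReal (Real.exp (-c.2 ^ 2 / 2)))) := by
    intro c
    have e1 : a.1 * (L c).2 - a.2 * (L c).1 = R * c.2 := by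
      rw [hLa]
      field_simp
      rw [hR2]; ring
    have e2 : (L c).1 ^ 2 + (L c).2 ^ 2 = c.1 ^ 2 + c.2 ^ 2 := by
      rw [hLa]
      field_simp
      rw [hR2]; ring
    rw [e1, e2, abs_mul, abs_of_pos hR0, mul_pow, ENNReal.ofReal_mul (by positivity),
      show -(c.1 ^ 2 + c.2 ^ 2) / 2 = -c.1 ^ 2 / 2 + -c.2 ^ 2 / 2 by ring, Real.exp_add,
      ENNReal.ofReal_mul (Real.exp_pos _).le]
    ring
  simp_rw [he]
  rw [lintegral_const_mul' _ _ ENNReal.ofReal_ne_top, Measure.volume_eq_prod,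
    lintegral_prod_mul (f := fun x => ENNReal.ofReal (Real.exp (-x ^ 2 / 2)))
      (g := fun x => ENNReal.ofReal (|x| ^ n) * ENNReal.ofReal (Real.exp (-x ^ 2 / 2)))
      (by fun_prop) (by fun_prop),
    lintegral_gauss_real, lintegral_abs_pow_mul_gauss, gaussMoment]

/-- For a fixed first row `a`, the determinant is a linear form in the second row, with coefficient
vector of length `|a|`. The remaining integral over `a` is radial, and the polar Jacobian raises the
moment from `n` to `n + 1`. -/
theorem lintegral_abs_det_pow_two (n : ℕ) :
    ∫⁻ A : Matrix (Fin 2) (Fin 2) ℝ, ENNReal.ofReal (|A.det| ^ n) * gaussWeight A =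
      ENNReal.ofReal Real.pi * ENNReal.ofReal (Real.sqrt (2 * Real.pi)) *
        ENNReal.ofReal (gaussMoment n) * ENNReal.ofReal (gaussMoment (n + 1)) := by
  have hm : Measurable fun A : Matrix (Fin 2) (Fin 2) ℝ =>
      ENNReal.ofReal (|A.det| ^ n) * gaussWeight A := by
    refine (Continuous.measurable ?_).ennreal_ofReal.mul measurable_gaussWeight
    exact (continuous_abs.comp continuous_id.matrix_det).pow _
  have hm2 : Measurable fun p : (ℝ × ℝ) × (ℝ × ℝ) =>
      ENNReal.ofReal (|!![p.1.1, p.1.2; p.2.1, p.2.2].det| ^ n) *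
        gaussWeight !![p.1.1, p.1.2; p.2.1, p.2.2] :=
    hm.comp volume_preserving_matrix_two.measurable
  have hae : ∀ᵐ a : ℝ × ℝ, 0 < a.1 ^ 2 + a.2 ^ 2 := by
    have : ∀ᵐ a : ℝ × ℝ, a ≠ 0 := Measure.ae_ne volume 0
    filter_upwards [this] with a ha
    by_contra hn
    apply ha
    have h1 : a.1 = 0 := by nlinarith [sq_nonneg a.1, sq_nonneg a.2]
    have h2 : a.2 = 0 := by nlinarith [sq_nonneg a.1, sq_nonneg a.2]
    exact Prod.ext h1 h2
  rw [← volume_preserving_matrix_two.lintegral_comp hm, Measure.volume_eq_prod,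
    lintegral_prod _ hm2.aemeasurable]
  calc _ = ∫⁻ a : ℝ × ℝ, (ENNReal.ofReal (Real.sqrt (a.1 ^ 2 + a.2 ^ 2) ^ n) *
        ENNReal.ofReal (Real.exp (-Real.sqrt (a.1 ^ 2 + a.2 ^ 2) ^ 2 / 2))) *
        (ENNReal.ofReal (Real.sqrt (2 * Real.pi)) * ENNReal.ofReal (gaussMoment n)) := by
        refine lintegral_congr_ae ?_
        filter_upwards [hae] with a ha
        rw [mul_right_comm, ← lintegral_linear_form n a ha, Real.sq_sqrt ha.le,
          ← lintegral_mul_const' _ _ ENNReal.ofReal_ne_top]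
        refine lintegral_congr fun b => ?_
        simp only [gaussWeight, Matrix.frobSq, Matrix.det_fin_two_of, Fin.sum_univ_two,
          Matrix.of_apply, Matrix.cons_val', Matrix.cons_val_zero, Matrix.cons_val_one,
          Matrix.cons_val_fin_one]
        rw [mul_assoc, ← ENNReal.ofReal_mul (Real.exp_pos _).le, ← Real.exp_add]
        congr 3
        ring
    _ = _ := by
        rw [lintegral_mul_const' _ _ (ENNReal.mul_ne_top ENNReal.ofReal_ne_top ENNReal.ofReal_ne_top),
          lintegral_radial (f := fun x => ENNReal.ofReal (x ^ n) *
            ENNReal.ofReal (Real.exp (-x ^ 2 / 2))) (by fun_prop)]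
        have he : ∀ x : ℝ, ENNReal.ofReal |x| * (ENNReal.ofReal (|x| ^ n) *
            ENNReal.ofReal (Real.exp (-|x| ^ 2 / 2))) =
            ENNReal.ofReal (|x| ^ (n + 1)) * ENNReal.ofReal (Real.exp (-x ^ 2 / 2)) := fun x => by
          rw [← mul_assoc, ← ENNReal.ofReal_mul (abs_nonneg _), ← pow_succ', sq_abs]
        simp_rw [he]
        rw [lintegral_abs_pow_mul_gauss, ← gaussMoment]
        ring

/-- The moment of order `n` is the ratio of the normalisations `ginibreZ` in sizes `n + 1` and `n`,
so the powers of `√(2π)` balance and the recursion for the density is exact. -/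
theorem deflationConst_one (n : ℕ) :
    ENNReal.ofReal (Real.sqrt (2 * Real.pi)) ^ (Fintype.card (Fin 1) * Fintype.card (Fin n)) *
        (∫⁻ U : Matrix (Fin n) (Fin 1) ℝ, graphWeight U) *
        ENNReal.ofReal (Real.sqrt (2 * Real.pi)) ^ (n * n) * ENNReal.ofReal (gaussMoment n) =
      ENNReal.ofReal (Real.sqrt (2 * Real.pi)) ^ ((n + 1) * (n + 1)) := by
  have h := lintegral_graphWeight_mul (Fin 1) (Fin n)
  simp only [Fintype.card_fin, lintegral_abs_det_pow_one] at h ⊢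
  generalize ENNReal.ofReal (Real.sqrt (2 * Real.pi)) = g at h ⊢
  generalize (∫⁻ U : Matrix (Fin n) (Fin 1) ℝ, graphWeight U) = v at h ⊢
  calc _ = g ^ (1 * n) * g ^ (n * n) * (v * ENNReal.ofReal (gaussMoment n)) := by ring
    _ = _ := by rw [h]; ring

/-- The constant `√(2π³) = π √(2π)` is the normalisation of `matrixGauss`. It absorbs what the 2 × 2
determinant integral contains besides the two moments, which are the ratio of `ginibreZ` in sizes `n
+ 2` and `n`. -/
theorem deflationConst_two (n : ℕ) :
    ENNReal.ofReal (Real.sqrt (2 * Real.pi)) ^ (Fintype.card (Fin 2) * Fintype.card (Fin n)) *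
        (∫⁻ U : Matrix (Fin n) (Fin 2) ℝ, graphWeight U) *
        ENNReal.ofReal (Real.sqrt (2 * Real.pi)) ^ (n * n) *
        (ENNReal.ofReal (Real.sqrt (2 * Real.pi ^ 3)) * ENNReal.ofReal (gaussMoment n) *
          ENNReal.ofReal (gaussMoment (n + 1))) =
      ENNReal.ofReal (Real.sqrt (2 * Real.pi)) ^ ((n + 2) * (n + 2)) := by
  have h := lintegral_graphWeight_mul (Fin 2) (Fin n)
  simp only [Fintype.card_fin, lintegral_abs_det_pow_two] at h ⊢
  have e : ENNReal.ofReal (Real.sqrt (2 * Real.pi ^ 3)) =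
      ENNReal.ofReal Real.pi * ENNReal.ofReal (Real.sqrt (2 * Real.pi)) := by
    rw [← ENNReal.ofReal_mul Real.pi_pos.le, show 2 * Real.pi ^ 3 = Real.pi ^ 2 * (2 * Real.pi) by ring,
      Real.sqrt_mul (by positivity), Real.sqrt_sq Real.pi_pos.le]
  rw [e]
  generalize ENNReal.ofReal (Real.sqrt (2 * Real.pi)) = g at h ⊢
  generalize (∫⁻ U : Matrix (Fin n) (Fin 2) ℝ, graphWeight U) = v at h ⊢
  calc _ = g ^ (2 * n) * g ^ (n * n) * (v * (ENNReal.ofReal Real.pi * g *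
        ENNReal.ofReal (gaussMoment n) * ENNReal.ofReal (gaussMoment (n + 1)))) := by ring
    _ = _ := by rw [h]; ring

end Constants

/-! ### Krylov matrices and the position of invariant subspaces. -/

section Genericity

attribute [local instance] matrixMeasureSpace matrix_borelSpace matrix_isAddHaarMeasure
  matrix_sigmaFinite matrix_secondCountable isAddHaarMeasure_pi_pi_pi isAddHaarMeasure_seq isAddHaarMeasure_seq_prod

open Polynomial (aeval)

variable {α ι κ : Type*} [Fintype α] [Fintype ι] [Fintype κ] [DecidableEq α] [DecidableEq ι]
  [DecidableEq κ] {r m : ℕ}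

theorem Matrix.aeval_intertwine {A : Matrix α α ℝ} {B : Matrix ι ι ℝ} {M : Matrix α ι ℝ}
    (h : A * M = M * B) (q : Polynomial ℝ) : aeval A q * M = M * aeval B q := by
  induction q using Polynomial.induction_on' with
  | add p q hp hq => rw [map_add, map_add, Matrix.add_mul, Matrix.mul_add, hp, hq]
  | monomial n a =>
    have hn : ∀ n : ℕ, A ^ n * M = M * B ^ n := fun n => by
      induction n with
      | zero => simp
      | succ n ih => rw [pow_succ, Matrix.mul_assoc, h, ← Matrix.mul_assoc, ih,
          Matrix.mul_assoc, ← pow_succ]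
    rw [Polynomial.aeval_monomial, Polynomial.aeval_monomial, Algebra.algebraMap_eq_smul_one,
      Algebra.algebraMap_eq_smul_one, Matrix.smul_mul, Matrix.one_mul, Matrix.smul_mul, hn,
      Matrix.smul_mul, Matrix.one_mul, Matrix.mul_smul]

theorem Matrix.eq_zero_of_mul_eq_zero {A : Matrix α α ℝ} (hA : A.det ≠ 0) {M : Matrix α ι ℝ}
    (h : A * M = 0) : M = 0 := by
  have := congrArg (A⁻¹ * ·) h
  simpa [← Matrix.mul_assoc, Matrix.nonsing_inv_mul _ hA.isUnit] using this

/-- The Krylov matrix of the row with index `a`, the exponents being given by `σ`. -/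
def Matrix.krylov (σ : α → ℕ) (a : α) (P : Matrix α α ℝ) : Matrix α α ℝ :=
  Matrix.of fun i j => (P ^ σ i) a j

theorem Matrix.krylov_mul {σ : α → ℕ} {a : α} {P : Matrix α α ℝ} {Δ : Matrix ι ι ℝ}
    {M : Matrix α ι ℝ} (h : P * M = M * Δ) (i : α) (j : ι) :
    (Matrix.krylov σ a P * M) i j = (M * Δ ^ σ i) a j := by
  have := Matrix.aeval_intertwine h (Polynomial.X ^ σ i)
  simp only [map_pow, Polynomial.aeval_X] at this
  rw [← this]
  rfl

/-- The Krylov matrix times `M` has as rows the row `a` of `M` times powers of `Δ`. Thus an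
eigenvector, or the frame of an invariant subspace, is determined by its row `a`. -/
theorem Matrix.eq_zero_of_row_eq_zero {σ : α → ℕ} {a : α} {P : Matrix α α ℝ} {Δ : Matrix ι ι ℝ}
    {M : Matrix α ι ℝ} (hP : (Matrix.krylov σ a P).det ≠ 0) (h : P * M = M * Δ)
    (ha : ∀ j, M a j = 0) : M = 0 := by
  refine Matrix.eq_zero_of_mul_eq_zero hP ?_
  ext i j
  rw [Matrix.krylov_mul h]
  simp [Matrix.mul_apply, ha]

/-- The polynomial that expresses the coordinate `b` of an eigenvector, normalised at the
coordinate `a`, by the eigenvalue. -/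
noncomputable def Matrix.krylovPoly (σ : α → ℕ) (a b : α) (P : Matrix α α ℝ) : Polynomial ℝ :=
  ∑ i, Polynomial.C ((Matrix.krylov σ a P).adjugate b i) * Polynomial.X ^ σ i

theorem Matrix.aeval_krylovPoly (σ : α → ℕ) (a b : α) (P : Matrix α α ℝ) (B : Matrix ι ι ℝ) :
    aeval B (Matrix.krylovPoly σ a b P) =
      ∑ i, (Matrix.krylov σ a P).adjugate b i • B ^ σ i := by
  simp [Matrix.krylovPoly, map_sum, Algebra.smul_def]

/-- The real `2 × 2` matrix of a complex number. -/
noncomputable def complexMatrix : ℂ →ₐ[ℝ] Matrix (Fin 2) (Fin 2) ℝ :=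
  Algebra.leftMulMatrix Complex.basisOneI

theorem complexMatrix_apply (z : ℂ) : complexMatrix z = !![z.re, -z.im; z.im, z.re] :=
  Algebra.leftMulMatrix_complex z

theorem aeval_complexMatrix (z : ℂ) (q : Polynomial ℝ) :
    aeval (complexMatrix z) q = complexMatrix (aeval z q) :=
  Polynomial.aeval_algHom_apply complexMatrix z q

theorem Matrix.eq_zero_of_mul_complexMatrix {M : Matrix α (Fin 2) ℝ} {z : ℂ} (hz : z ≠ 0)
    (h : M * complexMatrix z = 0) : M = 0 := by
  have := congrArg (· * complexMatrix z⁻¹) h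
  simpa [Matrix.mul_assoc, ← map_mul, hz] using this

/-- Normalise the complex eigenvector to have coordinate 1 at `a`. If the determinant vanished, its
coordinate at `b` would be real, and up to the Krylov determinant this coordinate is `g(z)` for the
Krylov polynomial `g`. With `g(z)` real, the second column of the normalised frame is a real
eigenvector of `g(P)`, or zero, with coordinate 0 at `a`. By `hP'` it is zero, which is impossible
for non-real `z`. -/
theorem Matrix.top_det_ne_zero {σ : α → ℕ} {a b : α} {P : Matrix α α ℝ} {z : ℂ}
    {M : Matrix α (Fin 2) ℝ} (hP : (Matrix.krylov σ a P).det ≠ 0)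
    (hP' : (Matrix.krylov σ a (aeval P (Matrix.krylovPoly σ a b P))).det ≠ 0)
    (h : P * M = M * complexMatrix z) (hz : z.im ≠ 0) (hM : M ≠ 0) :
    M a 0 * M b 1 - M a 1 * M b 0 ≠ 0 := by
  intro hdet
  -- A row `(c, d)` stands for the complex number `c - i d`; right multiplication by `complexMatrix`
  -- is then complex multiplication.
  set w : ℂ := ⟨M a 0, -M a 1⟩ with hw
  have hw0 : w ≠ 0 := by
    intro h0
    refine hM (Matrix.eq_zero_of_row_eq_zero hP h fun j => ?_)
    have h1 := congrArg Complex.re h0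
    have h2 := congrArg Complex.im h0
    simp only [hw, Complex.zero_re, Complex.zero_im, neg_eq_zero] at h1 h2
    fin_cases j
    · exact h1
    · exact h2
  have hn : M a 0 * M a 0 + M a 1 * M a 1 ≠ 0 := by
    have := (Complex.normSq_pos.2 hw0).ne'
    rw [Complex.normSq_apply] at this
    simpa [hw] using this
  have hn' : M a 0 ^ 2 + M a 1 ^ 2 ≠ 0 := by rwa [sq, sq]
  set M' := M * complexMatrix w⁻¹ with hM'
  have hPM' : P * M' = M' * complexMatrix z := by
    rw [hM', ← Matrix.mul_assoc, h, Matrix.mul_assoc, Matrix.mul_assoc, ← map_mul, ← map_mul,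
      mul_comm]
  have hent : ∀ i j, M' i j = M i 0 * complexMatrix w⁻¹ 0 j + M i 1 * complexMatrix w⁻¹ 1 j :=
    fun i j => by rw [hM', Matrix.mul_apply, Fin.sum_univ_two]
  have hwr : (w⁻¹).re = M a 0 / (M a 0 * M a 0 + M a 1 * M a 1) := by
    rw [Complex.inv_re, Complex.normSq_apply]; simp [hw]
  have hwi : (w⁻¹).im = M a 1 / (M a 0 * M a 0 + M a 1 * M a 1) := by
    rw [Complex.inv_im, Complex.normSq_apply]; simp [hw]
  have ha0 : M' a 0 = 1 := by
    rw [hent, complexMatrix_apply, hwr, hwi]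
    simp
    field_simp
  have ha1 : M' a 1 = 0 := by
    rw [hent, complexMatrix_apply, hwr, hwi]
    simp
    ring
  have hb1 : M' b 1 = 0 := by
    rw [hent, complexMatrix_apply, hwr, hwi]
    simp
    field_simp
    linarith
  set g := Matrix.krylovPoly σ a b P with hg
  have him : (aeval z g).im = 0 := by
    have h1 : ((Matrix.krylov σ a P).adjugate * (Matrix.krylov σ a P * M')) b 1 = 0 := by
      rw [← Matrix.mul_assoc, Matrix.adjugate_mul, Matrix.smul_mul, Matrix.one_mul,
        Matrix.smul_apply, hb1, smul_zero]
    have h2 : aeval (complexMatrix z) g 0 1 = 0 := by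
      rw [← h1, hg, Matrix.aeval_krylovPoly, Matrix.sum_apply, Matrix.mul_apply]
      refine Finset.sum_congr rfl fun i _ => ?_
      rw [Matrix.krylov_mul hPM', Matrix.smul_apply, smul_eq_mul, Matrix.mul_apply,
        Fin.sum_univ_two, ha0, ha1]
      simp
    rw [aeval_complexMatrix, complexMatrix_apply] at h2
    simpa using h2
  have hgP : aeval P g * M' = M' * aeval (complexMatrix z) g := Matrix.aeval_intertwine hPM' g
  let u : Matrix α (Fin 1) ℝ := Matrix.of fun i _ => M' i 1
  have hu : u = 0 := by
    refine Matrix.eq_zero_of_row_eq_zero (Δ := !![(aeval z g).re]) hP' ?_ fun j => ha1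
    ext i j
    have := congrFun (congrFun hgP i) 1
    rw [aeval_complexMatrix, complexMatrix_apply, him, Matrix.mul_apply, Matrix.mul_apply,
      Fin.sum_univ_two] at this
    rw [Matrix.mul_apply, Matrix.mul_apply]
    simpa [u] using this
  have h3 := congrFun (congrFun hPM' a) 1
  have hu' : ∀ i, M' i 1 = 0 := fun i => congrFun (congrFun hu i) 0
  rw [Matrix.mul_apply, Matrix.mul_apply, Fin.sum_univ_two, ha0, ha1, complexMatrix_apply] at h3
  simp [hu'] at h3
  exact hz h3

/-- The two columns are the real part and the negative imaginary part of a complex eigenvector. -/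
theorem Matrix.exists_mul_eq_mul_complexMatrix {P : Matrix α α ℝ} {z : ℂ}
    (hz : aeval z P.charpoly = 0) :
    ∃ M : Matrix α (Fin 2) ℝ, M ≠ 0 ∧ P * M = M * complexMatrix z := by
  have hdet : (Matrix.scalar α z - P.map (algebraMap ℝ ℂ)).det = 0 := by
    rw [← Matrix.eval_charpoly, Matrix.charpoly_map, Polynomial.eval_map_algebraMap, hz]
  obtain ⟨v, hv0, hv⟩ := Matrix.exists_mulVec_eq_zero_iff.2 hdet
  rw [Matrix.sub_mulVec, sub_eq_zero] at hv
  refine ⟨Matrix.of fun i j => if j = 0 then (v i).re else -(v i).im, fun h0 => hv0 ?_, ?_⟩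
  · funext i
    have h1 := congrFun (congrFun h0 i) 0
    have h2 := congrFun (congrFun h0 i) 1
    simp at h1 h2
    exact Complex.ext h1 h2
  · ext i j
    have hi := congrFun hv i
    have e : (Matrix.scalar α z *ᵥ v) i = z * v i := by
      simp [Matrix.scalar_apply, Matrix.mulVec_diagonal]
    rw [e, Matrix.mulVec, dotProduct] at hi
    simp only [Matrix.map_apply, Complex.coe_algebraMap] at hi
    have h1 := congrArg Complex.re hi
    have h2 := congrArg Complex.im hi
    simp only [Complex.re_sum, Complex.im_sum, Complex.re_ofReal_mul, Complex.im_ofReal_mul,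
      Complex.mul_re, Complex.mul_im, Complex.ofReal_re, Complex.ofReal_im, zero_mul, sub_zero,
      add_zero] at h1 h2
    rw [Matrix.mul_apply, Matrix.mul_apply, Fin.sum_univ_two, complexMatrix_apply]
    fin_cases j
    · simp; linarith
    · simp; linarith

theorem Matrix.aeval_charpoly_eq_zero {P : Matrix α α ℝ} {z : ℂ} {M : Matrix α (Fin 2) ℝ}
    (hM : M ≠ 0) (h : P * M = M * complexMatrix z) : aeval z P.charpoly = 0 := by
  by_contra hne
  have := Matrix.aeval_intertwine h P.charpoly
  rw [Matrix.aeval_self_charpoly, Matrix.zero_mul, aeval_complexMatrix] at this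
  exact hM (Matrix.eq_zero_of_mul_complexMatrix hne this.symm)

theorem Matrix.exists_mul_eq_mul_real {P : Matrix α α ℝ} {x : ℝ} (hx : P.charpoly.IsRoot x) :
    ∃ M : Matrix α (Fin 1) ℝ, M ≠ 0 ∧ P * M = M * !![x] := by
  have hdet : (Matrix.scalar α x - P).det = 0 := by
    rw [← Matrix.eval_charpoly]; exact hx
  obtain ⟨v, hv0, hv⟩ := Matrix.exists_mulVec_eq_zero_iff.2 hdet
  rw [Matrix.sub_mulVec, sub_eq_zero] at hv
  refine ⟨Matrix.of fun i _ => v i, fun h0 => hv0 (funext fun i => congrFun (congrFun h0 i) 0), ?_⟩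
  ext i j
  have hi := congrFun hv i
  have e : (Matrix.scalar α x *ᵥ v) i = x * v i := by
    simp [Matrix.scalar_apply, Matrix.mulVec_diagonal]
  rw [e, Matrix.mulVec, dotProduct] at hi
  rw [Matrix.mul_apply, Matrix.mul_apply]
  simp [← hi, mul_comm]

theorem Matrix.isRoot_charpoly {P : Matrix α α ℝ} {x : ℝ} {M : Matrix α (Fin 1) ℝ}
    (hM : M ≠ 0) (h : P * M = M * !![x]) : P.charpoly.IsRoot x := by
  by_contra hne
  have := Matrix.aeval_intertwine h P.charpoly
  have e : ∀ q : Polynomial ℝ, aeval (!![x] : Matrix (Fin 1) (Fin 1) ℝ) q = q.eval x • 1 := by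
    intro q
    have : (!![x] : Matrix (Fin 1) (Fin 1) ℝ) = algebraMap ℝ _ x := by
      ext i j; fin_cases i; fin_cases j; simp [Matrix.algebraMap_matrix_apply]
    rw [this, Polynomial.aeval_algebraMap_apply, Algebra.algebraMap_eq_smul_one]
    simp
  rw [Matrix.aeval_self_charpoly, Matrix.zero_mul, e, Matrix.mul_smul, Matrix.mul_one] at this
  exact (smul_ne_zero hne hM) this.symm

end Genericity

/-! ### Almost sure genericity of products of matrices. -/

section GenericSequences

attribute [local instance] matrixMeasureSpace matrix_borelSpace matrix_isAddHaarMeasure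
  matrix_sigmaFinite matrix_secondCountable isAddHaarMeasure_pi_pi_pi isAddHaarMeasure_seq isAddHaarMeasure_seq_prod

open Polynomial (aeval)

variable {α ι κ : Type*} [Fintype α] [Fintype ι] [Fintype κ] [DecidableEq α] [DecidableEq ι]
  [DecidableEq κ] {r m N : ℕ}

/-- The product of the list `X` starting at position `l` and returning cyclically. -/
def cyclicProd (X : Fin m → Matrix α α ℝ) (l : ℕ) : Matrix α α ℝ :=
  (((List.finRange m).rotate l).map X).prod

theorem tailProd_eq_map (X : Fin m → Matrix α α ℝ) (l : ℕ) :
    tailProd X l = (((List.finRange m).drop l).map X).prod := by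
  rw [tailProd, List.ofFn_eq_map, List.map_drop]

theorem cyclicProd_zero (X : Fin m → Matrix α α ℝ) : cyclicProd X 0 = (List.ofFn X).prod := by
  rw [cyclicProd, List.rotate_zero, List.ofFn_eq_map]

/-- Transports eigenvectors of the full product to eigenvectors of the product started at position
`l`. -/
theorem cyclicProd_mul_tailProd (X : Fin m → Matrix α α ℝ) {l : ℕ} (hl : l ≤ m) :
    cyclicProd X l * tailProd X l = tailProd X l * (List.ofFn X).prod := by
  rw [cyclicProd, List.rotate_eq_drop_append_take (by simpa using hl), List.map_append,
    List.prod_append, ← tailProd_eq_map, Matrix.mul_assoc, tailProd_eq_map, ← List.prod_append,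
    ← List.map_append, List.take_append_drop, List.ofFn_eq_map]

theorem PolyOnLines.matrix_list_prod (L : List (Fin m)) :
    ∀ i j, PolyOnLines fun X : Fin m → Matrix α α ℝ => (L.map X).prod i j := by
  induction L with
  | nil => intro i j; simp_rw [List.map_nil, List.prod_nil]; exact const _
  | cons l L ih =>
    intro i j
    simp_rw [List.map_cons, List.prod_cons]
    exact matrix_mul (fun i j => entry l i j) ih i j

theorem list_prod_ite_eq_pow (L : List (Fin (r + 1))) (P : Matrix α α ℝ) :
    (L.map fun l => if l = 0 then P else 1).prod = P ^ L.count 0 := by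
  induction L with
  | nil => simp
  | cons l L ih =>
    rw [List.map_cons, List.prod_cons, ih, List.count_cons]
    by_cases h : l = 0
    · simp [h, pow_succ']
    · simp [h]

/-- This sequence is the test point for the genericity statements: a condition on all cyclic
products becomes a condition on the single matrix `P`. -/
theorem cyclicProd_ite (P : Matrix α α ℝ) (l : ℕ) :
    cyclicProd (fun l : Fin (r + 1) => if l = 0 then P else 1) l = P := by
  rw [cyclicProd, list_prod_ite_eq_pow, List.count_eq_one_of_mem, pow_one]
  · exact List.nodup_rotate.2 (List.nodup_finRange _)
  · exact List.mem_rotate.2 (List.mem_finRange _)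

/-- The shift matrix of an enumeration. -/
def shiftMatrix (σ : α ≃ Fin N) : Matrix α α ℝ :=
  Matrix.of fun i j => if (σ j : ℕ) = σ i + 1 then 1 else 0

theorem shiftMatrix_pow_apply (σ : α ≃ Fin N) {a : α} (ha : (σ a : ℕ) = 0) (k : ℕ) (j : α) :
    (shiftMatrix σ ^ k) a j = if (σ j : ℕ) = k then 1 else 0 := by
  induction k generalizing j with
  | zero =>
    rw [pow_zero, Matrix.one_apply]
    refine if_congr ⟨fun h => by rw [← h, ha], fun h => ?_⟩ rfl rfl
    exact σ.injective (Fin.ext (by rw [ha, h]))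
  | succ k ih =>
    rw [pow_succ, Matrix.mul_apply]
    simp_rw [ih, shiftMatrix, Matrix.of_apply, ite_mul, one_mul, zero_mul]
    by_cases hj : (σ j : ℕ) = k + 1
    · rw [if_pos hj, Finset.sum_eq_single (σ.symm ⟨k, by have := (σ j).2; omega⟩)]
      · simp [hj]
      · intro i _ hi
        rw [if_neg]
        intro h
        exact hi (σ.injective (Fin.ext (by simp [h])))
      · simp
    · rw [if_neg hj]
      refine Finset.sum_eq_zero fun i _ => ?_
      by_cases hi : (σ i : ℕ) = k
      · rw [if_pos hi, if_neg (by rwa [hi])]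
      · rw [if_neg hi]

/-- The powers of the shift move the first basis row vector through the whole basis. -/
theorem krylov_shiftMatrix (σ : α ≃ Fin N) {a : α} (ha : (σ a : ℕ) = 0) :
    Matrix.krylov (fun i => (σ i : ℕ)) a (shiftMatrix σ) = 1 := by
  ext i j
  rw [Matrix.krylov, Matrix.of_apply, shiftMatrix_pow_apply σ ha, Matrix.one_apply]
  refine if_congr ⟨fun h => σ.injective (Fin.ext h.symm), fun h => by rw [h]⟩ rfl rfl

theorem PolyOnLines.krylov {E : Type*} [TopologicalSpace E] [AddCommGroup E] [Module ℝ E]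
    {M : E → Matrix α α ℝ} (hM : ∀ i j, PolyOnLines fun x => M x i j) (σ : α → ℕ) (a i j : α) :
    PolyOnLines fun x => Matrix.krylov σ a (M x) i j :=
  matrix_pow hM (σ i) a j

theorem PolyOnLines.smul_matrix_sum {E : Type*} [TopologicalSpace E] [AddCommGroup E] [Module ℝ E]
    {β : Type*} {s : Finset β} {c : β → E → ℝ} {M : β → E → Matrix α α ℝ}
    (hc : ∀ k ∈ s, PolyOnLines (c k)) (hM : ∀ k ∈ s, ∀ i j, PolyOnLines fun x => M k x i j) (i j : α) :
    PolyOnLines fun x => (∑ k ∈ s, c k x • M k x) i j := by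
  simp_rw [Matrix.sum_apply, Matrix.smul_apply, smul_eq_mul]
  exact sum fun k hk => (hc k hk).mul (hM k hk i j)

theorem ae_det_krylov_ne_zero (σ : α ≃ Fin N) {a : α} (ha : (σ a : ℕ) = 0) (r : ℕ) :
    ∀ᵐ X : Fin (r + 1) → Matrix α α ℝ, ∀ l : ℕ,
      (Matrix.krylov (fun i => (σ i : ℕ)) a (cyclicProd X l)).det ≠ 0 := by
  refine ae_all_iff.2 fun l => (PolyOnLines.det (PolyOnLines.krylov
    (PolyOnLines.matrix_list_prod _) _ a)).ae_ne_zero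
      (fun l => if l = 0 then shiftMatrix σ else 1) ?_
  have := cyclicProd_ite (r := r) (shiftMatrix σ) l
  rw [cyclicProd] at this
  rw [this, krylov_shiftMatrix σ ha, Matrix.det_one]
  exact one_ne_zero

theorem ae_det_krylov_krylovPoly_ne_zero (σ : α ≃ Fin N) {a b : α} (ha : (σ a : ℕ) = 0)
    (hb : (σ b : ℕ) = 1) (r : ℕ) :
    ∀ᵐ X : Fin (r + 1) → Matrix α α ℝ, ∀ l : ℕ,
      (Matrix.krylov (fun i => (σ i : ℕ)) a (aeval (cyclicProd X l)
        (Matrix.krylovPoly (fun i => (σ i : ℕ)) a b (cyclicProd X l)))).det ≠ 0 := by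
  refine ae_all_iff.2 fun l => ?_
  simp_rw [Matrix.aeval_krylovPoly]
  have h1 : ∀ i j, PolyOnLines fun X : Fin (r + 1) → Matrix α α ℝ => cyclicProd X l i j :=
    PolyOnLines.matrix_list_prod _
  refine (PolyOnLines.det (PolyOnLines.krylov (PolyOnLines.smul_matrix_sum
    (fun k _ => PolyOnLines.adjugate (PolyOnLines.krylov h1 _ a) b k)
    fun k _ => PolyOnLines.matrix_pow h1 _) _ a)).ae_ne_zero
      (fun l => if l = 0 then shiftMatrix σ else 1) ?_
  -- At the shift matrix the Krylov polynomial is the variable itself, because `b` has index 1; the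
  -- outer Krylov matrix is therefore again the identity.
  rw [cyclicProd_ite, krylov_shiftMatrix σ ha, Matrix.adjugate_one, Finset.sum_eq_single b]
  · rw [hb, Matrix.one_apply_eq, one_smul, pow_one, krylov_shiftMatrix σ ha, Matrix.det_one]
    exact one_ne_zero
  · intro i _ hi
    rw [Matrix.one_apply_ne hi.symm, zero_smul]
  · simp

theorem Matrix.aeval_diagonal (d : α → ℝ) (q : Polynomial ℝ) :
    aeval (Matrix.diagonal d) q = Matrix.diagonal fun i => q.eval (d i) := by
  induction q using Polynomial.induction_on' with
  | add p q hp hq => rw [map_add, hp, hq, Matrix.diagonal_add]; simp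
  | monomial n c =>
    rw [Polynomial.aeval_monomial, Matrix.diagonal_pow, Algebra.algebraMap_eq_smul_one,
      Matrix.smul_mul, Matrix.one_mul, ← Matrix.diagonal_smul]
    simp [Pi.smul_def]

/-- Lagrange interpolation expresses the derivative through values of the characteristic polynomial.
These are determinants, so polynomial dependence on the entries becomes visible. -/
theorem Matrix.aeval_derivative_charpoly (P : Matrix α α ℝ) :
    aeval P P.charpoly.derivative = ∑ j ∈ Finset.range (Fintype.card α + 1),
      P.charEval j • aeval P (Lagrange.basis (Finset.range (Fintype.card α + 1))
        (fun j : ℕ => (j : ℝ)) j).derivative := by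
  have h := Lagrange.eq_interpolate (s := Finset.range (Fintype.card α + 1))
    (v := fun j : ℕ => (j : ℝ)) (f := P.charpoly) (fun a _ b _ h => Nat.cast_injective h) (by
      rw [Finset.card_range]
      refine lt_of_le_of_lt Polynomial.degree_le_natDegree ?_
      rw [Matrix.charpoly_natDegree_eq_dim]
      exact_mod_cast Nat.lt_succ_self _)
  conv_lhs => rw [h, Lagrange.interpolate_apply]
  simp [Polynomial.derivative_sum, map_sum, Algebra.smul_def, Matrix.charEval]

theorem PolyOnLines.aeval_matrix {E : Type*} [TopologicalSpace E] [AddCommGroup E] [Module ℝ E]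
    {M : E → Matrix α α ℝ} (hM : ∀ i j, PolyOnLines fun x => M x i j) (q : Polynomial ℝ) (i j : α) :
    PolyOnLines fun x => aeval (M x) q i j := by
  simp_rw [Polynomial.aeval_eq_sum_range]
  exact smul_matrix_sum (c := fun k _ => q.coeff k) (fun k _ => const _)
    (fun k _ => matrix_pow hM k) i j

theorem PolyOnLines.charEval {E : Type*} [TopologicalSpace E] [AddCommGroup E] [Module ℝ E]
    {M : E → Matrix α α ℝ} (hM : ∀ i j, PolyOnLines fun x => M x i j) (k : ℕ) :
    PolyOnLines fun x => (M x).charEval k := by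
  simp_rw [Matrix.charEval, Matrix.eval_charpoly]
  refine det fun i j => ?_
  simp_rw [Matrix.sub_apply, sub_eq_add_neg, ← neg_one_mul (M _ i j)]
  exact (const _).add ((const _).mul (hM i j))

/-- Almost surely, the eigenvalues of a product are simple. -/
theorem ae_det_aeval_derivative_ne_zero (r : ℕ) :
    ∀ᵐ X : Fin (r + 1) → Matrix α α ℝ, (aeval (List.ofFn X).prod
      (List.ofFn X).prod.charpoly.derivative).det ≠ 0 := by
  simp_rw [← cyclicProd_zero, Matrix.aeval_derivative_charpoly]
  have h1 : ∀ i j, PolyOnLines fun X : Fin (r + 1) → Matrix α α ℝ => cyclicProd X 0 i j :=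
    PolyOnLines.matrix_list_prod _
  let σ := Fintype.equivFin α
  refine (PolyOnLines.det (PolyOnLines.smul_matrix_sum (fun k _ => PolyOnLines.charEval h1 k)
    fun k _ => PolyOnLines.aeval_matrix h1 _)).ae_ne_zero
      (fun l => if l = 0 then Matrix.diagonal fun i => ((σ i : ℕ) : ℝ) else 1) ?_
  -- The test point has the distinct eigenvalues `0, 1, 2, …`, where the derivative does not vanish.
  rw [cyclicProd_ite, ← Matrix.aeval_derivative_charpoly, Matrix.aeval_diagonal, Matrix.det_diagonal]
  refine Finset.prod_ne_zero_iff.2 fun i _ => ?_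
  have hsep : (Matrix.diagonal fun i => ((σ i : ℕ) : ℝ)).charpoly.Separable := by
    rw [Matrix.charpoly_diagonal, Polynomial.separable_prod_X_sub_C_iff]
    intro i j hij
    exact σ.injective (Fin.ext (Nat.cast_injective hij))
  have := hsep.eval₂_derivative_ne_zero (RingHom.id ℝ) (x := ((σ i : ℕ) : ℝ)) (by
    rw [Polynomial.eval₂_id, Matrix.charpoly_diagonal, Polynomial.eval_prod]
    exact Finset.prod_eq_zero (Finset.mem_univ i) (by simp))
  rwa [Polynomial.eval₂_id] at this

end GenericSequences

/-! ### Invariant graphs as a set of spectral data. -/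

section Counting

open Polynomial (aeval)

variable {ι κ : Type*} [Fintype ι] [Fintype κ] [DecidableEq ι] [DecidableEq κ] {r : ℕ}

/-- The matrix whose columns span the graph of `U`. -/
def graphMatrix (U : Matrix κ ι ℝ) : Matrix (ι ⊕ κ) ι ℝ := Matrix.fromRows 1 U

theorem graphMatrix_mul (U : Matrix κ ι ℝ) (E : Matrix ι ι ℝ) :
    graphMatrix U * E = Matrix.fromRows E (U * E) := by
  rw [graphMatrix, Matrix.fromRows_mul, Matrix.one_mul]

theorem mem_invariantGraphs_iff {S : Set (Fin (r + 1) → Matrix ι ι ℝ)}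
    {X : Fin (r + 1) → Matrix (ι ⊕ κ) (ι ⊕ κ) ℝ} {U : Fin (r + 1) → Matrix κ ι ℝ} :
    U ∈ invariantGraphs S X ↔ ∃ G ∈ S, ∀ l, X l * graphMatrix (U (l + 1)) =
      graphMatrix (U l) * G l := by
  have key : ∀ (l) (G : Matrix ι ι ℝ), X l * graphMatrix (U (l + 1)) =
      graphMatrix (U l) * G ↔ (X l).toBlocks₁₁ + (X l).toBlocks₁₂ * U (l + 1) = G ∧
        (X l).toBlocks₂₁ + (X l).toBlocks₂₂ * U (l + 1) = U l * G := by
    intro l G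
    conv_lhs => rw [← Matrix.fromBlocks_toBlocks (X l)]
    rw [graphMatrix_mul, graphMatrix, Matrix.fromBlocks_mul_fromRows, Matrix.mul_one,
      Matrix.mul_one]
    exact Matrix.fromRows_ext_iff _ _ _ _
  simp_rw [key]
  constructor
  · rintro ⟨hS, hR⟩
    refine ⟨_, hS, fun l => ⟨rfl, ?_⟩⟩
    have := congrFun hR l
    simp only [riccati] at this
    rw [← this]
    abel
  · rintro ⟨G, hG, h⟩
    have hG' : (fun l => (X l).toBlocks₁₁ + (X l).toBlocks₁₂ * U (l + 1)) = G :=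
      funext fun l => (h l).1
    refine ⟨by rwa [hG'], funext fun l => ?_⟩
    simp only [riccati]
    rw [(h l).1, ← (h l).2]
    abel

/-- The columns of `Q z l` span the invariant subspace for `z` at position `l`. With invertible top
block it is a graph, namely of the bottom block times the inverse of the top block. Different `z`
give different graphs, since the maps induced on the subspaces have different characteristic
polynomials. -/
theorem encard_invariantGraphs {S : Set (Fin (r + 1) → Matrix ι ι ℝ)}
    {X : Fin (r + 1) → Matrix (ι ⊕ κ) (ι ⊕ κ) ℝ} {ρ : Type*} {R : Set ρ}
    {Q : ρ → Fin (r + 1) → Matrix (ι ⊕ κ) ι ℝ} {Δ : ρ → Fin (r + 1) → Matrix ι ι ℝ}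
    (hQ : ∀ z ∈ R, ∀ l, X l * Q z (l + 1) = Q z l * Δ z l)
    (htop : ∀ z ∈ R, ∀ l, (Q z l).toRows₁.det ≠ 0)
    (hΔ : ∀ z ∈ R, (fun l => (Q z l).toRows₁ * Δ z l * (Q z (l + 1)).toRows₁⁻¹) ∈ S)
    (hinj : ∀ z ∈ R, ∀ z' ∈ R, (List.ofFn (Δ z)).prod.charpoly = (List.ofFn (Δ z')).prod.charpoly →
      z = z')
    (hsurj : ∀ U ∈ invariantGraphs S X, ∃ z ∈ R, ∃ E : Fin (r + 1) → Matrix ι ι ℝ, ∀ l,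
      Q z l = graphMatrix (U l) * E l) :
    (invariantGraphs S X).encard = R.encard := by
  let Φ : ρ → Fin (r + 1) → Matrix κ ι ℝ := fun z l => (Q z l).toRows₂ * (Q z l).toRows₁⁻¹
  have hΦ : ∀ z ∈ R, ∀ l, graphMatrix (Φ z l) = Q z l * (Q z l).toRows₁⁻¹ := by
    intro z hz l
    conv_rhs => rw [← Matrix.fromRows_toRows (Q z l)]
    rw [Matrix.fromRows_mul, Matrix.toRows₁_fromRows, Matrix.mul_nonsing_inv _ (htop z hz l).isUnit]
    rfl
  have hΦeq : ∀ z ∈ R, ∀ l, X l * graphMatrix (Φ z (l + 1)) = graphMatrix (Φ z l) *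
      ((Q z l).toRows₁ * Δ z l * (Q z (l + 1)).toRows₁⁻¹) := by
    intro z hz l
    rw [hΦ z hz, hΦ z hz, ← Matrix.mul_assoc, hQ z hz, Matrix.mul_assoc (Q z l) (_)⁻¹,
      ← Matrix.mul_assoc (_)⁻¹, ← Matrix.mul_assoc (_)⁻¹,
      Matrix.nonsing_inv_mul _ (htop z hz l).isUnit, Matrix.one_mul, Matrix.mul_assoc]
  have himage : invariantGraphs S X = Φ '' R := by
    ext U
    constructor
    · intro hU
      obtain ⟨z, hz, E, hE⟩ := hsurj U hU
      refine ⟨z, hz, funext fun l => ?_⟩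
      have h1 : (Q z l).toRows₁ = E l := by
        rw [hE, graphMatrix_mul, Matrix.toRows₁_fromRows]
      have h2 : (Q z l).toRows₂ = U l * E l := by
        rw [hE, graphMatrix_mul, Matrix.toRows₂_fromRows]
      simp only [Φ]
      rw [h2, ← h1, Matrix.mul_assoc, Matrix.mul_nonsing_inv _ (htop z hz l).isUnit, Matrix.mul_one]
    · rintro ⟨z, hz, rfl⟩
      exact mem_invariantGraphs_iff.2 ⟨_, hΔ z hz, hΦeq z hz⟩
  have hinjOn : Set.InjOn Φ R := by
    intro z hz z' hz' h
    refine hinj z hz z' hz' ?_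
    have hG : (fun l => (Q z l).toRows₁ * Δ z l * (Q z (l + 1)).toRows₁⁻¹) =
        fun l => (Q z' l).toRows₁ * Δ z' l * (Q z' (l + 1)).toRows₁⁻¹ := by
      funext l
      have e := hΦeq z hz l
      rw [h, hΦeq z' hz' l, graphMatrix_mul, graphMatrix_mul] at e
      have := congrArg Matrix.toRows₁ e
      simpa using this.symm
    have h1 := Matrix.charpoly_eq_of_intertwine (htop z hz 0)
      (ofFn_prod_conj (fun l => htop z hz l) (Δ z))
    have h2 := Matrix.charpoly_eq_of_intertwine (htop z' hz' 0)
      (ofFn_prod_conj (fun l => htop z' hz' l) (Δ z'))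
    rw [← h1, ← h2, hG]
  rw [himage, hinjOn.encard_image]

end Counting

/-! ### Invariant graphs correspond to real eigenvalues or conjugate pairs. -/

section CountingRoots

attribute [local instance] matrixMeasureSpace matrix_borelSpace matrix_isAddHaarMeasure
  matrix_sigmaFinite matrix_secondCountable isAddHaarMeasure_pi_pi_pi isAddHaarMeasure_seq isAddHaarMeasure_seq_prod

open Polynomial (aeval)

variable {α ι κ : Type*} [Fintype α] [Fintype ι] [Fintype κ] [DecidableEq α] [DecidableEq ι]
  [DecidableEq κ] {r n : ℕ}

/-- Multiplication by tail products extends an invariant subspace of the full product to a cyclic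
family; in the transported frames all of `Δ` is concentrated in the last step. -/
theorem mul_tailProd_mul {X : Fin (r + 1) → Matrix α α ℝ} {M : Matrix α ι ℝ} {Δ : Matrix ι ι ℝ}
    (h : (List.ofFn X).prod * M = M * Δ) (l : Fin (r + 1)) :
    X l * (tailProd X (l + 1 : Fin (r + 1)) * M) =
      tailProd X l * M * (if l = Fin.last r then Δ else 1) := by
  by_cases hl : l = Fin.last r
  · subst hl
    rw [if_pos rfl, Fin.last_add_one, Fin.val_zero, tailProd_zero, h, tailProd_fin X (Fin.last r),
      tailProd_of_le X (by simp), Matrix.mul_one, Matrix.mul_assoc]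
  · have hval : ((l + 1 : Fin (r + 1)) : ℕ) = l + 1 :=
      Fin.val_add_one_of_lt (Fin.lt_last_iff_ne_last.2 hl)
    rw [if_neg hl, Matrix.mul_one, hval, tailProd_fin X l, Matrix.mul_assoc]

theorem ofFn_ite_last_prod (Δ : Matrix ι ι ℝ) :
    (List.ofFn fun l : Fin (r + 1) => if l = Fin.last r then Δ else 1).prod = Δ := by
  rw [List.ofFn_succ', List.concat_eq_append, List.prod_append]
  simp [(Fin.castSucc_lt_last _).ne]

theorem cyclicProd_tailProd_mul {X : Fin (r + 1) → Matrix α α ℝ} {M : Matrix α ι ℝ}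
    {Δ : Matrix ι ι ℝ} (h : (List.ofFn X).prod * M = M * Δ) (l : Fin (r + 1)) :
    cyclicProd X l * (tailProd X l * M) = tailProd X l * M * Δ := by
  rw [← Matrix.mul_assoc, cyclicProd_mul_tailProd X l.2.le, Matrix.mul_assoc, h, Matrix.mul_assoc]

theorem tailProd_mul_ne_zero {X : Fin (r + 1) → Matrix α α ℝ} (hX : ∀ l, (X l).det ≠ 0)
    {M : Matrix α ι ℝ} (hM : M ≠ 0) (l : ℕ) : tailProd X l * M ≠ 0 := fun h =>
  hM (Matrix.eq_zero_of_mul_eq_zero (det_tailProd_ne_zero hX l) h)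

theorem graphMatrix_ne_zero [Nonempty ι] (U : Matrix κ ι ℝ) : graphMatrix U ≠ 0 := by
  intro h
  have i : ι := Classical.arbitrary ι
  have := congrFun (congrFun h (Sum.inl i)) i
  simp [graphMatrix] at this

/-- The Krylov conditions ensure that an eigenvector of each cyclic product has a non-zero first
coordinate, hence spans a graph, and that every real eigenspace is a line. -/
theorem encard_invariantGraphs_one {σ : Fin 1 ⊕ κ → ℕ}
    {X : Fin (r + 1) → Matrix (Fin 1 ⊕ κ) (Fin 1 ⊕ κ) ℝ} (hX : ∀ l, (X l).det ≠ 0)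
    (hK : ∀ l : ℕ, (Matrix.krylov σ (Sum.inl 0) (cyclicProd X l)).det ≠ 0) :
    (invariantGraphs Set.univ X).encard =
      {x : ℝ | (List.ofFn X).prod.charpoly.IsRoot x}.encard := by
  have hex : ∀ x : ℝ, ∃ M : Matrix (Fin 1 ⊕ κ) (Fin 1) ℝ, (List.ofFn X).prod.charpoly.IsRoot x →
      M ≠ 0 ∧ (List.ofFn X).prod * M = M * !![x] := by
    intro x
    by_cases hx : (List.ofFn X).prod.charpoly.IsRoot x
    · obtain ⟨M, hM⟩ := Matrix.exists_mul_eq_mul_real hx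
      exact ⟨M, fun _ => hM⟩
    · exact ⟨0, fun h => absurd h hx⟩
  choose Q hQ using hex
  have htop : ∀ x, (List.ofFn X).prod.charpoly.IsRoot x → ∀ l : Fin (r + 1),
      (tailProd X l * Q x).toRows₁.det ≠ 0 := by
    intro x hx l h0
    refine tailProd_mul_ne_zero hX (hQ x hx).1 l (Matrix.eq_zero_of_row_eq_zero (hK l)
      (cyclicProd_tailProd_mul (hQ x hx).2 l) fun j => ?_)
    rw [Matrix.det_fin_one] at h0
    rw [Subsingleton.elim j 0]
    exact h0
  refine encard_invariantGraphs (Q := fun x l => tailProd X l * Q x)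
    (Δ := fun x l => if l = Fin.last r then !![x] else 1) ?_ htop (fun _ _ => Set.mem_univ _) ?_ ?_
  · exact fun x hx l => mul_tailProd_mul (hQ x hx).2 l
  · intro x _ y _ h
    rw [ofFn_ite_last_prod, ofFn_ite_last_prod] at h
    have := congrArg (Polynomial.eval x) h
    simp only [Matrix.eval_charpoly, Matrix.det_fin_one] at this
    simp [Matrix.scalar_apply] at this
    linarith
  · intro U hU
    obtain ⟨G, -, hG⟩ := mem_invariantGraphs_iff.1 hU
    have h0 := ofFn_prod_intertwine (M := fun l => graphMatrix (U l)) hG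
    set x := (List.ofFn G).prod 0 0 with hxdef
    have hx1 : (List.ofFn G).prod = !![x] := by
      ext i j; fin_cases i; fin_cases j; rfl
    rw [hx1] at h0
    have hx : (List.ofFn X).prod.charpoly.IsRoot x :=
      Matrix.isRoot_charpoly (graphMatrix_ne_zero (U 0)) h0
    have hcomm : (Q x).toRows₁ * !![x] = !![x] * (Q x).toRows₁ := by
      ext i j; fin_cases i; fin_cases j; simp [Matrix.mul_apply, mul_comm]
    have hK0 := hK 0
    rw [cyclicProd_zero] at hK0
    -- Both terms satisfy the eigenvector equation for `x` and have the same first coordinate.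
    have hdiff : Q x - graphMatrix (U 0) * (Q x).toRows₁ = 0 := by
      refine Matrix.eq_zero_of_row_eq_zero (Δ := !![x]) hK0 ?_ fun j => ?_
      · rw [Matrix.mul_sub, Matrix.sub_mul, (hQ x hx).2, ← Matrix.mul_assoc, h0, Matrix.mul_assoc,
          Matrix.mul_assoc, hcomm]
      · rw [graphMatrix_mul, Matrix.sub_apply, Matrix.fromRows_apply_inl, Matrix.toRows₁_apply,
          sub_self]
    refine ⟨x, hx, fun l => tailProd G l * (Q x).toRows₁, fun l => ?_⟩
    rw [sub_eq_zero] at hdiff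
    conv_lhs => rw [hdiff]
    rw [← Matrix.mul_assoc, ← Matrix.mul_assoc,
      tailProd_intertwine (M := fun l => graphMatrix (U l)) hG l]

/-- The real `2 × 2` matrices with non-real eigenvalues. -/
def nonrealTwo : Set (Matrix (Fin 2) (Fin 2) ℝ) := {G | G.trace ^ 2 < 4 * G.det}

theorem measurableSet_nonrealTwo : MeasurableSet nonrealTwo :=
  (isOpen_lt (by fun_prop) (by fun_prop)).measurableSet

theorem mem_nonrealTwo_of_intertwine {A B M : Matrix (Fin 2) (Fin 2) ℝ} (hM : M.det ≠ 0)
    (h : A * M = M * B) : A ∈ nonrealTwo ↔ B ∈ nonrealTwo := by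
  have e : A = M * B * M⁻¹ := by
    rw [← h, Matrix.mul_assoc, Matrix.mul_nonsing_inv _ hM.isUnit, Matrix.mul_one]
  have ht : A.trace = B.trace := by
    rw [e, Matrix.trace_mul_comm, ← Matrix.mul_assoc, Matrix.nonsing_inv_mul _ hM.isUnit,
      Matrix.one_mul]
  have hd : A.det = B.det := by
    have := congrArg Matrix.det h
    rw [Matrix.det_mul, Matrix.det_mul, mul_comm] at this
    exact mul_left_cancel₀ hM this
  simp only [nonrealTwo, Set.mem_ofPred_eq, ht, hd]

theorem nonrealTwo_conj (g G : Matrix (Fin 2) (Fin 2) ℝ) (hg : g.det ≠ 0) :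
    g * G * g⁻¹ ∈ nonrealTwo ↔ G ∈ nonrealTwo :=
  mem_nonrealTwo_of_intertwine hg (by
    rw [Matrix.mul_assoc, Matrix.nonsing_inv_mul _ hg.isUnit, Matrix.mul_one])

theorem complexMatrix_mem_nonrealTwo {z : ℂ} (hz : 0 < z.im) : complexMatrix z ∈ nonrealTwo := by
  rw [complexMatrix_apply, nonrealTwo, Set.mem_ofPred_eq, Matrix.trace_fin_two_of,
    Matrix.det_fin_two_of]
  nlinarith [mul_pos hz hz]

theorem exists_intertwine_complexMatrix {G : Matrix (Fin 2) (Fin 2) ℝ} (hG : G ∈ nonrealTwo) :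
    ∃ z : ℂ, 0 < z.im ∧ ∃ E : Matrix (Fin 2) (Fin 2) ℝ, E.det ≠ 0 ∧
      G * E = E * complexMatrix z := by
  obtain ⟨a, b, c, d, rfl⟩ : ∃ a b c d, G = !![a, b; c, d] :=
    ⟨_, _, _, _, Matrix.eta_fin_two G⟩
  simp only [nonrealTwo, Set.mem_ofPred_eq, Matrix.trace_fin_two_of, Matrix.det_fin_two_of] at hG
  have hb : b ≠ 0 := by
    rintro rfl
    nlinarith [sq_nonneg (a - d)]
  have hpos : 0 < 4 * (a * d - b * c) - (a + d) ^ 2 := by linarith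
  set s := Real.sqrt (4 * (a * d - b * c) - (a + d) ^ 2) with hs
  have hs0 : 0 < s := Real.sqrt_pos.2 hpos
  have hs2 : s ^ 2 = 4 * (a * d - b * c) - (a + d) ^ 2 := Real.sq_sqrt hpos.le
  -- The columns are the real and the negative imaginary part of the eigenvector `(b, z - a)`.
  refine ⟨⟨(a + d) / 2, s / 2⟩, by positivity, !![b, 0; (a + d) / 2 - a, -(s / 2)], ?_, ?_⟩
  · rw [Matrix.det_fin_two_of]
    simp only [zero_mul, sub_zero]
    exact mul_ne_zero hb (by linarith)
  · rw [complexMatrix_apply]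
    ext i j
    fin_cases i <;> fin_cases j <;> simp [Matrix.mul_apply, Fin.sum_univ_two] <;> nlinarith

/-- The factor `w` is the quotient of the complex coordinates at `a`; after this scaling the frames
agree in row `a`, hence everywhere. -/
theorem Matrix.exists_eq_mul_complexMatrix {σ : α → ℕ} {a : α} {P : Matrix α α ℝ} {z : ℂ}
    {M M' : Matrix α (Fin 2) ℝ} (hP : (Matrix.krylov σ a P).det ≠ 0)
    (h : P * M = M * complexMatrix z) (h' : P * M' = M' * complexMatrix z) (hM' : M' ≠ 0) :
    ∃ w : ℂ, M = M' * complexMatrix w := by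
  set u : ℂ := ⟨M' a 0, -M' a 1⟩ with hu
  set v : ℂ := ⟨M a 0, -M a 1⟩ with hv
  have hu0 : u ≠ 0 := by
    intro h0
    refine hM' (Matrix.eq_zero_of_row_eq_zero hP h' fun j => ?_)
    have h1 := congrArg Complex.re h0
    have h2 := congrArg Complex.im h0
    simp only [hu, Complex.zero_re, Complex.zero_im, neg_eq_zero] at h1 h2
    fin_cases j
    · exact h1
    · exact h2
  refine ⟨v / u, ?_⟩
  rw [← sub_eq_zero]
  refine Matrix.eq_zero_of_row_eq_zero (Δ := complexMatrix z) hP ?_ fun j => ?_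
  · rw [Matrix.mul_sub, Matrix.sub_mul, h, ← Matrix.mul_assoc, h', Matrix.mul_assoc,
      Matrix.mul_assoc, ← map_mul, ← map_mul, mul_comm]
  · have hw : u * (v / u) = v := mul_div_cancel₀ _ hu0
    have h1 := congrArg Complex.re hw
    have h2 := congrArg Complex.im hw
    generalize v / u = w at h1 h2 ⊢
    simp only [Complex.mul_re, Complex.mul_im, hu, hv] at h1 h2
    rw [Matrix.sub_apply, Matrix.mul_apply, Fin.sum_univ_two, complexMatrix_apply]
    fin_cases j
    · simp; linarith
    · simp; linarith

/-- Conjugate eigenvalues define the same real plane, and the upper half-plane selects one of them.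
Membership in `nonrealTwo` excludes planes on which the product has real eigenvalues. The second
Krylov condition makes the planes graphs, by `Matrix.top_det_ne_zero`. -/
theorem encard_invariantGraphs_two {σ : Fin 2 ⊕ κ → ℕ}
    {X : Fin (r + 1) → Matrix (Fin 2 ⊕ κ) (Fin 2 ⊕ κ) ℝ} (hX : ∀ l, (X l).det ≠ 0)
    (hK : ∀ l : ℕ, (Matrix.krylov σ (Sum.inl 0) (cyclicProd X l)).det ≠ 0)
    (hK' : ∀ l : ℕ, (Matrix.krylov σ (Sum.inl 0) (aeval (cyclicProd X l)
      (Matrix.krylovPoly σ (Sum.inl 0) (Sum.inl 1) (cyclicProd X l)))).det ≠ 0) :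
    (invariantGraphs {G | (List.ofFn G).prod ∈ nonrealTwo} X).encard =
      {z : ℂ | 0 < z.im ∧ aeval z (List.ofFn X).prod.charpoly = 0}.encard := by
  have hex : ∀ z : ℂ, ∃ M : Matrix (Fin 2 ⊕ κ) (Fin 2) ℝ,
      aeval z (List.ofFn X).prod.charpoly = 0 →
      M ≠ 0 ∧ (List.ofFn X).prod * M = M * complexMatrix z := by
    intro z
    by_cases hz : aeval z (List.ofFn X).prod.charpoly = 0
    · obtain ⟨M, hM⟩ := Matrix.exists_mul_eq_mul_complexMatrix hz
      exact ⟨M, fun _ => hM⟩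
    · exact ⟨0, fun h => absurd h hz⟩
  choose Q hQ using hex
  have htop : ∀ z ∈ {z : ℂ | 0 < z.im ∧ aeval z (List.ofFn X).prod.charpoly = 0},
      ∀ l : Fin (r + 1), (tailProd X l * Q z).toRows₁.det ≠ 0 := by
    rintro z ⟨hz, hz'⟩ l
    have := Matrix.top_det_ne_zero (hK l) (hK' l) (cyclicProd_tailProd_mul (hQ z hz').2 l) hz.ne'
      (tailProd_mul_ne_zero hX (hQ z hz').1 l)
    rw [Matrix.det_fin_two]
    exact this
  refine encard_invariantGraphs (Q := fun z l => tailProd X l * Q z)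
    (Δ := fun z l => if l = Fin.last r then complexMatrix z else 1) ?_ htop ?_ ?_ ?_
  · exact fun z hz l => mul_tailProd_mul (hQ z hz.2).2 l
  · intro z hz
    have := ofFn_prod_conj (fun l => htop z hz l) (fun l => if l = Fin.last r then complexMatrix z else 1)
    rw [ofFn_ite_last_prod] at this
    exact (mem_nonrealTwo_of_intertwine (htop z hz 0) this).2 (complexMatrix_mem_nonrealTwo hz.1)
  · intro z hz w hw h
    rw [ofFn_ite_last_prod, ofFn_ite_last_prod, Matrix.charpoly_fin_two, Matrix.charpoly_fin_two,
      complexMatrix_apply, complexMatrix_apply, Matrix.trace_fin_two_of, Matrix.trace_fin_two_of,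
      Matrix.det_fin_two_of, Matrix.det_fin_two_of] at h
    have h0 := congrArg (Polynomial.eval 0) h
    have h1 := congrArg (Polynomial.eval 1) h
    simp at h0 h1
    have hre : z.re = w.re := by linarith
    have him : z.im * z.im = w.im * w.im := by rw [hre] at h0; linarith
    refine Complex.ext hre ?_
    nlinarith [hz.1, hw.1, mul_pos hz.1 hw.1]
  · intro U hU
    obtain ⟨G, hGS, hG⟩ := mem_invariantGraphs_iff.1 hU
    have h0 := ofFn_prod_intertwine (M := fun l => graphMatrix (U l)) hG
    obtain ⟨z, hz, E, hE, hGE⟩ := exists_intertwine_complexMatrix hGS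
    have h1 : (List.ofFn X).prod * (graphMatrix (U 0) * E) =
        graphMatrix (U 0) * E * complexMatrix z := by
      rw [← Matrix.mul_assoc, h0, Matrix.mul_assoc, hGE, Matrix.mul_assoc]
    have hne : graphMatrix (U 0) * E ≠ 0 := by
      intro h
      have h2 := congrArg Matrix.toRows₁ h
      rw [graphMatrix_mul, Matrix.toRows₁_fromRows] at h2
      apply hE
      rw [h2]
      exact Matrix.det_zero
    have hz' := Matrix.aeval_charpoly_eq_zero hne h1
    have hK0 := hK 0
    rw [cyclicProd_zero] at hK0
    obtain ⟨w, hw⟩ := Matrix.exists_eq_mul_complexMatrix hK0 (hQ z hz').2 h1 hne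
    refine ⟨z, ⟨hz, hz'⟩, fun l => tailProd G l * (E * complexMatrix w), fun l => ?_⟩
    conv_lhs => rw [hw]
    rw [Matrix.mul_assoc (graphMatrix (U 0)), ← Matrix.mul_assoc,
      tailProd_intertwine (M := fun l => graphMatrix (U l)) hG l, Matrix.mul_assoc]

theorem ae_encard_invariantGraphs_one (n r : ℕ) :
    ∀ᵐ X : Fin (r + 1) → Matrix (Fin 1 ⊕ Fin n) (Fin 1 ⊕ Fin n) ℝ,
      (invariantGraphs Set.univ X).encard =
        {x : ℝ | (List.ofFn X).prod.charpoly.IsRoot x}.encard := by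
  filter_upwards [ae_det_ne_zero (r + 1),
    ae_det_krylov_ne_zero (finSumFinEquiv : Fin 1 ⊕ Fin n ≃ _) (a := Sum.inl 0) (by simp) r]
    with X h1 h2
  exact encard_invariantGraphs_one h1 h2

theorem ae_encard_invariantGraphs_two (n r : ℕ) :
    ∀ᵐ X : Fin (r + 1) → Matrix (Fin 2 ⊕ Fin n) (Fin 2 ⊕ Fin n) ℝ,
      (invariantGraphs {G | (List.ofFn G).prod ∈ nonrealTwo} X).encard =
        {z : ℂ | 0 < z.im ∧ aeval z (List.ofFn X).prod.charpoly = 0}.encard := by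
  filter_upwards [ae_det_ne_zero (r + 1),
    ae_det_krylov_ne_zero (finSumFinEquiv : Fin 2 ⊕ Fin n ≃ _) (a := Sum.inl 0) (by simp) r,
    ae_det_krylov_krylovPoly_ne_zero (finSumFinEquiv : Fin 2 ⊕ Fin n ≃ _) (a := Sum.inl 0)
      (b := Sum.inl 1) (by simp) (by simp) r] with X h1 h2 h3
  exact encard_invariantGraphs_two h1 h2 h3

end CountingRoots

/-! ### The weights as densities of products. -/

section PushForward

attribute [local instance] matrixMeasureSpace matrix_borelSpace matrix_isAddHaarMeasure
  matrix_sigmaFinite matrix_secondCountable isAddHaarMeasure_pi_pi_pi isAddHaarMeasure_seq isAddHaarMeasure_seq_prod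

variable {r : ℕ}

theorem ae_prod_ne_zero (r : ℕ) : ∀ᵐ t : Fin r → ℝ, ∏ l, t l ≠ 0 := by
  have h : ∀ l : Fin r, ∀ᵐ t : Fin r → ℝ, t l ≠ 0 := fun l =>
    (Measure.quasiMeasurePreserving_eval (fun _ : Fin r => (volume : Measure ℝ)) l).ae
      (Measure.ae_ne volume 0)
  filter_upwards [ae_all_iff.2 h] with t ht
  exact Finset.prod_ne_zero_iff.2 fun l _ => ht l

theorem measurable_scalarGauss : Measurable scalarGauss := by
  unfold scalarGauss
  fun_prop

theorem measurable_realWeight_integrand (r : ℕ) : Measurable fun q : ℝ × (Fin r → ℝ) =>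
    (∏ l, scalarGauss (q.2 l)) * scalarGauss (q.1 / ∏ l, q.2 l) *
      (ENNReal.ofReal |∏ l, q.2 l|)⁻¹ := by
  have hp : Measurable fun q : ℝ × (Fin r → ℝ) => ∏ l, q.2 l := by fun_prop
  refine ((Finset.measurable_fun_prod _ fun l _ => measurable_scalarGauss.comp (by fun_prop)).mul
    (measurable_scalarGauss.comp (measurable_fst.div hp))).mul ?_
  exact (ENNReal.measurable_ofReal.comp (continuous_abs.measurable.comp hp)).inv

theorem measurable_realWeight (m : ℕ) : Measurable (realWeight m) :=
  (measurable_realWeight_integrand (m - 1)).lintegral_prod_right'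

theorem lintegral_comp_mul_left {p : ℝ} (hp : p ≠ 0) (f : ℝ → ℝ≥0∞) :
    ENNReal.ofReal |p| * ∫⁻ s, f (p * s) = ∫⁻ s, f s := by
  have h : LinearMap.det (LinearMap.mulLeft ℝ p) = p := by simp
  have := lintegral_comp_linearMap volume (LinearMap.mulLeft ℝ p) (by rwa [h]) f
  rwa [h] at this

theorem lintegral_snoc {E : Type*} [MeasureSpace E] [SigmaFinite (volume : Measure E)]
    {f : (Fin (r + 1) → E) → ℝ≥0∞} (hf : Measurable f) :
    ∫⁻ t, f t = ∫⁻ t' : Fin r → E, ∫⁻ s : E, f (Fin.snoc t' s) := by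
  have h := (volume_preserving_piFinSuccAbove (fun _ : Fin (r + 1) => E) (Fin.last r)).symm
  have e : ∀ p : E × (Fin r → E), (MeasurableEquiv.piFinSuccAbove (fun _ : Fin (r + 1) => E)
      (Fin.last r)).symm p = Fin.snoc p.2 p.1 := fun p => by
    simp [MeasurableEquiv.piFinSuccAbove]
    rfl
  have hm : Measurable fun p => f ((MeasurableEquiv.piFinSuccAbove (fun _ : Fin (r + 1) => E)
      (Fin.last r)).symm p) := hf.comp h.measurable
  rw [← h.lintegral_comp hf, Measure.volume_eq_prod, lintegral_prod_symm _ hm.aemeasurable]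
  simp_rw [e]

/-- For almost every choice of the first factors their product is non-zero; the last factor is then
rescaled by it, and Fubini exchanges the integrals. -/
theorem lintegral_scalarGauss_comp_prod {f : ℝ → ℝ≥0∞} (hf : Measurable f) :
    ∫⁻ t : Fin (r + 1) → ℝ, (∏ l, scalarGauss (t l)) * f (∏ l, t l) =
      ∫⁻ x, realWeight (r + 1) x * f x := by
  have hm : Measurable fun t : Fin (r + 1) → ℝ => (∏ l, scalarGauss (t l)) * f (∏ l, t l) := by
    have hp : Measurable fun t : Fin (r + 1) → ℝ => ∏ l, t l := by fun_prop
    have h := hf.comp hp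
    exact (Finset.measurable_fun_prod _ fun l _ =>
      measurable_scalarGauss.comp (measurable_pi_apply l)).mul h
  have hm2 : Measurable fun q : ℝ × (Fin r → ℝ) => (∏ l, scalarGauss (q.2 l)) *
      scalarGauss (q.1 / ∏ l, q.2 l) * (ENNReal.ofReal |∏ l, q.2 l|)⁻¹ * f q.1 :=
    (measurable_realWeight_integrand r).mul (hf.comp measurable_fst)
  have hm3 : ∀ x : ℝ, Measurable fun t : Fin r → ℝ => (∏ l, scalarGauss (t l)) *
      scalarGauss (x / ∏ l, t l) * (ENNReal.ofReal |∏ l, t l|)⁻¹ := fun x => by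
    have h := (measurable_realWeight_integrand r).comp (measurable_prodMk_left (x := x))
    exact h
  calc _ = ∫⁻ t : Fin r → ℝ, ∫⁻ x, (∏ l, scalarGauss (t l)) * scalarGauss (x / ∏ l, t l) *
      (ENNReal.ofReal |∏ l, t l|)⁻¹ * f x := by
        rw [lintegral_snoc hm]
        refine lintegral_congr_ae ?_
        filter_upwards [ae_prod_ne_zero r] with t ht
        simp_rw [Fin.prod_univ_castSucc, Fin.snoc_castSucc, Fin.snoc_last]
        rw [← lintegral_comp_mul_left ht fun x => (∏ l, scalarGauss (t l)) *
          scalarGauss (x / ∏ l, t l) * (ENNReal.ofReal |∏ l, t l|)⁻¹ * f x,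
          ← lintegral_const_mul' _ _ ENNReal.ofReal_ne_top]
        refine lintegral_congr fun s => ?_
        rw [mul_div_cancel_left₀ _ ht]
        have h0 : ENNReal.ofReal |∏ l, t l| ≠ 0 := by simpa using ht
        calc _ = (ENNReal.ofReal |∏ l, t l| * (ENNReal.ofReal |∏ l, t l|)⁻¹) *
            ((∏ l, scalarGauss (t l)) * scalarGauss s * f ((∏ l, t l) * s)) := by
              rw [ENNReal.mul_inv_cancel h0 ENNReal.ofReal_ne_top, one_mul]
          _ = _ := by ring
    _ = ∫⁻ x, ∫⁻ t : Fin r → ℝ, (∏ l, scalarGauss (t l)) * scalarGauss (x / ∏ l, t l) *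
      (ENNReal.ofReal |∏ l, t l|)⁻¹ * f x := by
        have h := lintegral_lintegral_swap (μ := (volume : Measure (Fin r → ℝ)))
          (ν := (volume : Measure ℝ)) (f := fun t x => (∏ l, scalarGauss (t l)) *
            scalarGauss (x / ∏ l, t l) * (ENNReal.ofReal |∏ l, t l|)⁻¹ * f x)
        refine h ?_
        have h2 := hm2.comp (measurable_swap (α := Fin r → ℝ) (β := ℝ))
        exact h2.aemeasurable
    _ = _ := by
        refine lintegral_congr fun x => ?_
        rw [lintegral_mul_const _ (hm3 x), realWeight]
        rfl

/-- A push-forward is determined by the integrals of measurable functions. -/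
theorem map_withDensity_eq {E F : Type*} [MeasurableSpace E] [MeasurableSpace F] {μ : Measure E}
    {ν : Measure F} {ρ : E → ℝ≥0∞} {w : F → ℝ≥0∞} (hρ : Measurable ρ) {T : E → F} (hT : Measurable T)
    (h : ∀ f : F → ℝ≥0∞, Measurable f → ∫⁻ t, ρ t * f (T t) ∂μ = ∫⁻ x, w x * f x ∂ν) :
    (μ.withDensity ρ).map T = ν.withDensity w := by
  ext s hs
  rw [Measure.map_apply hT hs, withDensity_apply _ (hT hs), withDensity_apply _ hs,
    ← lintegral_indicator (hT hs), ← lintegral_indicator hs]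
  have := h (s.indicator fun _ => 1) (measurable_const.indicator hs)
  classical
  simp only [Set.indicator_apply, mul_ite, mul_one, mul_zero] at this
  simp only [Set.indicator_apply, Set.mem_preimage]
  exact this

theorem map_scalarGauss (m : ℕ) (hm : 1 ≤ m) :
    (volume.withDensity fun t : Fin m → ℝ => ∏ l, scalarGauss (t l)).map (fun t => ∏ l, t l) =
      volume.withDensity (realWeight m) := by
  obtain ⟨r, rfl⟩ : ∃ r, m = r + 1 := ⟨m - 1, by omega⟩
  exact map_withDensity_eq
    (Finset.measurable_fun_prod _ fun l _ => measurable_scalarGauss.comp (by fun_prop))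
    (by fun_prop) fun f hf => lintegral_scalarGauss_comp_prod hf

theorem matrixGauss_eq (G : Matrix (Fin 2) (Fin 2) ℝ) :
    matrixGauss G = (ENNReal.ofReal (Real.sqrt (2 * Real.pi ^ 3)))⁻¹ * gaussWeight G := by
  have h : 0 < Real.sqrt (2 * Real.pi ^ 3) := Real.sqrt_pos.2 (by have := Real.pi_pos; positivity)
  rw [matrixGauss, gaussWeight, Matrix.frobSq_eq_trace, ENNReal.ofReal_div_of_pos h, mul_comm,
    ENNReal.div_eq_inv_mul, mul_comm]

theorem measurable_matrixGauss : Measurable matrixGauss := by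
  simp_rw [funext matrixGauss_eq]
  exact measurable_gaussWeight.const_mul _

theorem continuous_prodTwo (n : ℕ) : Continuous fun H : Fin n → Fin 2 → Fin 2 → ℝ => prodTwo H :=
  (continuous_ofFn_prod n : Continuous fun X : Fin n → Matrix (Fin 2) (Fin 2) ℝ => (List.ofFn X).prod)

theorem measurable_matrixWeight_integrand (r : ℕ) :
    Measurable fun q : Matrix (Fin 2) (Fin 2) ℝ × (Fin r → Fin 2 → Fin 2 → ℝ) =>
      (∏ l, matrixGauss (Matrix.of (q.2 l))) * matrixGauss ((prodTwo q.2)⁻¹ * q.1) *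
        (ENNReal.ofReal (|(prodTwo q.2).det| ^ 2))⁻¹ := by
  have hp : Continuous fun q : Matrix (Fin 2) (Fin 2) ℝ × (Fin r → Fin 2 → Fin 2 → ℝ) =>
    prodTwo q.2 := (continuous_prodTwo r).comp continuous_snd
  have hinv : Measurable fun q : Matrix (Fin 2) (Fin 2) ℝ × (Fin r → Fin 2 → Fin 2 → ℝ) =>
      (prodTwo q.2)⁻¹ * q.1 := by
    refine measurable_pi_iff.2 fun i => measurable_pi_iff.2 fun j => ?_
    simp_rw [Matrix.inv_def, Ring.inverse_eq_inv', Matrix.smul_mul, Matrix.smul_apply, smul_eq_mul]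
    refine hp.matrix_det.measurable.inv.mul (Continuous.measurable ?_)
    exact (hp.matrix_adjugate.matrix_mul continuous_fst).matrix_elem i j
  refine ((Finset.measurable_fun_prod _ fun l _ => measurable_matrixGauss.comp
    (Continuous.measurable ?_)).mul (measurable_matrixGauss.comp hinv)).mul
      (Measurable.inv (ENNReal.measurable_ofReal.comp (Continuous.measurable ?_)))
  · exact (continuous_apply l).comp continuous_snd
  · exact (hp.matrix_det.abs).pow 2

theorem measurable_matrixWeight (m : ℕ) : Measurable (matrixWeight m) :=
  (measurable_matrixWeight_integrand (m - 1)).lintegral_prod_right'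

theorem ae_det_prodTwo_ne_zero (r : ℕ) :
    ∀ᵐ H : Fin r → Fin 2 → Fin 2 → ℝ, (prodTwo H).det ≠ 0 := by
  have h : ∀ᵐ H : Fin r → Matrix (Fin 2) (Fin 2) ℝ, (List.ofFn H).prod.det ≠ 0 := by
    filter_upwards [ae_det_ne_zero (ι := Fin 2) r] with H hH
    exact det_tailProd_ne_zero hH 0
  exact h

/-- The last factor is multiplied from the left by the product `Q` of the others; the Jacobian is
`|det Q|²` because `Q` acts on two columns. -/
theorem lintegral_matrixGauss_comp_prod {f : Matrix (Fin 2) (Fin 2) ℝ → ℝ≥0∞} (hf : Measurable f) :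
    ∫⁻ H : Fin (r + 1) → Fin 2 → Fin 2 → ℝ, (∏ l, matrixGauss (Matrix.of (H l))) * f (prodTwo H) =
      ∫⁻ G : Matrix (Fin 2) (Fin 2) ℝ, matrixWeight (r + 1) G * f G := by
  have hm : Measurable fun H : Fin (r + 1) → Fin 2 → Fin 2 → ℝ =>
      (∏ l, matrixGauss (Matrix.of (H l))) * f (prodTwo H) :=
    (Finset.measurable_fun_prod _ fun l _ => measurable_matrixGauss.comp
      (measurable_pi_apply l)).mul (hf.comp (continuous_prodTwo _).measurable)
  have hm2 : Measurable fun q : Matrix (Fin 2) (Fin 2) ℝ × (Fin r → Fin 2 → Fin 2 → ℝ) =>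
      (∏ l, matrixGauss (Matrix.of (q.2 l))) * matrixGauss ((prodTwo q.2)⁻¹ * q.1) *
        (ENNReal.ofReal (|(prodTwo q.2).det| ^ 2))⁻¹ * f q.1 :=
    (measurable_matrixWeight_integrand r).mul (hf.comp measurable_fst)
  have hm3 : ∀ x : Matrix (Fin 2) (Fin 2) ℝ, Measurable fun H : Fin r → Fin 2 → Fin 2 → ℝ =>
      (∏ l, matrixGauss (Matrix.of (H l))) * matrixGauss ((prodTwo H)⁻¹ * x) *
        (ENNReal.ofReal (|(prodTwo H).det| ^ 2))⁻¹ := fun x => by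
    have h := (measurable_matrixWeight_integrand r).comp (measurable_prodMk_left (x := x))
    exact h
  calc _ = ∫⁻ H : Fin r → Fin 2 → Fin 2 → ℝ, ∫⁻ G : Matrix (Fin 2) (Fin 2) ℝ,
      (∏ l, matrixGauss (Matrix.of (H l))) * matrixGauss ((prodTwo H)⁻¹ * G) *
        (ENNReal.ofReal (|(prodTwo H).det| ^ 2))⁻¹ * f G := by
        rw [lintegral_snoc hm]
        refine lintegral_congr_ae ?_
        filter_upwards [ae_det_prodTwo_ne_zero r] with H hH
        have hprod : ∀ s : Fin 2 → Fin 2 → ℝ, prodTwo (Fin.snoc H s : Fin (r + 1) → _) =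
            prodTwo H * Matrix.of s := by
          intro s
          rw [prodTwo, List.ofFn_succ', List.concat_eq_append, List.prod_append, prodTwo]
          simp
        simp_rw [Fin.prod_univ_castSucc, Fin.snoc_castSucc, Fin.snoc_last, hprod]
        rw [← lintegral_matrix_mul_left hH fun G => (∏ l, matrixGauss (Matrix.of (H l))) *
          matrixGauss ((prodTwo H)⁻¹ * G) * (ENNReal.ofReal (|(prodTwo H).det| ^ 2))⁻¹ * f G,
          ← lintegral_const_mul' _ _ ENNReal.ofReal_ne_top, Fintype.card_fin]
        have h0 : ENNReal.ofReal (|(prodTwo H).det| ^ 2) ≠ 0 := by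
          have := abs_pos.2 hH
          simpa using hH
        have key : ∀ s : Matrix (Fin 2) (Fin 2) ℝ,
            (∏ l, matrixGauss (Matrix.of (H l))) * matrixGauss s * f (prodTwo H * s) =
            ENNReal.ofReal (|(prodTwo H).det| ^ 2) * ((∏ l, matrixGauss (Matrix.of (H l))) *
              matrixGauss ((prodTwo H)⁻¹ * (prodTwo H * s)) *
              (ENNReal.ofReal (|(prodTwo H).det| ^ 2))⁻¹ * f (prodTwo H * s)) := by
          intro s
          rw [← Matrix.mul_assoc, Matrix.nonsing_inv_mul _ hH.isUnit, Matrix.one_mul]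
          calc _ = (ENNReal.ofReal (|(prodTwo H).det| ^ 2) *
                (ENNReal.ofReal (|(prodTwo H).det| ^ 2))⁻¹) *
              ((∏ l, matrixGauss (Matrix.of (H l))) * matrixGauss s * f (prodTwo H * s)) := by
                rw [ENNReal.mul_inv_cancel h0 ENNReal.ofReal_ne_top, one_mul]
            _ = _ := by ring
        exact lintegral_congr key
    _ = ∫⁻ G : Matrix (Fin 2) (Fin 2) ℝ, ∫⁻ H : Fin r → Fin 2 → Fin 2 → ℝ,
      (∏ l, matrixGauss (Matrix.of (H l))) * matrixGauss ((prodTwo H)⁻¹ * G) *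
        (ENNReal.ofReal (|(prodTwo H).det| ^ 2))⁻¹ * f G :=
        (lintegral_lintegral_swap (f := fun (G : Matrix (Fin 2) (Fin 2) ℝ)
          (H : Fin r → Fin 2 → Fin 2 → ℝ) =>
          (∏ l, matrixGauss (Matrix.of (H l))) * matrixGauss ((prodTwo H)⁻¹ * G) *
        (ENNReal.ofReal (|(prodTwo H).det| ^ 2))⁻¹ * f G) hm2.aemeasurable).symm
    _ = _ := by
        refine lintegral_congr fun x => ?_
        rw [lintegral_mul_const _ (hm3 x), matrixWeight]
        rfl

theorem map_matrixGauss (m : ℕ) (hm : 1 ≤ m) :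
    (volume.withDensity fun H : Fin m → Fin 2 → Fin 2 → ℝ =>
          ∏ l, matrixGauss (Matrix.of (H l))).map (fun H => fun i j => prodTwo H i j) =
      volume.withDensity fun G : Fin 2 → Fin 2 → ℝ => matrixWeight m (Matrix.of G) := by
  obtain ⟨r, rfl⟩ : ∃ r, m = r + 1 := ⟨m - 1, by omega⟩
  refine map_withDensity_eq (Finset.measurable_fun_prod _ fun l _ => measurable_matrixGauss.comp
      (measurable_pi_apply l)) (continuous_prodTwo _).measurable fun f hf => ?_
  exact lintegral_matrixGauss_comp_prod (f := f) hf

end PushForward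

/-! ### The complex weight from the 2 × 2 matrix weight. -/

section SingularValues

attribute [local instance] matrixMeasureSpace matrix_borelSpace matrix_isAddHaarMeasure
  matrix_sigmaFinite matrix_secondCountable isAddHaarMeasure_pi_pi_pi isAddHaarMeasure_seq isAddHaarMeasure_seq_prod

variable {r m : ℕ}

theorem Matrix.frobSq_orthogonal_mul {ν β : Type*} [Fintype ν] [DecidableEq ν] [Fintype β] [DecidableEq β]
    {R : Matrix ν ν ℝ} (hR : Rᵀ * R = 1) (G : Matrix ν β ℝ) : (R * G).frobSq = G.frobSq := by
  rw [Matrix.frobSq_eq_trace', Matrix.frobSq_eq_trace', Matrix.transpose_mul, Matrix.mul_assoc,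
    ← Matrix.mul_assoc Rᵀ, hR, Matrix.one_mul]

theorem Matrix.frobSq_mul_orthogonal {ν β : Type*} [Fintype ν] [DecidableEq ν] [Fintype β] [DecidableEq β]
    {R : Matrix ν ν ℝ} (hR : Rᵀ * R = 1) (G : Matrix β ν ℝ) : (G * R).frobSq = G.frobSq := by
  rw [Matrix.frobSq_eq_trace, Matrix.frobSq_eq_trace, Matrix.transpose_mul, Matrix.mul_assoc,
    ← Matrix.mul_assoc R, mul_eq_one_comm.1 hR, Matrix.one_mul]

theorem matrixGauss_congr {G G' : Matrix (Fin 2) (Fin 2) ℝ} (h : G.frobSq = G'.frobSq) :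
    matrixGauss G = matrixGauss G' := by
  rw [matrixGauss_eq, matrixGauss_eq, gaussWeight, gaussWeight, h]

theorem matrixWeight_mul_orthogonal {R : Matrix (Fin 2) (Fin 2) ℝ} (hR : Rᵀ * R = 1)
    (G : Matrix (Fin 2) (Fin 2) ℝ) : matrixWeight m (G * R) = matrixWeight m G := by
  unfold matrixWeight
  refine lintegral_congr fun H => ?_
  rw [← Matrix.mul_assoc, matrixGauss_congr (Matrix.frobSq_mul_orthogonal hR _)]

/-- The rotation is absorbed into the first integrated factor. With only one factor nothing is
integrated, and the Gaussian weight is itself invariant. -/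
theorem matrixWeight_orthogonal_mul {R : Matrix (Fin 2) (Fin 2) ℝ} (hR : Rᵀ * R = 1)
    (G : Matrix (Fin 2) (Fin 2) ℝ) : matrixWeight (r + 1) (R * G) = matrixWeight (r + 1) G := by
  have hRdet : R.det * R.det = 1 := by
    have := congrArg Matrix.det hR
    rwa [Matrix.det_mul, Matrix.det_transpose, Matrix.det_one] at this
  have hR0 : R.det ≠ 0 := fun h => by rw [h, mul_zero] at hRdet; exact zero_ne_one hRdet
  have habs : |R.det| = 1 := by
    have : |R.det| * |R.det| = 1 := by rw [← abs_mul, hRdet, abs_one]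
    nlinarith [abs_nonneg R.det]
  rw [matrixWeight, matrixWeight]
  change ∫⁻ H : Fin r → Matrix (Fin 2) (Fin 2) ℝ, (∏ l, matrixGauss (H l)) *
      matrixGauss ((List.ofFn H).prod⁻¹ * (R * G)) *
      (ENNReal.ofReal (|(List.ofFn H).prod.det| ^ 2))⁻¹ =
    ∫⁻ H : Fin r → Matrix (Fin 2) (Fin 2) ℝ, (∏ l, matrixGauss (H l)) *
      matrixGauss ((List.ofFn H).prod⁻¹ * G) * (ENNReal.ofReal (|(List.ofFn H).prod.det| ^ 2))⁻¹
  rcases r with _ | r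
  · refine lintegral_congr fun H => ?_
    simp only [List.ofFn_zero, List.prod_nil, inv_one, Matrix.one_mul]
    rw [matrixGauss_congr (Matrix.frobSq_orthogonal_mul hR _)]
  · let A : Fin (r + 1) → Matrix (Fin 2) (Fin 2) ℝ := Fin.cons R fun _ => 1
    have hA : ∀ l, (A l)ᵀ * A l = 1 := fun l => by
      refine Fin.cases ?_ (fun l => ?_) l
      · exact hR
      · simp [A]
    have hAdet : ∀ l, (A l).det ≠ 0 := fun l => by
      refine Fin.cases ?_ (fun l => ?_) l
      · exact hR0
      · simp [A]
    have h := lintegral_seq_twoSidedMul hAdet (B := fun _ => (1 : Matrix (Fin 2) (Fin 2) ℝ))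
      (by simp) fun H => (∏ l, matrixGauss (H l)) *
      matrixGauss ((List.ofFn H).prod⁻¹ * (R * G)) *
      (ENNReal.ofReal (|(List.ofFn H).prod.det| ^ 2))⁻¹
    rw [← h]
    have h1 : ∏ l, (|(A l).det| ^ Fintype.card (Fin 2) *
        |(1 : Matrix (Fin 2) (Fin 2) ℝ).det| ^ Fintype.card (Fin 2)) = 1 := by
      refine Finset.prod_eq_one fun l _ => ?_
      refine Fin.cases ?_ (fun l => ?_) l
      · simp [A, habs]
      · simp [A]
    rw [h1, ENNReal.ofReal_one, one_mul]
    refine lintegral_congr fun H => ?_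
    have hp : (List.ofFn fun l => A l * H l * 1).prod = R * (List.ofFn H).prod := by
      simp [List.ofFn_succ, A, Matrix.mul_assoc]
    rw [hp, Matrix.mul_inv_rev, Matrix.mul_assoc, ← Matrix.mul_assoc R⁻¹,
      Matrix.nonsing_inv_mul _ hR0.isUnit, Matrix.one_mul, Matrix.det_mul, abs_mul, habs, one_mul]
    congr 2
    refine Finset.prod_congr rfl fun l _ => ?_
    simp only [Matrix.mul_one]
    exact matrixGauss_congr (Matrix.frobSq_orthogonal_mul (hA l) _)

theorem complexMatrix_orthogonal {u : ℂ} (hu : u.re * u.re + u.im * u.im = 1) :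
    (complexMatrix u)ᵀ * complexMatrix u = 1 := by
  rw [complexMatrix_apply]
  ext i j
  fin_cases i <;> fin_cases j <;> simp [Matrix.mul_apply, Fin.sum_univ_two] <;> linarith

/-- The matrix is multiplication by `z = p + i q` plus complex conjugation followed by
multiplication by `w = a + i b`. Rotations by the angles `s` and `t` on the two sides multiply `z`
by `exp(i(s + t))` and `w` by `exp(i(s - t))`; the angles are chosen so that both become their
norms. -/
theorem matrixWeight_eq_singular (p q a b : ℝ) :
    matrixWeight (r + 1) !![p + a, b - q; b + q, p - a] =
      matrixWeight (r + 1) !![Real.sqrt (p ^ 2 + q ^ 2) + Real.sqrt (a ^ 2 + b ^ 2), 0;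
        0, Real.sqrt (p ^ 2 + q ^ 2) - Real.sqrt (a ^ 2 + b ^ 2)] := by
  set z : ℂ := ⟨p, q⟩
  set w : ℂ := ⟨a, b⟩
  have hz : Real.sqrt (p ^ 2 + q ^ 2) = ‖z‖ := by
    rw [Complex.norm_def, Complex.normSq_mk, sq, sq]
  have hw : Real.sqrt (a ^ 2 + b ^ 2) = ‖w‖ := by
    rw [Complex.norm_def, Complex.normSq_mk, sq, sq]
  set s := -(z.arg + w.arg) / 2 with hs
  set t := -(z.arg - w.arg) / 2 with ht
  have horth : ∀ x : ℝ, (complexMatrix (Complex.exp (x * Complex.I)))ᵀ *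
      complexMatrix (Complex.exp (x * Complex.I)) = 1 := fun x => by
    apply complexMatrix_orthogonal
    rw [← Complex.normSq_apply, Complex.normSq_eq_norm_sq, Complex.norm_exp_ofReal_mul_I, one_pow]
  have hC : ∀ x : ℂ, !![1, 0; 0, -1] * complexMatrix x =
      complexMatrix (starRingEnd ℂ x) * !![1, 0; 0, -1] := fun x => by
    rw [complexMatrix_apply, complexMatrix_apply]
    ext i j
    fin_cases i <;> fin_cases j <;> simp [Matrix.mul_apply, Fin.sum_univ_two]
  have hM : !![p + a, b - q; b + q, p - a] =
      complexMatrix z + complexMatrix w * !![1, 0; 0, -1] := by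
    rw [complexMatrix_apply, complexMatrix_apply]
    ext i j
    fin_cases i <;> fin_cases j <;> simp [Matrix.mul_apply, Fin.sum_univ_two, z, w] <;> ring
  have hzs : Complex.exp (s * Complex.I) * z * Complex.exp (t * Complex.I) = ‖z‖ := by
    conv_lhs => rw [← Complex.norm_mul_exp_arg_mul_I z]
    rw [mul_left_comm, mul_assoc, ← Complex.exp_add, ← Complex.exp_add, hs, ht]
    push_cast
    rw [show -((z.arg : ℂ) + w.arg) / 2 * Complex.I + (z.arg * Complex.I) +
      -((z.arg : ℂ) - w.arg) / 2 * Complex.I = 0 by ring, Complex.exp_zero, mul_one]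
  have hconj : starRingEnd ℂ (Complex.exp (t * Complex.I)) = Complex.exp (-(t * Complex.I)) := by
    rw [← Complex.exp_conj, map_mul, Complex.conj_ofReal, Complex.conj_I, mul_neg]
  have hws : Complex.exp (s * Complex.I) * w * starRingEnd ℂ (Complex.exp (t * Complex.I)) = ‖w‖ := by
    rw [hconj]
    conv_lhs => rw [← Complex.norm_mul_exp_arg_mul_I w]
    rw [mul_left_comm, mul_assoc, ← Complex.exp_add, ← Complex.exp_add, hs, ht]
    push_cast
    rw [show -((z.arg : ℂ) + w.arg) / 2 * Complex.I + (w.arg * Complex.I) +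
      -(-((z.arg : ℂ) - w.arg) / 2 * Complex.I) = 0 by ring, Complex.exp_zero, mul_one]
  rw [← matrixWeight_orthogonal_mul (horth s), ← matrixWeight_mul_orthogonal (horth t)]
  congr 1
  rw [hM, Matrix.mul_add, Matrix.add_mul, ← map_mul, ← map_mul, hzs, ← Matrix.mul_assoc, ← map_mul,
    Matrix.mul_assoc, hC, ← Matrix.mul_assoc, ← map_mul, hws, hz, hw, complexMatrix_apply,
    complexMatrix_apply]
  ext i j
  fin_cases i <;> fin_cases j <;> simp [Matrix.mul_apply, Fin.sum_univ_two]
  ring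

theorem volume_preserving_matrix_two' :
    MeasurePreserving (fun p : (ℝ × ℝ) × (ℝ × ℝ) => !![p.1.1, p.2.1; p.2.2, p.1.2]) := by
  have s1 : MeasurePreserving (fun p : (ℝ × ℝ) × (ℝ × ℝ) => (p.1.1, (p.1.2, p.2))) :=
    volume_preserving_prodAssoc
  have s2 : MeasurePreserving (fun p : ℝ × (ℝ × (ℝ × ℝ)) => (p.1, (p.2.2.1, (p.2.2.2, p.2.1)))) := by
    have t1 : MeasurePreserving (fun p : ℝ × (ℝ × ℝ) => (p.2, p.1)) := Measure.measurePreserving_swap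
    have t2 : MeasurePreserving (fun p : (ℝ × ℝ) × ℝ => (p.1.1, (p.1.2, p.2))) :=
      volume_preserving_prodAssoc
    exact (MeasurePreserving.id _).prod (t2.comp t1)
  have s3 : MeasurePreserving (fun p : ℝ × (ℝ × (ℝ × ℝ)) => ((p.1, p.2.1), p.2.2)) :=
    volume_preserving_prodAssoc.symm
  exact volume_preserving_matrix_two.comp (s3.comp (s2.comp s1))

theorem lintegral_prod_linear (a b c d : ℝ) (h : a * d - b * c ≠ 0) (f : ℝ × ℝ → ℝ≥0∞) :
    ENNReal.ofReal |a * d - b * c| *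
      ∫⁻ z : ℝ × ℝ, f (a * z.1 + b * z.2, c * z.1 + d * z.2) = ∫⁻ z, f z := by
  let L : ℝ × ℝ →ₗ[ℝ] ℝ × ℝ := Matrix.toLin (Module.Basis.finTwoProd ℝ) (Module.Basis.finTwoProd ℝ)
    !![a, b; c, d]
  have hdet : LinearMap.det L = a * d - b * c := by
    rw [LinearMap.det_toLin, Matrix.det_fin_two_of]
  have := lintegral_comp_linearMap volume L (by rwa [hdet]) f
  rw [hdet] at this
  rw [← this]
  congr 1
  refine lintegral_congr fun x => ?_
  have hx : L x = (a * x.1 + b * x.2, c * x.1 + d * x.2) :=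
    Matrix.toLin_finTwoProd_apply _ _ _ _ _
  rw [hx]

/-- Lebesgue measure on `2 × 2` matrices in the coordinates given by the conformal and the
anti-conformal part. -/
theorem lintegral_conformal {f : Matrix (Fin 2) (Fin 2) ℝ → ℝ≥0∞} (hf : Measurable f) :
    ∫⁻ G, f G = 4 * ∫⁻ p : ℝ, ∫⁻ q : ℝ, ∫⁻ z : ℝ × ℝ,
      f !![p + z.1, z.2 - q; z.2 + q, p - z.1] := by
  have hm : Measurable fun p : (ℝ × ℝ) × (ℝ × ℝ) => f !![p.1.1, p.2.1; p.2.2, p.1.2] :=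
    hf.comp volume_preserving_matrix_two'.measurable
  have hmat : Measurable fun p : (ℝ × ℝ) × (ℝ × ℝ) =>
      (!![p.1.1 + p.2.1, p.2.2 - p.1.2; p.2.2 + p.1.2, p.1.1 - p.2.1] :
        Matrix (Fin 2) (Fin 2) ℝ) := by
    refine Continuous.measurable (continuous_matrix fun i j => ?_)
    fin_cases i <;> fin_cases j <;> simp <;> fun_prop
  have hm' : Measurable fun p : (ℝ × ℝ) × (ℝ × ℝ) =>
      f !![p.1.1 + p.2.1, p.2.2 - p.1.2; p.2.2 + p.1.2, p.1.1 - p.2.1] := hf.comp hmat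
  calc ∫⁻ G, f G = ∫⁻ x : ℝ × ℝ, ∫⁻ y : ℝ × ℝ, f !![x.1, y.1; y.2, x.2] := by
        rw [← volume_preserving_matrix_two'.lintegral_comp hf, Measure.volume_eq_prod,
          lintegral_prod _ hm.aemeasurable]
    -- The diagonal and the off-diagonal entries are replaced by half-sum and half-difference, each
    -- time with Jacobian 2.
    _ = 2 * ∫⁻ x : ℝ × ℝ, ∫⁻ y : ℝ × ℝ, f !![x.1 + x.2, y.1; y.2, x.1 - x.2] := by
        have := lintegral_prod_linear 1 1 1 (-1) (by norm_num)
          fun x => ∫⁻ y : ℝ × ℝ, f !![x.1, y.1; y.2, x.2]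
        rw [← this]
        congr 1
        · norm_num
        · simp [sub_eq_add_neg]
    _ = 2 * ∫⁻ x : ℝ × ℝ, 2 * ∫⁻ y : ℝ × ℝ, f !![x.1 + x.2, y.2 - y.1; y.2 + y.1, x.1 - x.2] := by
        congr 1
        refine lintegral_congr fun x => ?_
        have := lintegral_prod_linear (-1) 1 1 1 (by norm_num)
          fun y => f !![x.1 + x.2, y.1; y.2, x.1 - x.2]
        rw [← this]
        congr 1
        · norm_num
        · refine lintegral_congr fun y => ?_
          simp only [neg_mul, one_mul, neg_add_eq_sub, add_comm y.1 y.2]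
    _ = 4 * ∫⁻ x : ℝ × ℝ, ∫⁻ y : ℝ × ℝ, f !![x.1 + x.2, y.2 - y.1; y.2 + y.1, x.1 - x.2] := by
        rw [lintegral_const_mul' _ _ (by norm_num), ← mul_assoc]
        norm_num
    _ = _ := by
        congr 1
        have hr : Measurable fun p : (ℝ × ℝ) × (ℝ × ℝ) =>
            f !![p.1.1 + p.1.2, p.2.2 - p.2.1; p.2.2 + p.2.1, p.1.1 - p.1.2] := by
          have : Measurable fun p : (ℝ × ℝ) × (ℝ × ℝ) =>
            (((p.1.1, p.2.1), (p.1.2, p.2.2)) : (ℝ × ℝ) × (ℝ × ℝ)) := by fun_prop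
          have h := hm'.comp this
          exact h
        rw [Measure.volume_eq_prod, lintegral_prod _ (hr.lintegral_prod_right').aemeasurable]
        refine lintegral_congr fun p => ?_
        have h1 : ∀ a : ℝ, ∫⁻ y : ℝ × ℝ, f !![p + a, y.2 - y.1; y.2 + y.1, p - a]
            ∂((volume : Measure ℝ).prod volume) =
            ∫⁻ q : ℝ, ∫⁻ b : ℝ, f !![p + a, b - q; b + q, p - a] := fun a => by
          rw [lintegral_prod]
          have h := hr.comp (measurable_prodMk_left (x := (p, a)))
          exact h.aemeasurable
        simp_rw [h1]
        have h2 : Measurable fun z : (ℝ × ℝ) × ℝ =>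
            f !![p + z.1.1, z.2 - z.1.2; z.2 + z.1.2, p - z.1.1] := by
          have : Measurable fun z : (ℝ × ℝ) × ℝ =>
            (((p, z.1.2), (z.1.1, z.2)) : (ℝ × ℝ) × (ℝ × ℝ)) := by fun_prop
          have h := hm'.comp this
          exact h
        rw [lintegral_lintegral_swap (h2.lintegral_prod_right').aemeasurable]
        refine lintegral_congr fun q => ?_
        rw [lintegral_prod]
        have h := hm'.comp (measurable_prodMk_left (x := (p, q)))
        exact h.aemeasurable

theorem lintegral_sqrt_substitution (t : ℝ) (g : ℝ → ℝ≥0∞) :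
    ∫⁻ q in Set.Ioi |t|, g q = ∫⁻ y in Set.Ioi (0 : ℝ),
      ENNReal.ofReal (y / Real.sqrt (y ^ 2 + t ^ 2)) * g (Real.sqrt (y ^ 2 + t ^ 2)) := by
  have himg : (fun y => Real.sqrt (y ^ 2 + t ^ 2)) '' Set.Ioi (0 : ℝ) = Set.Ioi |t| := by
    ext q
    constructor
    · rintro ⟨y, hy, rfl⟩
      have hy0 : (0 : ℝ) < y := hy
      rw [Set.mem_Ioi, ← Real.sqrt_sq_eq_abs]
      exact Real.sqrt_lt_sqrt (sq_nonneg t) (by nlinarith)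
    · intro hq
      have hq0 : |t| < q := hq
      have hlt : t ^ 2 < q ^ 2 := by
        rw [← sq_abs t]
        exact pow_lt_pow_left₀ hq0 (abs_nonneg t) two_ne_zero
      refine ⟨Real.sqrt (q ^ 2 - t ^ 2), Real.sqrt_pos.2 (by linarith), ?_⟩
      simp only
      rw [Real.sq_sqrt (by linarith), sub_add_cancel, Real.sqrt_sq ((abs_nonneg t).trans hq0.le)]
  have hpos : ∀ y ∈ Set.Ioi (0 : ℝ), 0 < y ^ 2 + t ^ 2 := fun y hy => by
    have : (0 : ℝ) < y := hy
    positivity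
  have hder : ∀ y ∈ Set.Ioi (0 : ℝ), HasDerivWithinAt (fun y => Real.sqrt (y ^ 2 + t ^ 2))
      (y / Real.sqrt (y ^ 2 + t ^ 2)) (Set.Ioi 0) y := by
    intro y hy
    have h1 : HasDerivAt (fun y : ℝ => y ^ 2 + t ^ 2) (2 * y) y := by
      simpa using ((hasDerivAt_id y).pow 2).add_const (t ^ 2)
    have h2 := h1.sqrt (hpos y hy).ne'
    refine (h2.congr_deriv ?_).hasDerivWithinAt
    rw [mul_div_mul_left _ _ two_ne_zero]
  have hinj : Set.InjOn (fun y => Real.sqrt (y ^ 2 + t ^ 2)) (Set.Ioi (0 : ℝ)) := by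
    intro y hy z hz h
    have hy0 : (0 : ℝ) < y := hy
    have hz0 : (0 : ℝ) < z := hz
    have := (Real.sqrt_inj (hpos y hy).le (hpos z hz).le).1 h
    nlinarith
  rw [← himg, lintegral_image_eq_lintegral_abs_deriv_mul measurableSet_Ioi hder hinj]
  refine setLIntegral_congr_fun measurableSet_Ioi fun y hy => ?_
  have hy0 : (0 : ℝ) < y := hy
  rw [abs_of_nonneg (by positivity)]

/-- The measure of `2 × 2` matrices with non-real eigenvalues in the coordinates given by the real
and the imaginary part of the eigenvalue. -/
theorem lintegral_nonrealTwo {F : ℝ → ℝ → ℝ≥0∞} (hF : Measurable (Function.uncurry F)) :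
    ∫⁻ G : Matrix (Fin 2) (Fin 2) ℝ, nonrealTwo.indicator (fun G => matrixWeight (r + 1) G *
      F (G.trace / 2) (Real.sqrt (4 * G.det - G.trace ^ 2) / 2)) G =
    ∫⁻ x : ℝ, ∫⁻ y in Set.Ioi (0 : ℝ),
      F x y * (ENNReal.ofReal (2 * y) * complexWeight (r + 1) x y) := by
  have hW := measurable_matrixWeight (r + 1)
  have hFm : Measurable fun G : Matrix (Fin 2) (Fin 2) ℝ =>
      F (G.trace / 2) (Real.sqrt (4 * G.det - G.trace ^ 2) / 2) := by
    have h1 : Measurable fun G : Matrix (Fin 2) (Fin 2) ℝ =>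
        (G.trace / 2, Real.sqrt (4 * G.det - G.trace ^ 2) / 2) :=
      Continuous.measurable (by fun_prop)
    have h := hF.comp h1
    exact h
  have hm : Measurable (nonrealTwo.indicator fun G : Matrix (Fin 2) (Fin 2) ℝ =>
      matrixWeight (r + 1) G * F (G.trace / 2) (Real.sqrt (4 * G.det - G.trace ^ 2) / 2)) :=
    (hW.mul hFm).indicator measurableSet_nonrealTwo
  let D : ℝ → ℝ → Matrix (Fin 2) (Fin 2) ℝ := fun s t => !![s + t, 0; 0, s - t]
  have hD : Measurable (Function.uncurry D) := by
    refine Continuous.measurable (continuous_matrix fun i j => ?_)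
    fin_cases i <;> fin_cases j <;> simp [D, Function.uncurry] <;> fun_prop
  -- With `t` the length of the anticonformal part, the trace is `2p` and `4 det - trace²` is `4(q²
  -- - t²)`, so the eigenvalues are `p ± i√(q² - t²)` and the singular values `√(p² + q²) ± t`. The
  -- integrand depends on the anticonformal part only through `t`.
  let Ψ : ℝ → ℝ → ℝ → ℝ≥0∞ := fun p q t => {x : ℝ × ℝ | x.2 ^ 2 < x.1 ^ 2}.indicator (fun x =>
    matrixWeight (r + 1) (D (Real.sqrt (p ^ 2 + x.1 ^ 2)) x.2) * F p (Real.sqrt (x.1 ^ 2 - x.2 ^ 2)))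
    (q, t)
  have hset : MeasurableSet {x : ℝ × ℝ | x.2 ^ 2 < x.1 ^ 2} :=
    (isOpen_lt (by fun_prop) (by fun_prop)).measurableSet
  have hΨ : ∀ p, Measurable (Function.uncurry (Ψ p)) := by
    intro p
    refine Measurable.indicator (Measurable.mul ?_ ?_) hset
    · have h1 : Measurable fun x : ℝ × ℝ => (Real.sqrt (p ^ 2 + x.1 ^ 2), x.2) := by fun_prop
      have h := hW.comp (hD.comp h1)
      exact h
    · have h1 : Measurable fun x : ℝ × ℝ => (p, Real.sqrt (x.1 ^ 2 - x.2 ^ 2)) := by fun_prop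
      have h := hF.comp h1
      exact h
  have hpt : ∀ p q : ℝ, ∀ z : ℝ × ℝ, nonrealTwo.indicator (fun G => matrixWeight (r + 1) G *
      F (G.trace / 2) (Real.sqrt (4 * G.det - G.trace ^ 2) / 2))
      !![p + z.1, z.2 - q; z.2 + q, p - z.1] = Ψ p q (Real.sqrt (z.1 ^ 2 + z.2 ^ 2)) := by
    intro p q z
    have hz : 0 ≤ z.1 ^ 2 + z.2 ^ 2 := by positivity
    have htr : (!![p + z.1, z.2 - q; z.2 + q, p - z.1] : Matrix (Fin 2) (Fin 2) ℝ).trace = 2 * p := by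
      rw [Matrix.trace_fin_two_of]; ring
    have hdet : 4 * (!![p + z.1, z.2 - q; z.2 + q, p - z.1] : Matrix (Fin 2) (Fin 2) ℝ).det -
        (2 * p) ^ 2 = 2 ^ 2 * (q ^ 2 - Real.sqrt (z.1 ^ 2 + z.2 ^ 2) ^ 2) := by
      rw [Matrix.det_fin_two_of, Real.sq_sqrt hz]; ring
    classical
    simp only [Ψ, Set.indicator_apply]
    refine if_congr ?_ ?_ rfl
    · rw [nonrealTwo, Set.mem_ofPred_eq, Set.mem_ofPred_eq, htr]
      constructor <;> intro h <;> nlinarith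
    · rw [htr, hdet, Real.sqrt_mul (by norm_num), Real.sqrt_sq (by norm_num),
        mul_div_cancel_left₀ _ two_ne_zero, mul_div_cancel_left₀ _ two_ne_zero,
        matrixWeight_eq_singular]
  rw [lintegral_conformal hm]
  simp_rw [hpt]
  rw [← lintegral_const_mul' _ _ (by norm_num)]
  refine lintegral_congr fun p => ?_
  let V : ℝ → ℝ → ℝ≥0∞ := fun y d => matrixWeight (r + 1) !![muPlus p y d, 0; 0, muMinus p y d]
  have hV : Measurable (Function.uncurry V) := by
    have h1 : Measurable fun x : ℝ × ℝ => (!![muPlus p x.1 x.2, 0; 0, muMinus p x.1 x.2] :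
        Matrix (Fin 2) (Fin 2) ℝ) := by
      refine Continuous.measurable (continuous_matrix fun i j => ?_)
      fin_cases i <;> fin_cases j <;> simp [muPlus, muMinus] <;> fun_prop
    have h := hW.comp h1
    exact h
  -- The integrand is even in `q`; on the positive side `q = √(y² + t²)` introduces the imaginary
  -- part `y` of the eigenvalue.
  have hinner : ∀ t : ℝ, ∫⁻ q, Ψ p q |t| = 2 * ∫⁻ y in Set.Ioi (0 : ℝ),
      F p y * (ENNReal.ofReal (y / Real.sqrt (y ^ 2 + t ^ 2)) * V y (2 * t)) := by
    intro t
    let g : ℝ → ℝ≥0∞ := fun q => matrixWeight (r + 1) (D (Real.sqrt (p ^ 2 + q ^ 2)) |t|) *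
      F p (Real.sqrt (q ^ 2 - |t| ^ 2))
    have h1 : ∀ q, Ψ p q |t| = (Set.Ioi |t|).indicator g |q| := fun q => by
      classical
      simp only [Ψ, Set.indicator_apply, g]
      refine if_congr ?_ ?_ rfl
      · rw [Set.mem_ofPred_eq, Set.mem_Ioi, sq_lt_sq, abs_abs]
      · rw [sq_abs q]
    simp_rw [h1]
    rw [lintegral_comp_abs, setLIntegral_indicator measurableSet_Ioi,
      Set.inter_eq_left.2 (Set.Ioi_subset_Ioi (abs_nonneg t)), lintegral_sqrt_substitution]
    congr 1
    refine setLIntegral_congr_fun measurableSet_Ioi fun y hy => ?_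
    have hy0 : (0 : ℝ) < y := hy
    simp only [g]
    rw [Real.sq_sqrt (by positivity), sq_abs, add_sub_cancel_right, Real.sqrt_sq hy0.le,
      mul_left_comm, mul_comm (F p y)]
    rw [mul_left_comm, mul_assoc]
    congr 2
    have h4 : Real.sqrt ((2 * t) ^ 2 + 4 * (p ^ 2 + y ^ 2)) =
        2 * Real.sqrt (p ^ 2 + (y ^ 2 + t ^ 2)) := by
      rw [show (2 * t) ^ 2 + 4 * (p ^ 2 + y ^ 2) = 2 ^ 2 * (p ^ 2 + (y ^ 2 + t ^ 2)) by ring,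
        Real.sqrt_mul (by norm_num), Real.sqrt_sq (by norm_num)]
    have h5 : |2 * t| = 2 * |t| := by rw [abs_mul, abs_two]
    simp only [V, D, muPlus, muMinus]
    rw [h4, h5]
    congr 3 <;> ring_nf
  have hΨa : Measurable fun x : ℝ × ℝ => ENNReal.ofReal |x.2| * Ψ p x.1 |x.2| := by
    have h1 : Measurable fun x : ℝ × ℝ => (x.1, |x.2|) := by fun_prop
    have h := (hΨ p).comp h1
    refine Measurable.mul (by fun_prop) ?_
    exact h
  have hΨ' : ∀ q, Measurable (Ψ p q) := fun q => by
    have h := (hΨ p).comp (measurable_prodMk_left (x := q))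
    exact h
  have hΨ'' : ∀ t, Measurable fun q => Ψ p q t := fun t => by
    have h := (hΨ p).comp (measurable_prodMk_right (y := t))
    exact h
  have hFp : Measurable (F p) := by
    have h := hF.comp (measurable_prodMk_left (x := p))
    exact h
  calc 4 * ∫⁻ q : ℝ, ∫⁻ z : ℝ × ℝ, Ψ p q (Real.sqrt (z.1 ^ 2 + z.2 ^ 2))
      = 4 * ∫⁻ q : ℝ, ENNReal.ofReal Real.pi * ∫⁻ t : ℝ, ENNReal.ofReal |t| * Ψ p q |t| := by
        congr 1
        refine lintegral_congr fun q => ?_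
        rw [lintegral_radial (hΨ' q)]
    _ = 4 * (ENNReal.ofReal Real.pi * ∫⁻ t : ℝ, ENNReal.ofReal |t| * ∫⁻ q, Ψ p q |t|) := by
        rw [lintegral_const_mul' _ _ (by simp),
          lintegral_lintegral_swap hΨa.aemeasurable]
        congr 2
        refine lintegral_congr fun t => ?_
        rw [lintegral_const_mul _ (hΨ'' _)]
    _ = 4 * (ENNReal.ofReal Real.pi * (2 * ∫⁻ t : ℝ, ∫⁻ y in Set.Ioi (0 : ℝ),
          F p y * (ENNReal.ofReal |t| * ENNReal.ofReal (y / Real.sqrt (y ^ 2 + t ^ 2)) *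
            V y (2 * t)))) := by
        rw [← lintegral_const_mul' 2 _ (by norm_num)]
        congr 2
        refine lintegral_congr fun t => ?_
        rw [hinner, mul_left_comm, ← lintegral_const_mul' _ _ (by simp)]
        congr 1
        refine lintegral_congr fun y => ?_
        ring
    _ = 4 * (ENNReal.ofReal Real.pi * (2 * ∫⁻ y in Set.Ioi (0 : ℝ), F p y * ∫⁻ t : ℝ,
          (ENNReal.ofReal |t| * ENNReal.ofReal (y / Real.sqrt (y ^ 2 + t ^ 2)) *
            V y (2 * t)))) := by
        have h2 : Measurable fun x : ℝ × ℝ => ENNReal.ofReal |x.1| *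
            ENNReal.ofReal (x.2 / Real.sqrt (x.2 ^ 2 + x.1 ^ 2)) * V x.2 (2 * x.1) := by
          refine Measurable.mul (by fun_prop) ?_
          have h1 : Measurable fun x : ℝ × ℝ => (x.2, 2 * x.1) := by fun_prop
          have h := hV.comp h1
          exact h
        have h3 : Measurable fun x : ℝ × ℝ => F p x.2 * (ENNReal.ofReal |x.1| *
            ENNReal.ofReal (x.2 / Real.sqrt (x.2 ^ 2 + x.1 ^ 2)) * V x.2 (2 * x.1)) :=
          (hFp.comp measurable_snd).mul h2
        rw [lintegral_lintegral_swap h3.aemeasurable]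
        congr 3
        refine lintegral_congr fun y => ?_
        rw [lintegral_const_mul]
        have h := h2.comp (measurable_prodMk_right (y := y))
        exact h
    _ = _ := by
        rw [← lintegral_const_mul' 2 _ (by norm_num), ← lintegral_const_mul' _ _ (by simp),
          ← lintegral_const_mul' _ _ (by norm_num)]
        refine setLIntegral_congr_fun measurableSet_Ioi fun y hy => ?_
        have hy0 : (0 : ℝ) < y := hy
        have h6 : ∫⁻ t : ℝ, (ENNReal.ofReal |t| * ENNReal.ofReal (y / Real.sqrt (y ^ 2 + t ^ 2)) *
            V y (2 * t)) = ENNReal.ofReal y * ∫⁻ t : ℝ, ENNReal.ofReal (|2 * t| /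
              Real.sqrt ((2 * t) ^ 2 + 4 * y ^ 2)) * V y (2 * t) := by
          rw [← lintegral_const_mul' _ _ (by simp)]
          refine lintegral_congr fun t => ?_
          rw [← mul_assoc, ← ENNReal.ofReal_mul (abs_nonneg t), ← ENNReal.ofReal_mul hy0.le]
          congr 2
          rw [show (2 * t) ^ 2 + 4 * y ^ 2 = 2 ^ 2 * (y ^ 2 + t ^ 2) by ring,
            Real.sqrt_mul (by norm_num), Real.sqrt_sq (by norm_num), abs_mul, abs_two,
            mul_div_mul_left _ _ two_ne_zero]
          ring
        -- The variable `δ` is the difference `2t` of the singular values; the collected constants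
        -- are then exactly `2y · 2π`.
        have h7 := lintegral_comp_mul_left (p := (2 : ℝ)) two_ne_zero fun d =>
          ENNReal.ofReal (|d| / Real.sqrt (d ^ 2 + 4 * y ^ 2)) * V y d
        rw [h6, complexWeight]
        change _ = F p y * (ENNReal.ofReal (2 * y) * (ENNReal.ofReal (2 * Real.pi) *
          ∫⁻ d : ℝ, ENNReal.ofReal (|d| / Real.sqrt (d ^ 2 + 4 * y ^ 2)) * V y d))
        rw [← h7, abs_two, ENNReal.ofReal_mul zero_le_two, ENNReal.ofReal_mul zero_le_two,
          ENNReal.ofReal_ofNat]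
        ring

end SingularValues

/-! ### The Vandermonde product as a function of the polynomial. -/

section RootDiscriminant

open Polynomial

/-- The product of the absolute values of the derivative at the roots. -/
noncomputable def rootDisc (q : ℂ[X]) : ℝ := (q.roots.map fun z => ‖q.derivative.eval z‖).prod

/-- The derivative of `(X - z) q` is `q(z)` at `z` and `(μ - z) q'(μ)` at a root `μ` of `q`. The
factors `|μ - z|` multiply to a second `|q(z)|`. -/
theorem rootDisc_mul {q : ℂ[X]} (hq : q.Monic) (z : ℂ) :
    rootDisc ((X - C z) * q) = ‖q.eval z‖ ^ 2 * rootDisc q := by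
  have hne : (X - C z) * q ≠ 0 := mul_ne_zero (X_sub_C_ne_zero z) hq.ne_zero
  have hprod : ‖q.eval z‖ = (q.roots.map fun μ => ‖μ - z‖).prod := by
    have hsplit := prod_multiset_X_sub_C_of_monic_of_roots_card_eq hq
      (IsAlgClosed.card_roots_eq_natDegree)
    conv_lhs => rw [← hsplit]
    rw [eval_multiset_prod, Multiset.map_map]
    change (normHom : ℂ →*₀ ℝ) _ = _
    rw [map_multiset_prod, Multiset.map_map]
    congr 1
    refine Multiset.map_congr rfl fun μ _ => ?_
    simp [norm_sub_rev]
  rw [rootDisc, roots_mul hne, roots_X_sub_C, Multiset.map_add, Multiset.prod_add,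
    Multiset.map_singleton, Multiset.prod_singleton]
  have h1 : ((X - C z) * q).derivative.eval z = q.eval z := by
    rw [derivative_mul]; simp
  have h2 : (q.roots.map fun μ => ‖((X - C z) * q).derivative.eval μ‖) =
      q.roots.map fun μ => ‖μ - z‖ * ‖q.derivative.eval μ‖ := by
    refine Multiset.map_congr rfl fun μ hμ => ?_
    have : q.eval μ = 0 := (mem_roots hq.ne_zero).1 hμ
    rw [derivative_mul]
    simp [this]
  rw [h1, h2, Multiset.prod_map_mul, ← hprod, rootDisc]
  ring

theorem vandermondeProd_succ {n : ℕ} (z : Fin (n + 1) → ℂ) :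
    vandermondeProd z = (∏ l : Fin n, (z l.succ - z 0)) * vandermondeProd fun l => z l.succ := by
  rw [vandermondeProd, Fin.prod_univ_succ, Fin.prod_Ioi_zero]
  simp_rw [Fin.prod_Ioi_succ]
  rfl

theorem norm_vandermondeProd_sq {n : ℕ} (z : Fin n → ℂ) :
    ‖vandermondeProd z‖ ^ 2 = rootDisc (∏ i, (X - C (z i))) := by
  induction n with
  | zero => simp [vandermondeProd, rootDisc]
  | succ n ih =>
    rw [Fin.prod_univ_succ, rootDisc_mul (monic_prod_of_monic _ _ fun i _ => monic_X_sub_C _),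
      ← ih, vandermondeProd_succ, norm_mul, mul_pow, eval_prod, norm_prod, norm_prod]
    simp [norm_sub_rev]

/-- The absolute value of the Vandermonde product of the complex roots. -/
noncomputable def Polynomial.vandermondeNorm (q : ℝ[X]) : ℝ :=
  Real.sqrt (rootDisc (q.map (algebraMap ℝ ℂ)))

theorem Polynomial.vandermondeNorm_nonneg (q : ℝ[X]) : 0 ≤ q.vandermondeNorm := Real.sqrt_nonneg _

theorem Polynomial.vandermondeNorm_linear_mul {q : ℝ[X]} (hq : q.Monic) (x : ℝ) :
    ((X - C x) * q).vandermondeNorm = |q.eval x| * q.vandermondeNorm := by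
  rw [vandermondeNorm, Polynomial.map_mul, Polynomial.map_sub, map_X, map_C,
    rootDisc_mul (hq.map _), Real.sqrt_mul (sq_nonneg _), Real.sqrt_sq (norm_nonneg _)]
  congr 1
  rw [eval_map_algebraMap, Complex.coe_algebraMap]
  have : aeval (x : ℂ) q = ((q.eval x : ℝ) : ℂ) := aeval_ofReal q x
  rw [this, Complex.norm_real, Real.norm_eq_abs]

theorem map_quadratic (x y : ℝ) :
    ((X - C x) ^ 2 + C (y ^ 2) : ℝ[X]).map (algebraMap ℝ ℂ) =
      (X - C ((x : ℂ) + y * Complex.I)) * (X - C ((x : ℂ) - y * Complex.I)) := by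
  have h : (C (y * Complex.I) : ℂ[X]) * C (y * Complex.I) = - C (y : ℂ) * C (y : ℂ) := by
    rw [← C_mul, neg_mul, ← C_mul, ← C_neg]
    congr 1
    rw [mul_mul_mul_comm, Complex.I_mul_I]
    ring
  simp only [Polynomial.map_add, Polynomial.map_pow, Polynomial.map_sub, map_X, map_C,
    Complex.coe_algebraMap, Complex.ofReal_pow, C_add, C_sub, C_pow]
  linear_combination h

/-- Two linear factors are added in succession: `2|y|` is the distance of the conjugate roots, and
`q` has the same absolute value at both since it is real. -/
theorem Polynomial.vandermondeNorm_quadratic_mul {q : ℝ[X]} (hq : q.Monic) (x y : ℝ) :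
    (((X - C x) ^ 2 + C (y ^ 2)) * q).vandermondeNorm =
      2 * |y| * Complex.normSq (aeval ((x : ℂ) + y * Complex.I) q) * q.vandermondeNorm := by
  have hq' := hq.map (algebraMap ℝ ℂ)
  have hconj : ((x : ℂ) - y * Complex.I) = starRingEnd ℂ ((x : ℂ) + y * Complex.I) := by
    simp [sub_eq_add_neg]
  have hn : ‖aeval ((x : ℂ) - y * Complex.I) q‖ = ‖aeval ((x : ℂ) + y * Complex.I) q‖ := by
    rw [hconj, aeval_conj, RCLike.norm_conj]
  rw [vandermondeNorm, Polynomial.map_mul, map_quadratic, mul_assoc,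
    rootDisc_mul ((monic_X_sub_C _).mul hq'), rootDisc_mul hq', ← mul_assoc,
    Real.sqrt_mul (by positivity), ← vandermondeNorm]
  congr 1
  rw [← mul_pow, Real.sqrt_sq (by positivity), eval_mul, norm_mul, eval_map_algebraMap,
    eval_map_algebraMap, hn, Complex.normSq_eq_norm_sq]
  have : ‖(X - C ((x : ℂ) - y * Complex.I)).eval ((x : ℂ) + y * Complex.I)‖ = 2 * |y| := by
    have h2 : (x : ℂ) + y * Complex.I - (x - y * Complex.I) = 2 * y * Complex.I := by ring
    simp only [eval_sub, eval_X, eval_C]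
    rw [h2, norm_mul, norm_mul]
    simp
  rw [this]
  ring

end RootDiscriminant

/-! ### Unlabelled eigenvalue configurations as characteristic polynomials. -/

section EigenvaluePolynomial

open Polynomial

variable {k K N : ℕ}

/-- The real monic polynomial with the eigenvalues with coordinates `p`. -/
noncomputable def EigCoord.poly (p : EigCoord k K) : ℝ[X] :=
  (∏ j, (X - C (p.1 j))) * ∏ j, ((X - C (p.2 j).1) ^ 2 + C ((p.2 j).2 ^ 2))

theorem monic_quadratic (x y : ℝ) : ((X - C x) ^ 2 + C (y ^ 2) : ℝ[X]).Monic := by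
  monicity!

theorem EigCoord.monic_poly (p : EigCoord k K) : p.poly.Monic :=
  (monic_prod_of_monic _ _ fun _ _ => monic_X_sub_C _).mul
    (monic_prod_of_monic _ _ fun _ _ => monic_quadratic _ _)

theorem EigCoord.natDegree_poly (p : EigCoord k K) : p.poly.natDegree = k + 2 * K := by
  have h2 : ∀ x y : ℝ, ((X - C x) ^ 2 + C (y ^ 2) : ℝ[X]).natDegree = 2 := fun x y => by
    compute_degree!
  rw [EigCoord.poly, Monic.natDegree_mul (monic_prod_of_monic _ _ fun _ _ => monic_X_sub_C _)
    (monic_prod_of_monic _ _ fun _ _ => monic_quadratic _ _),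
    natDegree_prod_of_monic _ _ fun _ _ => monic_X_sub_C _,
    natDegree_prod_of_monic _ _ fun _ _ => monic_quadratic _ _]
  simp only [h2, natDegree_X_sub_C, Finset.sum_const, Finset.card_univ, Fintype.card_fin,
    smul_eq_mul, mul_one, mul_comm]

theorem EigCoord.map_poly (p : EigCoord k K) :
    p.poly.map (algebraMap ℝ ℂ) = ∏ l, (X - C (eigList p l)) := by
  rw [EigCoord.poly, Polynomial.map_mul, Polynomial.map_prod, Polynomial.map_prod,
    Fin.prod_univ_add, Fin.prod_univ_add]
  simp only [map_quadratic, Finset.prod_mul_distrib, eigList, Fin.append_left, Fin.append_right]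
  rw [mul_assoc]
  simp

theorem norm_vandermondeProd_eigList (p : EigCoord k K) :
    ‖vandermondeProd (eigList p)‖ = p.poly.vandermondeNorm := by
  rw [Polynomial.vandermondeNorm, EigCoord.map_poly, ← norm_vandermondeProd_sq,
    Real.sqrt_sq (norm_nonneg _)]

theorem isEigCoord_iff {A : Matrix (Fin N) (Fin N) ℝ} {p : EigCoord k K} :
    IsEigCoord A p ↔ p ∈ upperCoord k K ∧ A.charpoly = p.poly := by
  rw [IsEigCoord]
  refine and_congr_right fun _ => ?_
  rw [Matrix.charpoly_map]
  constructor
  · intro h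
    apply Polynomial.map_injective (algebraMap ℝ ℂ) (algebraMap ℝ ℂ).injective
    rw [EigCoord.map_poly, ← prod_multiset_X_sub_C_of_monic_of_roots_card_eq
      ((Matrix.charpoly_monic A).map (algebraMap ℝ ℂ)) IsAlgClosed.card_roots_eq_natDegree, h,
      Multiset.map_map]
    rfl
  · intro h
    rw [h, EigCoord.map_poly, ← roots_multiset_prod_X_sub_C (Finset.univ.val.map (eigList p)),
      Multiset.map_map]
    rfl

/-- The values of the eigenvalue polynomial at the natural numbers. -/
noncomputable def EigCoord.eval (p : EigCoord k K) : ℕ → ℝ := fun j => p.poly.eval (j : ℝ)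

theorem Polynomial.eq_of_natCast_eval_eq {q q' : ℝ[X]} (h : ∀ j : ℕ, q.eval (j : ℝ) = q'.eval (j : ℝ)) :
    q = q' :=
  eq_of_infinite_eval_eq _ _ ((Set.infinite_range_of_injective Nat.cast_injective).mono
    (by rintro _ ⟨j, rfl⟩; exact h j))

theorem EigCoord.eval_eq_iff {k' K' : ℕ} {p : EigCoord k K} {p' : EigCoord k' K'} :
    p.eval = p'.eval ↔ p.poly = p'.poly :=
  ⟨fun h => Polynomial.eq_of_natCast_eval_eq fun j => congrFun h j, fun h =>
    funext fun j => congrArg (Polynomial.eval (j : ℝ)) h⟩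

theorem charEval_eq_iff {α : Type*} [Fintype α] [DecidableEq α] {A : Matrix α α ℝ}
    {p : EigCoord k K} : A.charEval = p.eval ↔ A.charpoly = p.poly :=
  ⟨fun h => Polynomial.eq_of_natCast_eval_eq fun j => congrFun h j, fun h =>
    funext fun j => congrArg (Polynomial.eval (j : ℝ)) h⟩

theorem EigCoord.continuous_eval : Continuous (EigCoord.eval : EigCoord k K → ℕ → ℝ) := by
  refine continuous_pi fun j => ?_
  simp only [EigCoord.eval, EigCoord.poly, eval_mul, eval_prod, eval_add, eval_pow, eval_sub, eval_X,
    eval_C]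
  fun_prop

theorem isOpen_upperCoord : IsOpen (upperCoord k K) := by
  have : upperCoord k K = ⋂ j, {p | 0 < (p.2 j).2} := by
    ext p; simp [upperCoord]
  rw [this]
  exact isOpen_iInter_of_finite fun j => isOpen_lt continuous_const (by fun_prop)

/-- The values of the characteristic polynomials with `k` real roots and `K` pairs of non-real
roots. -/
def eigRange (k K : ℕ) : Set (ℕ → ℝ) := EigCoord.eval '' upperCoord k K

/-- An open set of coordinates is σ-compact, and so is its continuous image. -/
theorem measurableSet_eigRange : MeasurableSet (eigRange k K) := by
  have : LocallyCompactSpace (upperCoord k K) := isOpen_upperCoord.locallyCompactSpace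
  have hs : IsSigmaCompact (upperCoord k K) := isSigmaCompact_iff_sigmaCompactSpace.2 inferInstance
  obtain ⟨S, hS, hSU⟩ := hs.image EigCoord.continuous_eval
  rw [eigRange, ← hSU]
  exact MeasurableSet.iUnion fun n => (hS n).isClosed.measurableSet

theorem exists_perm_of_map_univ_eq {ι β : Type*} [Fintype ι] {f g : ι → β}
    (h : Finset.univ.val.map f = Finset.univ.val.map g) : ∃ σ : Equiv.Perm ι, ∀ i, g i = f (σ i) := by
  classical
  have hc : ∀ b, Nonempty ({i // g i = b} ≃ {i // f i = b}) := fun b => by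
    rw [← Fintype.card_eq]
    have := congrArg (Multiset.count b) h
    rw [Multiset.count_map, Multiset.count_map] at this
    rw [Fintype.card_subtype, Fintype.card_subtype, Finset.card_def, Finset.card_def,
      Finset.filter_val, Finset.filter_val]
    simp_rw [eq_comm (b := b)]
    exact this.symm
  let e := fun b => (hc b).some
  exact ⟨Equiv.ofFiberEquiv e, fun i => (Equiv.ofFiberEquiv_map e i).symm⟩

theorem EigCoord.roots_map_poly (p : EigCoord k K) : (p.poly.map (algebraMap ℝ ℂ)).roots =
    Finset.univ.val.map (fun j => ((p.1 j : ℝ) : ℂ)) +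
      Finset.univ.val.map (fun j => ((p.2 j).1 : ℂ) + (p.2 j).2 * Complex.I) +
      Finset.univ.val.map (fun j => ((p.2 j).1 : ℂ) - (p.2 j).2 * Complex.I) := by
  rw [← roots_multiset_prod_X_sub_C (Finset.univ.val.map (fun j => ((p.1 j : ℝ) : ℂ)) +
      Finset.univ.val.map (fun j => ((p.2 j).1 : ℂ) + (p.2 j).2 * Complex.I) +
      Finset.univ.val.map (fun j => ((p.2 j).1 : ℂ) - (p.2 j).2 * Complex.I)),
    Multiset.map_add, Multiset.map_add, Multiset.prod_add, Multiset.prod_add, Multiset.map_map,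
    Multiset.map_map, Multiset.map_map, EigCoord.map_poly, Fin.prod_univ_add, Fin.prod_univ_add]
  simp only [eigList, Fin.append_left, Fin.append_right]
  rfl

theorem EigCoord.filter_im_eq_zero {p : EigCoord k K} (hp : p ∈ upperCoord k K) :
    (p.poly.map (algebraMap ℝ ℂ)).roots.filter (fun z => z.im = 0) =
      Finset.univ.val.map fun j => ((p.1 j : ℝ) : ℂ) := by
  have hp' : ∀ j, (p.2 j).2 ≠ 0 := fun j => (hp j).ne'
  rw [EigCoord.roots_map_poly, Multiset.filter_add, Multiset.filter_add, Multiset.filter_map,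
    Multiset.filter_map, Multiset.filter_map]
  simp [Function.comp_def, hp']

theorem EigCoord.filter_im_pos {p : EigCoord k K} (hp : p ∈ upperCoord k K) :
    (p.poly.map (algebraMap ℝ ℂ)).roots.filter (fun z => 0 < z.im) =
      Finset.univ.val.map fun j => ((p.2 j).1 : ℂ) + (p.2 j).2 * Complex.I := by
  have hp' : ∀ j, 0 < (p.2 j).2 := hp
  have hp'' : ∀ j, ¬ ((p.2 j).2 < 0) := fun j => (hp' j).not_gt
  rw [EigCoord.roots_map_poly, Multiset.filter_add, Multiset.filter_add, Multiset.filter_map,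
    Multiset.filter_map, Multiset.filter_map]
  simp [Function.comp_def, hp', hp'']

/-- The polynomial determines the multiset of its real roots and that of its roots in the upper
half-plane, so the two kinds of labels are permuted separately. -/
theorem EigCoord.exists_perm_of_poly_eq {p p' : EigCoord k K} (hp : p ∈ upperCoord k K)
    (hp' : p' ∈ upperCoord k K) (h : p.poly = p'.poly) :
    ∃ (σ : Equiv.Perm (Fin k)) (τ : Equiv.Perm (Fin K)),
      p' = (fun j => p.1 (σ j), fun j => p.2 (τ j)) := by
  obtain ⟨σ, hσ⟩ := exists_perm_of_map_univ_eq
    ((filter_im_eq_zero hp).symm.trans ((congrArg (fun q : ℝ[X] =>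
      (q.map (algebraMap ℝ ℂ)).roots.filter fun z => z.im = 0) h).trans (filter_im_eq_zero hp')))
  obtain ⟨τ, hτ⟩ := exists_perm_of_map_univ_eq
    ((filter_im_pos hp).symm.trans ((congrArg (fun q : ℝ[X] =>
      (q.map (algebraMap ℝ ℂ)).roots.filter fun z => 0 < z.im) h).trans (filter_im_pos hp')))
  refine ⟨σ, τ, Prod.ext (funext fun j => Complex.ofReal_injective (hσ j)) (funext fun j => ?_)⟩
  have h1 := congrArg Complex.re (hτ j)
  have h2 := congrArg Complex.im (hτ j)
  simp at h1 h2
  exact Prod.ext h1 h2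

/-- The set of values of the eigenvalue polynomials with coordinates in a label-invariant set. -/
theorem measurableSet_eval_image {B : Set (EigCoord k K)} (hB : MeasurableSet B)
    (hinv : LabelInvariant B) : MeasurableSet (EigCoord.eval '' (B ∩ upperCoord k K)) := by
  let f : upperCoord k K → ℕ → ℝ := fun p => EigCoord.eval (p : EigCoord k K)
  have hf : Measurable f := (EigCoord.continuous_eval.comp continuous_subtype_val).measurable
  have hr : Set.range f = eigRange k K := by
    ext e; simp [f, eigRange]
  have hpre : f ⁻¹' (EigCoord.eval '' (B ∩ upperCoord k K)) = Subtype.val ⁻¹' B := by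
    ext ⟨p, hp⟩
    constructor
    · rintro ⟨p', ⟨hB', hp'⟩, he⟩
      obtain ⟨σ, τ, rfl⟩ := EigCoord.exists_perm_of_poly_eq hp' hp (EigCoord.eval_eq_iff.1 he)
      exact hinv σ τ p' hB'
    · intro h
      exact ⟨p, ⟨h, hp⟩, rfl⟩
  have : StandardBorelSpace (upperCoord k K) := isOpen_upperCoord.measurableSet.standardBorel
  have hsub : EigCoord.eval '' (B ∩ upperCoord k K) ⊆ Set.range f := by
    rw [hr]
    exact Set.image_mono Set.inter_subset_right
  rw [← Set.inter_eq_left.2 hsub]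
  -- On a standard Borel space, measurability of a set relative to the range of a measurable map can
  -- be tested on its preimage, even for non-injective maps. By label invariance the preimage is
  -- `B`.
  refine (hf.measurableSet_preimage_iff_inter_range (hr ▸ measurableSet_eigRange)).1 ?_
  rw [hpre]
  exact measurable_subtype_coe hB

theorem EigCoord.eval_mem_image_iff {B : Set (EigCoord k K)} (hinv : LabelInvariant B)
    {p : EigCoord k K} (hp : p ∈ upperCoord k K) :
    p.eval ∈ EigCoord.eval '' (B ∩ upperCoord k K) ↔ p ∈ B := by
  constructor
  · rintro ⟨p', ⟨hB', hp'⟩, he⟩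
    obtain ⟨σ, τ, rfl⟩ := EigCoord.exists_perm_of_poly_eq hp' hp (EigCoord.eval_eq_iff.1 he)
    exact hinv σ τ p' hB'
  · intro h
    exact ⟨p, ⟨h, hp⟩, rfl⟩

end EigenvaluePolynomial

/-! ### Adding one real eigenvalue or one conjugate pair. -/

section EigenvalueRecursion

open Polynomial

variable {k K N r : ℕ} {α : Type*} [Fintype α] [DecidableEq α]

/-- Prepend a real eigenvalue. -/
def EigCoord.consReal (t : ℝ) (p : EigCoord k K) : EigCoord (k + 1) K := (Fin.cons t p.1, p.2)

/-- Prepend a pair of non-real eigenvalues. -/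
def EigCoord.consPair (w : ℝ × ℝ) (p : EigCoord k K) : EigCoord k (K + 1) := (p.1, Fin.cons w p.2)

theorem EigCoord.poly_consReal (t : ℝ) (p : EigCoord k K) :
    (p.consReal t).poly = (X - C t) * p.poly := by
  simp [EigCoord.poly, EigCoord.consReal, Fin.prod_univ_succ, mul_assoc]

theorem EigCoord.poly_consPair (w : ℝ × ℝ) (p : EigCoord k K) :
    (p.consPair w).poly = ((X - C w.1) ^ 2 + C (w.2 ^ 2)) * p.poly := by
  simp only [EigCoord.poly, EigCoord.consPair, Fin.prod_univ_succ, Fin.cons_zero, Fin.cons_succ]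
  ring

theorem consPair_mem_upperCoord {w : ℝ × ℝ} {p : EigCoord k K} :
    p.consPair w ∈ upperCoord k (K + 1) ↔ 0 < w.2 ∧ p ∈ upperCoord k K := by
  change (∀ j : Fin (K + 1), 0 < ((Fin.cons w p.2 : Fin (K + 1) → ℝ × ℝ) j).2) ↔ _
  rw [Fin.forall_fin_succ]
  rfl

theorem charEval_mem_eigRange {P : Matrix α α ℝ} :
    P.charEval ∈ eigRange k K ↔ ∃ p ∈ upperCoord k K, P.charpoly = p.poly := by
  simp only [eigRange, Set.mem_image, eq_comm (b := P.charEval), charEval_eq_iff]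

theorem EigCoord.eval_consReal (t : ℝ) (p : EigCoord k K) :
    (p.consReal t).eval = (fun j : ℕ => (j : ℝ) - t) * p.eval := by
  funext j
  simp [EigCoord.eval, EigCoord.poly_consReal]

theorem EigCoord.eval_consPair (w : ℝ × ℝ) (p : EigCoord k K) :
    (p.consPair w).eval = (fun j : ℕ => ((j : ℝ) - w.1) ^ 2 + w.2 ^ 2) * p.eval := by
  funext j
  simp [EigCoord.eval, EigCoord.poly_consPair]

/-- The quadratic factors have no real zeros, so `t` is one of the real coordinates and the
corresponding linear factor can be cancelled. -/
theorem linear_mul_charEval_mem_eigRange {P : Matrix α α ℝ} {t : ℝ} :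
    (fun j : ℕ => (j : ℝ) - t) * P.charEval ∈ eigRange (k + 1) K ↔ P.charEval ∈ eigRange k K := by
  constructor
  · rintro ⟨p, hp, he⟩
    have hpoly : p.poly = (X - C t) * P.charpoly := Polynomial.eq_of_natCast_eval_eq fun j => by
      have := congrFun he j
      simpa [EigCoord.eval, Matrix.charEval] using this
    have hroot : p.poly.eval t = 0 := by rw [hpoly]; simp
    have hex : ∃ j, t = p.1 j := by
      by_contra hne
      push Not at hne
      rw [EigCoord.poly, eval_mul, eval_prod, eval_prod, mul_eq_zero, Finset.prod_eq_zero_iff,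
        Finset.prod_eq_zero_iff] at hroot
      rcases hroot with ⟨j, -, hj⟩ | ⟨j, -, hj⟩
      · exact hne j (sub_eq_zero.1 (by simpa using hj))
      · have h1 : 0 < (p.2 j).2 := hp j
        simp at hj
        nlinarith [sq_nonneg (t - (p.2 j).1)]
    obtain ⟨j, hj⟩ := hex
    have hp' : p.poly = (X - C t) * EigCoord.poly ((fun i => p.1 (j.succAbove i), p.2) : EigCoord k K) := by
      rw [EigCoord.poly, Fin.prod_univ_succAbove _ j, ← hj, mul_assoc]
      rfl
    refine charEval_mem_eigRange.2 ⟨(fun i => p.1 (j.succAbove i), p.2), hp, ?_⟩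
    exact mul_left_cancel₀ (X_sub_C_ne_zero t) (hpoly.symm.trans hp')
  · rintro ⟨p, hp, he⟩
    exact ⟨p.consReal t, hp, by rw [EigCoord.eval_consReal, he]⟩

/-- The root `x + i y` lies in the upper half-plane, hence belongs to one of the pairs, whose
quadratic factor can be cancelled. -/
theorem quadratic_mul_charEval_mem_eigRange {P : Matrix α α ℝ} {x y : ℝ} (hy : 0 < y) :
    (fun j : ℕ => ((j : ℝ) - x) ^ 2 + y ^ 2) * P.charEval ∈ eigRange k (K + 1) ↔
      P.charEval ∈ eigRange k K := by
  constructor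
  · rintro ⟨p, hp, he⟩
    have hpoly : p.poly = ((X - C x) ^ 2 + C (y ^ 2)) * P.charpoly :=
      Polynomial.eq_of_natCast_eval_eq fun j => by
        have := congrFun he j
        simpa [EigCoord.eval, Matrix.charEval] using this
    have hz : (x + y * Complex.I : ℂ) ∈ (p.poly.map (algebraMap ℝ ℂ)).roots.filter
        fun z => 0 < z.im := by
      rw [Multiset.mem_filter, mem_roots (p.monic_poly.map _).ne_zero, hpoly, Polynomial.map_mul,
        map_quadratic]
      simp [hy]
    rw [EigCoord.filter_im_pos hp, Multiset.mem_map] at hz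
    obtain ⟨j, -, hj⟩ := hz
    have h1 := congrArg Complex.re hj
    have h2 := congrArg Complex.im hj
    simp at h1 h2
    have hp' : p.poly = ((X - C x) ^ 2 + C (y ^ 2)) *
        EigCoord.poly ((p.1, fun i => p.2 (j.succAbove i)) : EigCoord k K) := by
      rw [EigCoord.poly, Fin.prod_univ_succAbove _ j, h1, h2, mul_left_comm]
      rfl
    refine charEval_mem_eigRange.2 ⟨(p.1, fun i => p.2 (j.succAbove i)), fun i => hp _, ?_⟩
    exact mul_left_cancel₀ (monic_quadratic x y).ne_zero (hpoly.symm.trans hp')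
  · rintro ⟨p, hp, he⟩
    exact ⟨p.consPair (x, y), consPair_mem_upperCoord.2 ⟨hy, hp⟩, by rw [EigCoord.eval_consPair, he]⟩

/-- The value at `z` of the polynomial of degree `≤ n` with prescribed values at the natural
numbers. -/
noncomputable def lagrangeEval (n : ℕ) (z : ℂ) (e : ℕ → ℝ) : ℂ :=
  ∑ i ∈ Finset.range (n + 1),
    (e i : ℂ) * aeval z (Lagrange.basis (Finset.range (n + 1)) (fun i : ℕ => (i : ℝ)) i)

theorem lagrangeEval_eval {q : ℝ[X]} {n : ℕ} (hq : q.natDegree ≤ n) (z : ℂ) :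
    lagrangeEval n z (fun j => q.eval (j : ℝ)) = aeval z q := by
  have h := Lagrange.eq_interpolate_of_eval_eq (s := Finset.range (n + 1))
    (v := fun i : ℕ => (i : ℝ)) (f := q) (fun j => q.eval (j : ℝ))
    (Nat.cast_injective.injOn) (by
      rw [Finset.card_range]
      exact degree_le_natDegree.trans_lt (Nat.cast_lt.2 (Nat.lt_succ_of_le hq))) (fun _ _ => rfl)
  conv_rhs => rw [h, Lagrange.interpolate_apply, map_sum]
  refine Finset.sum_congr rfl fun i _ => ?_
  rw [map_mul, aeval_C]
  rfl

theorem continuous_lagrangeEval (n : ℕ) :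
    Continuous fun x : ℂ × (ℕ → ℝ) => lagrangeEval n x.1 x.2 := by
  unfold lagrangeEval
  have h : ∀ q : ℝ[X], Continuous fun z : ℂ => aeval z q := fun q => q.continuous_aeval
  refine continuous_finsetSum _ fun i _ => Continuous.mul (by fun_prop) ((h _).comp continuous_fst)

theorem lagrangeEval_charEval (P : Matrix α α ℝ) (z : ℂ) :
    lagrangeEval (Fintype.card α) z P.charEval = aeval z P.charpoly :=
  lagrangeEval_eval (Matrix.charpoly_natDegree_eq_dim P).le z

theorem EigCoord.lagrangeEval_eval (p : EigCoord k K) (z : ℂ) :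
    lagrangeEval (k + 2 * K) z p.eval = aeval z p.poly :=
  _root_.lagrangeEval_eval p.natDegree_poly.le z

theorem Matrix.aeval_derivative_ne_zero {P : Matrix α α ℝ}
    (h : (aeval P P.charpoly.derivative).det ≠ 0) {z : ℂ} (hz : aeval z P.charpoly = 0) :
    aeval z P.charpoly.derivative ≠ 0 := by
  intro hd
  obtain ⟨M, hM0, hM⟩ := Matrix.exists_mul_eq_mul_complexMatrix hz
  have h1 := Matrix.aeval_intertwine hM P.charpoly.derivative
  rw [aeval_complexMatrix, hd, map_zero, Matrix.mul_zero] at h1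
  apply hM0
  have h2 := congrArg ((aeval P P.charpoly.derivative)⁻¹ * ·) h1
  rwa [← Matrix.mul_assoc, Matrix.nonsing_inv_mul _ h.isUnit, Matrix.one_mul, Matrix.mul_zero] at h2

theorem Matrix.nodup_roots_charpoly {P : Matrix α α ℝ}
    (h : (aeval P P.charpoly.derivative).det ≠ 0) :
    (P.charpoly.map (algebraMap ℝ ℂ)).roots.Nodup := by
  classical
  have h0 : P.charpoly.map (algebraMap ℝ ℂ) ≠ 0 := ((Matrix.charpoly_monic P).map _).ne_zero
  rw [Multiset.nodup_iff_count_le_one]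
  intro z
  rw [count_roots]
  by_contra hlt
  obtain ⟨h1, h2⟩ := (one_lt_rootMultiplicity_iff_isRoot h0).1 (not_le.1 hlt)
  rw [IsRoot.def, eval_map_algebraMap] at h1
  rw [IsRoot.def, derivative_map, eval_map_algebraMap] at h2
  exact Matrix.aeval_derivative_ne_zero h h1 h2

theorem encard_range_eq {n : ℕ} {β : Type*} {f : Fin n → β} (hf : Function.Injective f) :
    (Set.range f).encard = n := by
  rw [← Set.image_univ, hf.encard_image, Set.encard_univ]
  simp

theorem EigCoord.encard_real_roots {p : EigCoord k K} (hp : p ∈ upperCoord k K)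
    (h : (p.poly.map (algebraMap ℝ ℂ)).roots.Nodup) : {x : ℝ | p.poly.IsRoot x}.encard = k := by
  have hf := h.filter (fun z => z.im = 0)
  rw [EigCoord.filter_im_eq_zero hp] at hf
  have hinj : Function.Injective p.1 := fun i j hij =>
    Multiset.inj_on_of_nodup_map hf i (Finset.mem_univ_val i) j (Finset.mem_univ_val j)
      (congrArg _ hij)
  have hset : {x : ℝ | p.poly.IsRoot x} = Set.range p.1 := by
    ext x
    have h1 : p.poly.IsRoot x ↔ (x : ℂ) ∈ (p.poly.map (algebraMap ℝ ℂ)).roots.filter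
        (fun z => z.im = 0) := by
      rw [Multiset.mem_filter, mem_roots (p.monic_poly.map _).ne_zero, IsRoot.def, IsRoot.def,
        eval_map_algebraMap]
      have : aeval (x : ℂ) p.poly = ((p.poly.eval x : ℝ) : ℂ) := aeval_ofReal _ x
      rw [this]
      simp
    rw [Set.mem_ofPred_eq, h1, EigCoord.filter_im_eq_zero hp]
    simp
  rw [hset, encard_range_eq hinj]

theorem EigCoord.encard_upper_roots {p : EigCoord k K} (hp : p ∈ upperCoord k K)
    (h : (p.poly.map (algebraMap ℝ ℂ)).roots.Nodup) :
    {z : ℂ | 0 < z.im ∧ aeval z p.poly = 0}.encard = K := by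
  have hf := h.filter (fun z => 0 < z.im)
  rw [EigCoord.filter_im_pos hp] at hf
  have hinj : Function.Injective fun j => ((p.2 j).1 : ℂ) + (p.2 j).2 * Complex.I := fun i j hij =>
    Multiset.inj_on_of_nodup_map hf i (Finset.mem_univ_val i) j (Finset.mem_univ_val j) hij
  have hset : {z : ℂ | 0 < z.im ∧ aeval z p.poly = 0} =
      Set.range fun j => ((p.2 j).1 : ℂ) + (p.2 j).2 * Complex.I := by
    ext z
    have h1 : (0 < z.im ∧ aeval z p.poly = 0) ↔ z ∈ (p.poly.map (algebraMap ℝ ℂ)).roots.filter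
        (fun z => 0 < z.im) := by
      rw [Multiset.mem_filter, mem_roots (p.monic_poly.map _).ne_zero, IsRoot.def,
        eval_map_algebraMap, and_comm]
    rw [Set.mem_ofPred_eq, h1, EigCoord.filter_im_pos hp]
    simp
  rw [hset, encard_range_eq hinj]

/-- The Vandermonde product grows by the value at `t` of the old polynomial, which is the deflation
Jacobian. The factorial and `ginibreZ` account for the remaining constants. -/
theorem jointDensity_consReal (t : ℝ) (p : EigCoord k K) :
    jointDensity r (N + 1) (k + 1) K (p.consReal t) *
        (ENNReal.ofReal (k + 1) * ENNReal.ofReal (gaussMoment N) ^ r) =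
      ENNReal.ofReal |p.poly.eval t| * realWeight r t * jointDensity r N k K p := by
  have hZ := ginibreZ_pos N
  have hZ' := ginibreZ_pos (N + 1)
  have hγ := gaussMoment_pos N
  have hV := p.poly.vandermondeNorm_nonneg
  have hconst : 1 / (((k + 1)! : ℝ) * (K ! : ℝ)) * (1 / ginibreZ (N + 1)) ^ r *
      (|p.poly.eval t| * p.poly.vandermondeNorm) * ((k + 1) * gaussMoment N ^ r) =
      |p.poly.eval t| * (1 / ((k ! : ℝ) * (K ! : ℝ)) * (1 / ginibreZ N) ^ r *
        p.poly.vandermondeNorm) := by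
    rw [ginibreZ_succ, Nat.factorial_succ]
    have : (k ! : ℝ) ≠ 0 := by positivity
    have : (K ! : ℝ) ≠ 0 := by positivity
    push_cast
    simp only [one_div, mul_inv, mul_pow, inv_pow]
    field_simp
  rw [jointDensity, jointDensity, norm_vandermondeProd_eigList, norm_vandermondeProd_eigList,
    EigCoord.poly_consReal, Polynomial.vandermondeNorm_linear_mul p.monic_poly]
  have hprod : ∏ j, realWeight r ((p.consReal t).1 j) = realWeight r t * ∏ j, realWeight r (p.1 j) := by
    simp [EigCoord.consReal, Fin.prod_univ_succ]
  rw [hprod, ← ENNReal.ofReal_pow hγ.le, ← ENNReal.ofReal_mul (by positivity)]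
  have h2 : ∏ j, complexWeight r ((p.consReal t).2 j).1 ((p.consReal t).2 j).2 =
    ∏ j, complexWeight r (p.2 j).1 (p.2 j).2 := rfl
  rw [h2]
  have h3 := congrArg ENNReal.ofReal hconst
  rw [ENNReal.ofReal_mul (q := ((k : ℝ) + 1) * _) (by positivity),
    ENNReal.ofReal_mul (abs_nonneg _)] at h3
  calc _ = ENNReal.ofReal (1 / (((k + 1)! : ℝ) * (K ! : ℝ)) * (1 / ginibreZ (N + 1)) ^ r *
      (|p.poly.eval t| * p.poly.vandermondeNorm)) * ENNReal.ofReal ((k + 1) * gaussMoment N ^ r) *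
      (realWeight r t * (∏ j, realWeight r (p.1 j)) *
        ∏ j, complexWeight r (p.2 j).1 (p.2 j).2) := by ring
    _ = _ := by rw [h3]; ring

/-- The factor `2 w.2` comes from the interaction within the pair and matches the weight in
`lintegral_nonrealTwo`; the squared absolute value is the deflation Jacobian. -/
theorem jointDensity_consPair {w : ℝ × ℝ} (hw : 0 < w.2) (p : EigCoord k K) :
    jointDensity r (N + 2) k (K + 1) (p.consPair w) * (ENNReal.ofReal (K + 1) *
        (ENNReal.ofReal (gaussMoment N) * ENNReal.ofReal (gaussMoment (N + 1))) ^ r) =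
      ENNReal.ofReal (Complex.normSq (aeval ((w.1 : ℂ) + w.2 * Complex.I) p.poly)) *
        (ENNReal.ofReal (2 * w.2) * complexWeight r w.1 w.2) * jointDensity r N k K p := by
  have hZ := ginibreZ_pos N
  have hZ' := ginibreZ_pos (N + 2)
  have hγ := gaussMoment_pos N
  have hγ' := gaussMoment_pos (N + 1)
  have hV := p.poly.vandermondeNorm_nonneg
  set Q := Complex.normSq (aeval ((w.1 : ℂ) + w.2 * Complex.I) p.poly) with hQ
  have hQ0 : 0 ≤ Q := Complex.normSq_nonneg _
  have hconst : 1 / ((k ! : ℝ) * ((K + 1)! : ℝ)) * (1 / ginibreZ (N + 2)) ^ r *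
      (2 * |w.2| * Q * p.poly.vandermondeNorm) *
        ((K + 1) * (gaussMoment N * gaussMoment (N + 1)) ^ r) =
      Q * (2 * w.2) * (1 / ((k ! : ℝ) * (K ! : ℝ)) * (1 / ginibreZ N) ^ r *
        p.poly.vandermondeNorm) := by
    rw [ginibreZ_succ, ginibreZ_succ, Nat.factorial_succ, abs_of_pos hw]
    have : (k ! : ℝ) ≠ 0 := by positivity
    have : (K ! : ℝ) ≠ 0 := by positivity
    push_cast
    simp only [one_div, mul_inv, mul_pow, inv_pow]
    field_simp
  rw [jointDensity, jointDensity, norm_vandermondeProd_eigList, norm_vandermondeProd_eigList,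
    EigCoord.poly_consPair, Polynomial.vandermondeNorm_quadratic_mul p.monic_poly, ← hQ]
  have hprod : ∏ j, complexWeight r ((p.consPair w).2 j).1 ((p.consPair w).2 j).2 =
      complexWeight r w.1 w.2 * ∏ j, complexWeight r (p.2 j).1 (p.2 j).2 := by
    simp [EigCoord.consPair, Fin.prod_univ_succ]
  rw [hprod, ← ENNReal.ofReal_mul hγ.le, ← ENNReal.ofReal_pow (by positivity),
    ← ENNReal.ofReal_mul (by positivity)]
  have h2 : ∏ j, realWeight r ((p.consPair w).1 j) = ∏ j, realWeight r (p.1 j) := rfl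
  rw [h2]
  have h3 := congrArg ENNReal.ofReal hconst
  rw [ENNReal.ofReal_mul (q := ((K : ℝ) + 1) * _) (by positivity),
    ENNReal.ofReal_mul (p := Q * (2 * w.2)) (by have := hw.le; positivity),
    ENNReal.ofReal_mul hQ0] at h3
  calc _ = ENNReal.ofReal (1 / ((k ! : ℝ) * ((K + 1)! : ℝ)) * (1 / ginibreZ (N + 2)) ^ r *
      (2 * |w.2| * Q * p.poly.vandermondeNorm)) *
      ENNReal.ofReal ((K + 1) * (gaussMoment N * gaussMoment (N + 1)) ^ r) *
      (complexWeight r w.1 w.2 * (∏ j, realWeight r (p.1 j)) *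
        ∏ j, complexWeight r (p.2 j).1 (p.2 j).2) := by ring
    _ = _ := by rw [h3]; ring

end EigenvalueRecursion

/-! ### The deflated integrands in eigenvalue coordinates. -/

section DeflatedIntegrals

attribute [local instance] matrixMeasureSpace matrix_borelSpace matrix_isAddHaarMeasure
  matrix_sigmaFinite matrix_secondCountable isAddHaarMeasure_pi_pi_pi isAddHaarMeasure_seq isAddHaarMeasure_seq_prod

open Polynomial (aeval)

variable {k K n m r : ℕ} {α β : Type*} [Fintype α] [DecidableEq α] [Fintype β] [DecidableEq β]

theorem volume_preserving_submatrix (e : α ≃ β) :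
    MeasurePreserving (fun M : Matrix β β ℝ => M.submatrix e e) := by
  have h1 : MeasurePreserving (fun (v : β → ℝ) (i : α) => v (e i)) :=
    volume_preserving_arrowCongr' e.symm (MeasurableEquiv.refl ℝ) (MeasurePreserving.id _)
  have h2 : MeasurePreserving (fun (v : β → α → ℝ) (i : α) => v (e i)) :=
    volume_preserving_arrowCongr' e.symm (MeasurableEquiv.refl (α → ℝ)) (MeasurePreserving.id _)
  have h3 : MeasurePreserving (fun (M : β → β → ℝ) (i : β) (j : α) => M i (e j)) :=
    volume_preserving_pi fun _ => h1
  exact h2.comp h3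

theorem lintegral_charEval_reindex (e : α ≃ β) {h : (ℕ → ℝ) → ℝ≥0∞} (hh : Measurable h) :
    ∫⁻ X : Fin m → Matrix α α ℝ, h (List.ofFn X).prod.charEval * seqWeight X =
      ∫⁻ X : Fin m → Matrix β β ℝ, h (List.ofFn X).prod.charEval * seqWeight X := by
  have hm : Measurable fun X : Fin m → Matrix α α ℝ =>
      h (List.ofFn X).prod.charEval * seqWeight X :=
    (hh.comp (measurable_charEval.comp (continuous_ofFn_prod m).measurable)).mul measurable_seqWeight
  have hp : MeasurePreserving fun (X : Fin m → Matrix β β ℝ) l => (X l).submatrix e e :=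
    volume_preserving_pi fun _ => volume_preserving_submatrix e
  rw [← hp.lintegral_comp hm]
  refine lintegral_congr fun X => ?_
  have h1 : (List.ofFn fun l => (X l).submatrix e e).prod = (List.ofFn X).prod.submatrix e e := by
    have h := map_list_prod (Matrix.reindexAlgEquiv ℝ ℝ e.symm) (List.ofFn X)
    rw [List.map_ofFn] at h
    exact h.symm
  have h2 : seqWeight (fun l => (X l).submatrix e e) = seqWeight X := by
    refine Finset.prod_congr rfl fun l _ => ?_
    rw [gaussWeight, gaussWeight]
    congr 4
    simp only [Matrix.frobSq, Matrix.submatrix_apply]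
    rw [← e.sum_comp]
    refine Finset.sum_congr rfl fun i _ => ?_
    rw [← e.sum_comp]
  rw [h1, h2]
  congr 2
  funext j
  have := Matrix.charpoly_reindex e.symm (List.ofFn X).prod
  exact congrArg (Polynomial.eval (j : ℝ)) this

theorem abs_det_aeval_linear (P : Matrix α α ℝ) (t : ℝ) :
    |(aeval P (Polynomial.X - Polynomial.C t)).det| = |P.charpoly.eval t| := by
  rw [Matrix.eval_charpoly, map_sub, Polynomial.aeval_X, Polynomial.aeval_C,
    ← neg_sub, Matrix.det_neg, abs_mul, abs_pow, abs_neg, abs_one, one_pow, one_mul]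
  rfl

/-- Over the complex numbers the quadratic factors, and the two determinants are conjugate values of
the real characteristic polynomial. -/
theorem det_aeval_quadratic (P : Matrix α α ℝ) (x y : ℝ) :
    (aeval P ((Polynomial.X - Polynomial.C x) ^ 2 + Polynomial.C (y ^ 2))).det =
      Complex.normSq (aeval ((x : ℂ) + y * Complex.I) P.charpoly) := by
  apply Complex.ofReal_injective
  have hmap : (Complex.ofRealHom.mapMatrix (aeval P ((Polynomial.X - Polynomial.C x) ^ 2 +
      Polynomial.C (y ^ 2)))) =
      (Matrix.scalar α ((x : ℂ) + y * Complex.I) - P.map (algebraMap ℝ ℂ)) *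
      (Matrix.scalar α ((x : ℂ) - y * Complex.I) - P.map (algebraMap ℝ ℂ)) := by
    have hs : ∀ a : ℂ, Matrix.scalar α a = a • (1 : Matrix α α ℂ) := fun a => by
      rw [Matrix.scalar_apply, Matrix.smul_one_eq_diagonal]
    have hr : ∀ a : ℝ, Complex.ofRealHom.mapMatrix (algebraMap ℝ (Matrix α α ℝ) a) =
        (a : ℂ) • (1 : Matrix α α ℂ) := fun a => by
      rw [← hs]
      ext i j
      simp [Matrix.algebraMap_matrix_apply, Matrix.diagonal_apply, apply_ite Complex.ofReal]
    have hP : Complex.ofRealHom.mapMatrix P = P.map (algebraMap ℝ ℂ) := rfl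
    have h1 : ((x : ℂ) + y * Complex.I) * ((x : ℂ) - y * Complex.I) = (x : ℂ) * x + (y : ℂ) * y := by
      linear_combination (-(y : ℂ) ^ 2) * Complex.I_mul_I
    have h2 : ((x : ℂ) + y * Complex.I) + ((x : ℂ) - y * Complex.I) = x + x := by ring
    set z := (x : ℂ) + y * Complex.I
    set w := (x : ℂ) - y * Complex.I
    set Q := P.map (algebraMap ℝ ℂ)
    have h3 : (z • (1 : Matrix α α ℂ) - Q) * (w • (1 : Matrix α α ℂ) - Q) =
        (z * w) • (1 : Matrix α α ℂ) - (z + w) • Q + Q * Q := by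
      simp only [sub_mul, mul_sub, smul_mul_assoc, mul_smul_comm, one_mul, mul_one]
      module
    rw [hs, hs, h3, h1, h2]
    simp only [map_add, map_pow, map_sub, Polynomial.aeval_X, Polynomial.aeval_C, hr, hP]
    simp only [sq, sub_mul, mul_sub, smul_mul_assoc, mul_smul_comm, one_mul, mul_one]
    module
  have hconj : ((x : ℂ) - y * Complex.I) = starRingEnd ℂ ((x : ℂ) + y * Complex.I) := by
    simp [sub_eq_add_neg]
  rw [← Complex.ofRealHom_eq_coe, RingHom.map_det, hmap, Matrix.det_mul, ← Matrix.eval_charpoly,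
    ← Matrix.eval_charpoly, Matrix.charpoly_map, Polynomial.eval_map_algebraMap,
    Polynomial.eval_map_algebraMap, hconj, Polynomial.aeval_conj, ← Complex.mul_conj]

theorem charpoly_matrix_one (t : ℝ) :
    (!![t] : Matrix (Fin 1) (Fin 1) ℝ).charpoly = Polynomial.X - Polynomial.C t := by
  simp [Matrix.charpoly]

theorem charpoly_of_mem_nonrealTwo {G : Matrix (Fin 2) (Fin 2) ℝ} (hG : G ∈ nonrealTwo) :
    G.charpoly = (Polynomial.X - Polynomial.C (G.trace / 2)) ^ 2 +
      Polynomial.C ((Real.sqrt (4 * G.det - G.trace ^ 2) / 2) ^ 2) := by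
  have hG' : G.trace ^ 2 < 4 * G.det := hG
  rw [Matrix.charpoly_fin_two, div_pow, Real.sq_sqrt (by linarith)]
  have h1 : G.trace = 2 * (G.trace / 2) := by ring
  have h2 : (4 * G.det - G.trace ^ 2) / 2 ^ 2 = G.det - (G.trace / 2) ^ 2 := by ring
  rw [h2]
  conv_lhs => rw [h1]
  simp only [Polynomial.C_sub, Polynomial.C_pow, Polynomial.C_mul, Polynomial.C_ofNat]
  ring

/-- The point of `lagrangeEval` is that the Jacobian becomes a function of `charEval` alone, so the
induction hypothesis applies to the whole integrand. -/
theorem deflationKernel_one (h : (ℕ → ℝ) → ℝ≥0∞) (t : ℝ) (P : Matrix α α ℝ) :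
    deflationKernel Set.univ h !![t] P =
      ENNReal.ofReal ‖lagrangeEval (Fintype.card α) t P.charEval‖ *
        h ((fun j : ℕ => (j : ℝ) - t) * P.charEval) := by
  have h1 : (!![t] : Matrix (Fin 1) (Fin 1) ℝ).charEval = fun j : ℕ => (j : ℝ) - t := by
    funext j
    simp [Matrix.charEval, charpoly_matrix_one]
  have h2 : aeval (t : ℂ) P.charpoly = ((P.charpoly.eval t : ℝ) : ℂ) := Polynomial.aeval_ofReal _ t
  rw [deflationKernel, Matrix.abs_det_sylvester, charpoly_matrix_one, abs_det_aeval_linear, h1,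
    lagrangeEval_charEval, h2, Complex.norm_real, Real.norm_eq_abs]
  simp

theorem deflationKernel_two (h : (ℕ → ℝ) → ℝ≥0∞) (G : Matrix (Fin 2) (Fin 2) ℝ)
    (P : Matrix α α ℝ) :
    deflationKernel nonrealTwo h G P = nonrealTwo.indicator (fun G =>
      ENNReal.ofReal (Complex.normSq (lagrangeEval (Fintype.card α) (((G.trace / 2 : ℝ) : ℂ) +
        (Real.sqrt (4 * G.det - G.trace ^ 2) / 2 : ℝ) * Complex.I) P.charEval)) *
        h ((fun j : ℕ => ((j : ℝ) - G.trace / 2) ^ 2 +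
          (Real.sqrt (4 * G.det - G.trace ^ 2) / 2) ^ 2) * P.charEval)) G := by
  by_cases hG : G ∈ nonrealTwo
  · have h1 : G.charEval = fun j : ℕ => ((j : ℝ) - G.trace / 2) ^ 2 +
        (Real.sqrt (4 * G.det - G.trace ^ 2) / 2) ^ 2 := by
      funext j
      simp [Matrix.charEval, charpoly_of_mem_nonrealTwo hG]
    rw [deflationKernel, Matrix.abs_det_sylvester, h1, charpoly_of_mem_nonrealTwo hG,
      det_aeval_quadratic, Set.indicator_of_mem hG, Set.indicator_of_mem hG, lagrangeEval_charEval,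
      abs_of_nonneg (Complex.normSq_nonneg _), mul_one]
  · rw [deflationKernel, Set.indicator_of_notMem hG, Set.indicator_of_notMem hG, mul_zero, zero_mul]

theorem ofFn_matrix_one_prod (t : Fin m → ℝ) :
    (List.ofFn fun l => (!![t l] : Matrix (Fin 1) (Fin 1) ℝ)).prod = !![∏ l, t l] := by
  induction m with
  | zero => ext i j; fin_cases i; fin_cases j; simp
  | succ m ih =>
    rw [List.ofFn_succ, List.prod_cons, ih, Fin.prod_univ_succ]
    ext i j
    fin_cases i; fin_cases j
    simp [Matrix.mul_apply]

theorem lintegral_seqWeight_matrix_one {f : Matrix (Fin 1) (Fin 1) ℝ → ℝ≥0∞} (hf : Measurable f) :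
    ∫⁻ G : Fin (r + 1) → Matrix (Fin 1) (Fin 1) ℝ, seqWeight G * f (List.ofFn G).prod =
      ∫⁻ t : ℝ, realWeight (r + 1) t * f !![t] := by
  have hp : MeasurePreserving fun (t : Fin (r + 1) → ℝ) l => (!![t l] : Matrix (Fin 1) (Fin 1) ℝ) :=
    volume_preserving_pi fun _ => volume_preserving_matrix_one
  have hm : Measurable fun G : Fin (r + 1) → Matrix (Fin 1) (Fin 1) ℝ =>
      seqWeight G * f (List.ofFn G).prod :=
    measurable_seqWeight.mul (hf.comp (continuous_ofFn_prod _).measurable)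
  rw [← hp.lintegral_comp hm]
  have hf' : Measurable fun t : ℝ => f !![t] := by
    have h := hf.comp volume_preserving_matrix_one.measurable
    exact h
  rw [← lintegral_scalarGauss_comp_prod hf']
  refine lintegral_congr fun t => ?_
  rw [ofFn_matrix_one_prod]
  congr 1
  refine Finset.prod_congr rfl fun l _ => ?_
  rw [gaussWeight, scalarGauss]
  congr 4
  simp [Matrix.frobSq]

theorem gaussWeight_two (G : Matrix (Fin 2) (Fin 2) ℝ) :
    gaussWeight G = ENNReal.ofReal (Real.sqrt (2 * Real.pi ^ 3)) * matrixGauss G := by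
  have h : 0 < Real.sqrt (2 * Real.pi ^ 3) := Real.sqrt_pos.2 (by positivity)
  rw [matrixGauss_eq, ← mul_assoc, ENNReal.mul_inv_cancel (by simpa using h) ENNReal.ofReal_ne_top,
    one_mul]

theorem lintegral_seqWeight_matrix_two {f : Matrix (Fin 2) (Fin 2) ℝ → ℝ≥0∞} (hf : Measurable f) :
    ∫⁻ G : Fin (r + 1) → Matrix (Fin 2) (Fin 2) ℝ, seqWeight G * f (List.ofFn G).prod =
      ENNReal.ofReal (Real.sqrt (2 * Real.pi ^ 3)) ^ (r + 1) *
        ∫⁻ G : Matrix (Fin 2) (Fin 2) ℝ, matrixWeight (r + 1) G * f G := by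
  rw [← lintegral_matrixGauss_comp_prod hf, ← lintegral_const_mul' _ _
    (ENNReal.pow_ne_top ENNReal.ofReal_ne_top)]
  refine lintegral_congr fun G => ?_
  rw [seqWeight]
  simp_rw [gaussWeight_two]
  rw [Finset.prod_mul_distrib, Finset.prod_const, Finset.card_univ, Fintype.card_fin, mul_assoc]
  rfl

theorem measurable_complexWeight (m : ℕ) : Measurable fun w : ℝ × ℝ => complexWeight m w.1 w.2 := by
  unfold complexWeight
  refine Measurable.const_mul (Measurable.lintegral_prod_right' (f := fun x : (ℝ × ℝ) × ℝ =>
    ENNReal.ofReal (|x.2| / Real.sqrt (x.2 ^ 2 + 4 * x.1.2 ^ 2)) *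
      matrixWeight m !![muPlus x.1.1 x.1.2 x.2, 0; 0, muMinus x.1.1 x.1.2 x.2]) ?_) _
  refine Measurable.mul (by fun_prop) ?_
  have h1 : Measurable fun x : (ℝ × ℝ) × ℝ =>
      (!![muPlus x.1.1 x.1.2 x.2, 0; 0, muMinus x.1.1 x.1.2 x.2] : Matrix (Fin 2) (Fin 2) ℝ) := by
    refine Continuous.measurable (continuous_matrix fun i j => ?_)
    fin_cases i <;> fin_cases j <;> simp [muPlus, muMinus] <;> fun_prop
  have h := (measurable_matrixWeight m).comp h1
  exact h

theorem continuous_eigList : Continuous (eigList : EigCoord k K → Fin (k + K + K) → ℂ) := by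
  refine continuous_pi fun l => ?_
  refine Fin.addCases (fun l => Fin.addCases (fun l => ?_) (fun l => ?_) l) (fun l => ?_) l <;>
    simp only [eigList, Fin.append_left, Fin.append_right] <;> fun_prop

theorem measurable_jointDensity (m N k K : ℕ) : Measurable (jointDensity m N k K) := by
  unfold jointDensity
  refine Measurable.mul (Measurable.mul ?_ ?_) ?_
  · refine ENNReal.measurable_ofReal.comp (Continuous.measurable ?_)
    refine continuous_const.mul (Continuous.norm ?_)
    have h : Continuous fun z : Fin (k + K + K) → ℂ => vandermondeProd z := by
      unfold vandermondeProd
      fun_prop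
    exact h.comp continuous_eigList
  · refine Finset.measurable_fun_prod _ fun j _ => ?_
    have h1 : Measurable fun p : EigCoord k K => p.1 j := by fun_prop
    have h := (measurable_realWeight m).comp h1
    exact h
  · refine Finset.measurable_fun_prod _ fun j _ => ?_
    have h1 : Measurable fun p : EigCoord k K => p.2 j := by fun_prop
    have h := (measurable_complexWeight m).comp h1
    exact h

theorem volume_preserving_consReal :
    MeasurePreserving fun x : ℝ × EigCoord k K => x.2.consReal x.1 := by
  have s1 : MeasurePreserving (fun x : ℝ × EigCoord k K => ((x.1, x.2.1), x.2.2)) :=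
    volume_preserving_prodAssoc.symm
  have s2 : MeasurePreserving (fun x : ℝ × (Fin k → ℝ) => (Fin.cons x.1 x.2 : Fin (k + 1) → ℝ)) := by
    have := (volume_preserving_piFinSuccAbove (fun _ : Fin (k + 1) => ℝ) 0).symm
    refine (funext fun x => ?_ : (fun x : ℝ × (Fin k → ℝ) => (Fin.cons x.1 x.2 : Fin (k + 1) → ℝ)) =
      (MeasurableEquiv.piFinSuccAbove (fun _ : Fin (k + 1) => ℝ) 0).symm) ▸ this
    simp [MeasurableEquiv.piFinSuccAbove]
    rfl
  exact (s2.prod (MeasurePreserving.id _)).comp s1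

theorem volume_preserving_consPair :
    MeasurePreserving fun x : (ℝ × ℝ) × EigCoord k K => x.2.consPair x.1 := by
  have s1 : MeasurePreserving (fun x : (ℝ × ℝ) × EigCoord k K => (x.2.1, (x.1, x.2.2))) := by
    have t1 : MeasurePreserving (fun x : (ℝ × ℝ) × EigCoord k K => (x.2, x.1)) :=
      Measure.measurePreserving_swap
    have t2 : MeasurePreserving (fun x : EigCoord k K × (ℝ × ℝ) => (x.1.1, (x.1.2, x.2))) :=
      volume_preserving_prodAssoc
    have t3 : MeasurePreserving (fun x : (Fin K → ℝ × ℝ) × (ℝ × ℝ) => (x.2, x.1)) :=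
      Measure.measurePreserving_swap
    exact ((MeasurePreserving.id _).prod t3).comp (t2.comp t1)
  have s2 : MeasurePreserving
      (fun x : (ℝ × ℝ) × (Fin K → ℝ × ℝ) => (Fin.cons x.1 x.2 : Fin (K + 1) → ℝ × ℝ)) := by
    have := (volume_preserving_piFinSuccAbove (fun _ : Fin (K + 1) => ℝ × ℝ) 0).symm
    refine (funext fun x => ?_ : (fun x : (ℝ × ℝ) × (Fin K → ℝ × ℝ) =>
      (Fin.cons x.1 x.2 : Fin (K + 1) → ℝ × ℝ)) =
      (MeasurableEquiv.piFinSuccAbove (fun _ : Fin (K + 1) => ℝ × ℝ) 0).symm) ▸ this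
    simp [MeasurableEquiv.piFinSuccAbove]
    rfl
  exact ((MeasurePreserving.id _).prod s2).comp s1

theorem lintegral_upperCoord_consReal {f : EigCoord (k + 1) K → ℝ≥0∞} (hf : Measurable f) :
    ∫⁻ p in upperCoord (k + 1) K, f p = ∫⁻ t : ℝ, ∫⁻ p in upperCoord k K, f (p.consReal t) := by
  have hm := hf.indicator (isOpen_upperCoord (k := k + 1) (K := K)).measurableSet
  have hm' : Measurable fun x : ℝ × EigCoord k K =>
      (upperCoord (k + 1) K).indicator f (x.2.consReal x.1) := by
    have h := hm.comp (volume_preserving_consReal (k := k) (K := K)).measurable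
    exact h
  rw [← lintegral_indicator isOpen_upperCoord.measurableSet,
    ← volume_preserving_consReal.lintegral_comp hm, Measure.volume_eq_prod,
    lintegral_prod _ hm'.aemeasurable]
  refine lintegral_congr fun t => ?_
  rw [← lintegral_indicator isOpen_upperCoord.measurableSet]
  rfl

theorem lintegral_upperCoord_consPair {f : EigCoord k (K + 1) → ℝ≥0∞} (hf : Measurable f) :
    ∫⁻ p in upperCoord k (K + 1), f p =
      ∫⁻ x : ℝ, ∫⁻ y in Set.Ioi (0 : ℝ), ∫⁻ p in upperCoord k K, f (p.consPair (x, y)) := by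
  have hm := hf.indicator (isOpen_upperCoord (k := k) (K := K + 1)).measurableSet
  have hm' : Measurable fun x : (ℝ × ℝ) × EigCoord k K =>
      (upperCoord k (K + 1)).indicator f (x.2.consPair x.1) := by
    have h := hm.comp (volume_preserving_consPair (k := k) (K := K)).measurable
    exact h
  have hm'' : Measurable fun w : ℝ × ℝ =>
    ∫⁻ p : EigCoord k K, (upperCoord k (K + 1)).indicator f (p.consPair w) :=
    hm'.lintegral_prod_right'
  rw [← lintegral_indicator isOpen_upperCoord.measurableSet,
    ← volume_preserving_consPair.lintegral_comp hm, Measure.volume_eq_prod,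
    lintegral_prod _ hm'.aemeasurable, Measure.volume_eq_prod ℝ ℝ, lintegral_prod _ hm''.aemeasurable]
  refine lintegral_congr fun x => ?_
  rw [← lintegral_indicator measurableSet_Ioi]
  refine lintegral_congr fun y => ?_
  classical
  by_cases hy : 0 < y
  · rw [Set.indicator_of_mem (Set.mem_Ioi.2 hy), ← lintegral_indicator isOpen_upperCoord.measurableSet]
    refine lintegral_congr fun p => ?_
    rw [Set.indicator_apply, Set.indicator_apply]
    exact if_congr (consPair_mem_upperCoord.trans (and_iff_right hy)) rfl rfl
  · rw [Set.indicator_of_notMem (s := Set.Ioi (0 : ℝ)) hy]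
    refine (lintegral_congr fun p => ?_).trans lintegral_zero
    exact Set.indicator_of_notMem (fun h => hy (consPair_mem_upperCoord.1 h).1) _

end DeflatedIntegrals

/-! ### The induction on the numbers of real eigenvalues and conjugate pairs. -/

section JointDensity

attribute [local instance] matrixMeasureSpace matrix_borelSpace matrix_isAddHaarMeasure
  matrix_sigmaFinite matrix_secondCountable isAddHaarMeasure_pi_pi_pi isAddHaarMeasure_seq isAddHaarMeasure_seq_prod

open Polynomial (aeval)

variable {k K n r : ℕ}

theorem seqWeight_ne_top {α : Type*} [Fintype α] [DecidableEq α] {m : ℕ}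
    (X : Fin m → Matrix α α ℝ) : seqWeight X ≠ ∞ :=
  ENNReal.prod_ne_top fun _ _ => ENNReal.ofReal_ne_top

/-- The joint eigenvalue density of a product of `r + 1` Gaussian `n × n` matrices with `k` real
eigenvalues and `K` pairs of non-real eigenvalues is `jointDensity (r + 1) n k K`. -/
def HasJointDensity (r n k K : ℕ) : Prop :=
  ∀ h : (ℕ → ℝ) → ℝ≥0∞, Measurable h →
    ∫⁻ X : Fin (r + 1) → Matrix (Fin n) (Fin n) ℝ,
        (eigRange k K).indicator h (List.ofFn X).prod.charEval * seqWeight X =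
      (ENNReal.ofReal (Real.sqrt (2 * Real.pi)) ^ (n * n)) ^ (r + 1) *
        ∫⁻ p in upperCoord k K, jointDensity (r + 1) n k K p * h p.eval

theorem measurable_mul_sequence {E : Type*} [MeasurableSpace E] {g : E → ℕ → ℝ} (hg : Measurable g)
    {e : E → ℕ → ℝ} (he : Measurable e) {h : (ℕ → ℝ) → ℝ≥0∞} (hh : Measurable h) :
    Measurable fun x => h (g x * e x) := by
  have h1 : Measurable fun x => g x * e x :=
    measurable_pi_iff.2 fun j => ((measurable_pi_apply j).comp hg).mul ((measurable_pi_apply j).comp he)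
  have h2 := hh.comp h1
  exact h2

theorem measurable_lagrangeEval_comp (n : ℕ) {E : Type*} [MeasurableSpace E] {z : E → ℂ}
    (hz : Measurable z) {e : E → ℕ → ℝ} (he : Measurable e) :
    Measurable fun x => lagrangeEval n (z x) (e x) := by
  have h := (continuous_lagrangeEval n).measurable.comp (hz.prodMk he)
  exact h

theorem measurable_eval : Measurable (EigCoord.eval : EigCoord k K → ℕ → ℝ) :=
  EigCoord.continuous_eval.measurable

theorem hasJointDensity_zero (r : ℕ) : HasJointDensity r 0 0 0 := by
  intro h hh
  let q : EigCoord 0 0 := (Fin.elim0, Fin.elim0)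
  have hq : ∀ p : EigCoord 0 0, p = q := fun p => Subsingleton.elim _ _
  have hup : upperCoord 0 0 = Set.univ := Set.eq_univ_of_forall fun p j => j.elim0
  have he : q.eval = 1 := by
    funext j
    simp [EigCoord.eval, EigCoord.poly]
  have h1 : ∀ X : Fin (r + 1) → Matrix (Fin 0) (Fin 0) ℝ,
      (eigRange 0 0).indicator h (List.ofFn X).prod.charEval * seqWeight X = h 1 := fun X => by
    have hce : (List.ofFn X).prod.charEval = 1 := by
      funext j
      simp [Matrix.charEval, Matrix.charpoly]
    have hmem : (1 : ℕ → ℝ) ∈ eigRange 0 0 := ⟨q, by rw [hup]; trivial, he⟩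
    rw [hce, Set.indicator_of_mem hmem]
    simp [seqWeight, gaussWeight, Matrix.frobSq]
  have h2 : ∀ p : EigCoord 0 0, jointDensity (r + 1) 0 0 0 p * h p.eval = h 1 := fun p => by
    rw [hq p, he]
    simp [jointDensity, ginibreZ, vandermondeProd]
  have hv : (volume : Measure (Fin (r + 1) → Fin 0 → Fin 0 → ℝ)) Set.univ = 1 := by
    simp [volume_pi, Measure.pi_univ]
  have hv' : (volume : Measure (EigCoord 0 0)) Set.univ = 1 := by
    rw [Measure.volume_eq_prod, ← Set.univ_prod_univ, Measure.prod_prod]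
    simp [volume_pi, Measure.pi_univ]
  simp_rw [h1, h2]
  rw [hup, Measure.restrict_univ, lintegral_const, lintegral_const, hv', mul_zero, pow_zero, one_pow,
    one_mul]
  congr 1

/-- For a fixed value `t` of the 1 × 1 product, the induction hypothesis is applied to the
observable `w t`, which contains the Jacobian. Integration over `t` then uses the density
`realWeight`, and the multiplicity `k + 1` is cancelled at the end. -/
theorem hasJointDensity_real (hn : n = k + 2 * K) (hyp : HasJointDensity r n k K) :
    HasJointDensity r (n + 1) (k + 1) K := by
  intro h hh
  set g := (eigRange (k + 1) K).indicator h with hg_def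
  have hg : Measurable g := hh.indicator measurableSet_eigRange
  -- Almost surely the roots are simple, so the number of distinct real roots is the number of real
  -- coordinates.
  have hc : ∀ᵐ X : Fin (r + 1) → Matrix (Fin 1 ⊕ Fin n) (Fin 1 ⊕ Fin n) ℝ,
      g (List.ofFn X).prod.charEval ≠ 0 →
      (invariantGraphs {G | (List.ofFn G).prod ∈ (Set.univ : Set (Matrix (Fin 1) (Fin 1) ℝ))}
        X).encard = (k + 1 : ℕ) := by
    filter_upwards [ae_encard_invariantGraphs_one n r,
      ae_det_aeval_derivative_ne_zero (α := Fin 1 ⊕ Fin n) r] with X h1 h2 hne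
    have hmem : (List.ofFn X).prod.charEval ∈ eigRange (k + 1) K := by
      by_contra hmem
      exact hne (Set.indicator_of_notMem hmem _)
    obtain ⟨p, hp, hpoly⟩ := charEval_mem_eigRange.1 hmem
    have h3 := Matrix.nodup_roots_charpoly h2
    rw [hpoly] at h1 h3
    exact h1.trans (p.encard_real_roots hp h3)
  have hdefl := lintegral_deflation MeasurableSet.univ
    (fun _ _ _ => ⟨fun _ => trivial, fun _ => trivial⟩) hg hc
  rw [lintegral_charEval_reindex (finSumFinEquiv.trans (finCongr (add_comm 1 n))) hg] at hdefl
  let w : ℝ → (ℕ → ℝ) → ℝ≥0∞ := fun t e =>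
    ENNReal.ofReal ‖lagrangeEval n t e‖ * h ((fun j : ℕ => (j : ℝ) - t) * e)
  have hw : ∀ {E : Type} [MeasurableSpace E] {t : E → ℝ} {e : E → ℕ → ℝ}, Measurable t →
      Measurable e → Measurable fun x => w (t x) (e x) := by
    intro E _ t e ht he
    refine Measurable.mul (ENNReal.measurable_ofReal.comp (measurable_lagrangeEval_comp n
      (Complex.measurable_ofReal.comp ht) he).norm) (measurable_mul_sequence
      (measurable_pi_iff.2 fun j => measurable_const.sub ht) he hh)
  let Φ : ℝ → ℝ≥0∞ := fun t => ∫⁻ p in upperCoord k K, jointDensity (r + 1) n k K p * w t p.eval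
  have hΦ : Measurable Φ := by
    have h1 : Measurable fun x : ℝ × EigCoord k K =>
        jointDensity (r + 1) n k K x.2 * w x.1 x.2.eval :=
      ((measurable_jointDensity _ _ _ _).comp measurable_snd).mul
        (hw measurable_fst (measurable_eval.comp measurable_snd))
    exact h1.lintegral_prod_right'
  set cn := (ENNReal.ofReal (Real.sqrt (2 * Real.pi)) ^ (n * n)) ^ (r + 1) with hcn
  have hinner : ∀ G : Fin (r + 1) → Matrix (Fin 1) (Fin 1) ℝ,
      ∫⁻ X : Fin (r + 1) → Matrix (Fin n) (Fin n) ℝ, deflationKernel Set.univ g (List.ofFn G).prod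
        (List.ofFn X).prod * seqWeight G * seqWeight X =
      seqWeight G * (fun M : Matrix (Fin 1) (Fin 1) ℝ => cn * Φ (M 0 0)) (List.ofFn G).prod := by
    intro G
    set t := (List.ofFn G).prod 0 0 with ht
    have hG : (List.ofFn G).prod = !![t] := by
      ext i j
      fin_cases i; fin_cases j
      rfl
    simp only
    rw [← ht, ← hyp (w t) (hw measurable_const measurable_id),
      ← lintegral_const_mul' _ _ (seqWeight_ne_top G)]
    refine lintegral_congr fun X => ?_
    rw [hG, deflationKernel_one, Fintype.card_fin, mul_right_comm, mul_comm (seqWeight G)]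
    congr 2
    classical
    rw [hg_def, Set.indicator_apply, Set.indicator_apply]
    by_cases hmem : (List.ofFn X).prod.charEval ∈ eigRange k K
    · rw [if_pos hmem, if_pos (linear_mul_charEval_mem_eigRange.2 hmem)]
    · rw [if_neg hmem, if_neg fun h => hmem (linear_mul_charEval_mem_eigRange.1 h), mul_zero]
  simp_rw [hinner] at hdefl
  have hΦ' : Measurable fun M : Matrix (Fin 1) (Fin 1) ℝ => cn * Φ (M 0 0) := by
    have h1 : Measurable fun M : Matrix (Fin 1) (Fin 1) ℝ => M 0 0 :=
      Continuous.measurable (by fun_prop)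
    exact (hΦ.comp h1).const_mul _
  rw [lintegral_seqWeight_matrix_one hΦ'] at hdefl
  have hrhs : ∫⁻ t : ℝ, realWeight (r + 1) t * (cn * Φ t) =
      cn * ((ENNReal.ofReal (k + 1) * ENNReal.ofReal (gaussMoment n) ^ (r + 1)) *
        ∫⁻ p in upperCoord (k + 1) K, jointDensity (r + 1) (n + 1) (k + 1) K p * h p.eval) := by
    have hjm : Measurable fun p : EigCoord (k + 1) K =>
        jointDensity (r + 1) (n + 1) (k + 1) K p * h p.eval :=
      (measurable_jointDensity _ _ _ _).mul (hh.comp measurable_eval)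
    rw [lintegral_upperCoord_consReal hjm, ← lintegral_const_mul' _ _ (by finiteness),
      ← lintegral_const_mul' _ _ (by finiteness)]
    refine lintegral_congr fun t => ?_
    have hjm' : Measurable fun p : EigCoord k K => jointDensity (r + 1) n k K p * w t p.eval :=
      (measurable_jointDensity _ _ _ _).mul (hw measurable_const measurable_eval)
    rw [mul_left_comm]
    congr 1
    rw [← lintegral_const_mul _ hjm', ← lintegral_const_mul' _ _ (by finiteness)]
    refine lintegral_congr fun p => ?_
    have h1 := jointDensity_consReal (r := r + 1) (N := n) t p
    have h2 : aeval (t : ℂ) p.poly = ((p.poly.eval t : ℝ) : ℂ) := Polynomial.aeval_ofReal _ t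
    have h3 : w t p.eval = ENNReal.ofReal |p.poly.eval t| * h (p.consReal t).eval := by
      simp only [w]
      rw [hn, p.lagrangeEval_eval, h2, Complex.norm_real, Real.norm_eq_abs, EigCoord.eval_consReal]
    calc realWeight (r + 1) t * (jointDensity (r + 1) n k K p * w t p.eval)
        = (ENNReal.ofReal |p.poly.eval t| * realWeight (r + 1) t * jointDensity (r + 1) n k K p) *
            h (p.consReal t).eval := by rw [h3]; ring
      _ = _ := by rw [← h1]; ring
  have hsimp : ∀ t : ℝ, (!![t] : Matrix (Fin 1) (Fin 1) ℝ) 0 0 = t := fun t => rfl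
  simp only [hsimp] at hdefl
  rw [hrhs] at hdefl
  have hk0 : (((k + 1 : ℕ)) : ℝ≥0∞) ≠ 0 := by simp
  have hkt : (((k + 1 : ℕ)) : ℝ≥0∞) ≠ ∞ := by simp
  have hk : ENNReal.ofReal ((k : ℝ) + 1) = ((k + 1 : ℕ) : ℝ≥0∞) := by
    rw [← ENNReal.ofReal_natCast]; simp
  rw [← (ENNReal.mul_right_inj hk0 hkt), hdefl, ← deflationConst_one n, hcn, hk]
  ring

/-- The pattern is that of `hasJointDensity_real`, with multiplicity `K + 1`. The observable depends
on the 2 × 2 product only through its eigenvalue `x + i y`, so `lintegral_nonrealTwo` integrates out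
the rest. -/
theorem hasJointDensity_pair (hn : n = k + 2 * K) (hyp : HasJointDensity r n k K) :
    HasJointDensity r (n + 2) k (K + 1) := by
  intro h hh
  set g := (eigRange k (K + 1)).indicator h with hg_def
  have hg : Measurable g := hh.indicator measurableSet_eigRange
  have hc : ∀ᵐ X : Fin (r + 1) → Matrix (Fin 2 ⊕ Fin n) (Fin 2 ⊕ Fin n) ℝ,
      g (List.ofFn X).prod.charEval ≠ 0 →
      (invariantGraphs {G | (List.ofFn G).prod ∈ nonrealTwo} X).encard = (K + 1 : ℕ) := by
    filter_upwards [ae_encard_invariantGraphs_two n r,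
      ae_det_aeval_derivative_ne_zero (α := Fin 2 ⊕ Fin n) r] with X h1 h2 hne
    have hmem : (List.ofFn X).prod.charEval ∈ eigRange k (K + 1) := by
      by_contra hmem
      exact hne (Set.indicator_of_notMem hmem _)
    obtain ⟨p, hp, hpoly⟩ := charEval_mem_eigRange.1 hmem
    have h3 := Matrix.nodup_roots_charpoly h2
    rw [hpoly] at h1 h3
    exact h1.trans (p.encard_upper_roots hp h3)
  have hdefl := lintegral_deflation measurableSet_nonrealTwo
    (fun g G hg => nonrealTwo_conj g G hg) hg hc
  rw [lintegral_charEval_reindex (finSumFinEquiv.trans (finCongr (add_comm 2 n))) hg] at hdefl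
  let w : ℝ → ℝ → (ℕ → ℝ) → ℝ≥0∞ := fun x y e =>
    ENNReal.ofReal (Complex.normSq (lagrangeEval n (x + y * Complex.I) e)) *
      h ((fun j : ℕ => ((j : ℝ) - x) ^ 2 + y ^ 2) * e)
  have hw : ∀ {E : Type} [MeasurableSpace E] {x y : E → ℝ} {e : E → ℕ → ℝ}, Measurable x →
      Measurable y → Measurable e → Measurable fun a => w (x a) (y a) (e a) := by
    intro E _ x y e hx hy he
    refine Measurable.mul (ENNReal.measurable_ofReal.comp (Complex.continuous_normSq.measurable.comp
      (measurable_lagrangeEval_comp n ((Complex.measurable_ofReal.comp hx).add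
        ((Complex.measurable_ofReal.comp hy).mul_const _)) he))) (measurable_mul_sequence
      (measurable_pi_iff.2 fun j => ((measurable_const.sub hx).pow_const 2).add (hy.pow_const 2)) he hh)
  let F : ℝ → ℝ → ℝ≥0∞ := fun x y =>
    ∫⁻ p in upperCoord k K, jointDensity (r + 1) n k K p * w x y p.eval
  have hF : Measurable (Function.uncurry F) := by
    have h1 : Measurable fun x : (ℝ × ℝ) × EigCoord k K =>
        jointDensity (r + 1) n k K x.2 * w x.1.1 x.1.2 x.2.eval :=
      ((measurable_jointDensity _ _ _ _).comp measurable_snd).mul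
        (hw (measurable_fst.comp measurable_fst) (measurable_snd.comp measurable_fst)
          (measurable_eval.comp measurable_snd))
    exact h1.lintegral_prod_right'
  set cn := (ENNReal.ofReal (Real.sqrt (2 * Real.pi)) ^ (n * n)) ^ (r + 1) with hcn
  let Φ : Matrix (Fin 2) (Fin 2) ℝ → ℝ≥0∞ := nonrealTwo.indicator fun G =>
    F (G.trace / 2) (Real.sqrt (4 * G.det - G.trace ^ 2) / 2)
  have hΦ : Measurable Φ := by
    refine Measurable.indicator ?_ measurableSet_nonrealTwo
    have h1 : Measurable fun G : Matrix (Fin 2) (Fin 2) ℝ =>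
        (G.trace / 2, Real.sqrt (4 * G.det - G.trace ^ 2) / 2) :=
      Continuous.measurable (by fun_prop)
    have h := hF.comp h1
    exact h
  have hinner : ∀ G : Fin (r + 1) → Matrix (Fin 2) (Fin 2) ℝ,
      ∫⁻ X : Fin (r + 1) → Matrix (Fin n) (Fin n) ℝ, deflationKernel nonrealTwo g (List.ofFn G).prod
        (List.ofFn X).prod * seqWeight G * seqWeight X =
      seqWeight G * (fun M => cn * Φ M) (List.ofFn G).prod := by
    intro G
    simp_rw [deflationKernel_two, Fintype.card_fin]
    set M := (List.ofFn G).prod with hM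
    by_cases hmemM : M ∈ nonrealTwo
    · have hy : 0 < Real.sqrt (4 * M.det - M.trace ^ 2) / 2 :=
        half_pos (Real.sqrt_pos.2 (sub_pos.2 hmemM))
      simp only [Φ, Set.indicator_of_mem hmemM]
      set x := M.trace / 2
      set y := Real.sqrt (4 * M.det - M.trace ^ 2) / 2
      rw [← hyp (w x y) (hw measurable_const measurable_const measurable_id),
        ← lintegral_const_mul' _ _ (seqWeight_ne_top G)]
      refine lintegral_congr fun X => ?_
      rw [mul_right_comm, mul_comm (seqWeight G)]
      congr 2
      classical
      rw [hg_def, Set.indicator_apply, Set.indicator_apply]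
      by_cases hmem : (List.ofFn X).prod.charEval ∈ eigRange k K
      · rw [if_pos hmem, if_pos ((quadratic_mul_charEval_mem_eigRange hy).2 hmem)]
      · rw [if_neg hmem, if_neg fun h => hmem ((quadratic_mul_charEval_mem_eigRange hy).1 h), mul_zero]
    · simp only [Φ, Set.indicator_of_notMem hmemM, mul_zero, zero_mul, lintegral_zero]
  simp_rw [hinner] at hdefl
  rw [lintegral_seqWeight_matrix_two (hΦ.const_mul cn)] at hdefl
  have hrhs : ∫⁻ G : Matrix (Fin 2) (Fin 2) ℝ, matrixWeight (r + 1) G * (cn * Φ G) =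
      cn * ((ENNReal.ofReal (K + 1) * (ENNReal.ofReal (gaussMoment n) *
          ENNReal.ofReal (gaussMoment (n + 1))) ^ (r + 1)) *
        ∫⁻ p in upperCoord k (K + 1), jointDensity (r + 1) (n + 2) k (K + 1) p * h p.eval) := by
    have hjm : Measurable fun p : EigCoord k (K + 1) =>
        jointDensity (r + 1) (n + 2) k (K + 1) p * h p.eval :=
      (measurable_jointDensity _ _ _ _).mul (hh.comp measurable_eval)
    have h1 : ∀ G : Matrix (Fin 2) (Fin 2) ℝ, matrixWeight (r + 1) G * (cn * Φ G) =
        cn * nonrealTwo.indicator (fun G => matrixWeight (r + 1) G *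
          F (G.trace / 2) (Real.sqrt (4 * G.det - G.trace ^ 2) / 2)) G := fun G => by
      rw [mul_left_comm, Set.indicator_mul_right]
    simp_rw [h1]
    rw [lintegral_const_mul' _ _ (by finiteness), lintegral_nonrealTwo hF,
      lintegral_upperCoord_consPair hjm]
    congr 1
    rw [← lintegral_const_mul' _ _ (by finiteness)]
    refine lintegral_congr fun x => ?_
    rw [← lintegral_const_mul' _ _ (by finiteness)]
    refine setLIntegral_congr_fun measurableSet_Ioi fun y hy => ?_
    have hy0 : (0 : ℝ) < y := hy
    have hjm' : Measurable fun p : EigCoord k K => jointDensity (r + 1) n k K p * w x y p.eval :=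
      (measurable_jointDensity _ _ _ _).mul (hw measurable_const measurable_const measurable_eval)
    rw [mul_comm, ← lintegral_const_mul _ hjm', ← lintegral_const_mul' _ _ (by finiteness)]
    refine lintegral_congr fun p => ?_
    have h2 := jointDensity_consPair (r := r + 1) (N := n) (w := (x, y)) hy0 p
    have h3 : w x y p.eval = ENNReal.ofReal (Complex.normSq (aeval ((x : ℂ) + y * Complex.I) p.poly)) *
        h (p.consPair (x, y)).eval := by
      simp only [w]
      rw [hn, p.lagrangeEval_eval, EigCoord.eval_consPair]
    calc ENNReal.ofReal (2 * y) * complexWeight (r + 1) x y *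
          (jointDensity (r + 1) n k K p * w x y p.eval)
        = (ENNReal.ofReal (Complex.normSq (aeval ((x : ℂ) + y * Complex.I) p.poly)) *
            (ENNReal.ofReal (2 * y) * complexWeight (r + 1) x y) * jointDensity (r + 1) n k K p) *
            h (p.consPair (x, y)).eval := by rw [h3]; ring
      _ = _ := by rw [← h2]; ring
  rw [hrhs] at hdefl
  have hK0 : (((K + 1 : ℕ)) : ℝ≥0∞) ≠ 0 := by simp
  have hKt : (((K + 1 : ℕ)) : ℝ≥0∞) ≠ ∞ := by simp
  have hK : ENNReal.ofReal ((K : ℝ) + 1) = ((K + 1 : ℕ) : ℝ≥0∞) := by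
    rw [← ENNReal.ofReal_natCast]; simp
  rw [← (ENNReal.mul_right_inj hK0 hKt), hdefl, ← deflationConst_two n, hcn, hK]
  ring

/-- The conjugate pairs are adjoined first, starting from size 0, and the real eigenvalues
afterwards. -/
theorem hasJointDensity (r k K : ℕ) : HasJointDensity r (k + 2 * K) k K := by
  induction k with
  | zero =>
    induction K with
    | zero => exact hasJointDensity_zero r
    | succ K ih => exact hasJointDensity_pair rfl ih
  | succ k ih =>
    have h := hasJointDensity_real rfl ih
    rwa [show k + 2 * K + 1 = k + 1 + 2 * K by ring] at h

end JointDensity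

/-! ### From Lebesgue integrals to independent Gaussian matrices. -/

section GaussianMatrices

attribute [local instance] matrixMeasureSpace matrix_borelSpace matrix_isAddHaarMeasure
  matrix_sigmaFinite matrix_secondCountable isAddHaarMeasure_pi_pi_pi isAddHaarMeasure_seq isAddHaarMeasure_seq_prod

theorem volume_preserving_uncurry (ι κ E : Type*) [Fintype ι] [Fintype κ] [MeasureSpace E]
    [SigmaFinite (volume : Measure E)] :
    MeasurePreserving fun (f : ι → κ → E) (q : ι × κ) => f q.1 q.2 := by
  have hm : Measurable fun (f : ι → κ → E) (q : ι × κ) => f q.1 q.2 := by fun_prop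
  refine ⟨hm, (Measure.pi_eq fun s hs => ?_).symm⟩
  rw [Measure.map_apply hm (MeasurableSet.univ_pi hs)]
  have hpre : (fun (f : ι → κ → E) (q : ι × κ) => f q.1 q.2) ⁻¹' Set.univ.pi s =
      Set.univ.pi fun i => Set.univ.pi fun j => s (i, j) := by
    ext f
    simp [Set.mem_pi]
  rw [hpre, volume_pi, Measure.pi_pi, Fintype.prod_prod_type]
  refine Finset.prod_congr rfl fun i _ => ?_
  rw [volume_pi, Measure.pi_pi]

theorem gaussianPDF_zero_one (x : ℝ) : gaussianPDF 0 1 x =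
    (ENNReal.ofReal (Real.sqrt (2 * Real.pi)))⁻¹ * ENNReal.ofReal (Real.exp (-x ^ 2 / 2)) := by
  have h : 0 < Real.sqrt (2 * Real.pi) := Real.sqrt_pos.2 (by positivity)
  rw [gaussianPDF, gaussianPDFReal, ← ENNReal.ofReal_inv_of_pos h,
    ← ENNReal.ofReal_mul (by positivity)]
  simp

variable {N m : ℕ} {Ω : Type*} [MeasurableSpace Ω] {P : Measure Ω} [IsProbabilityMeasure P]

theorem prod_gaussianPDF (X : Fin m → Matrix (Fin N) (Fin N) ℝ) :
    ∏ q : Fin m × Fin N × Fin N, gaussianPDF 0 1 (X q.1 q.2.1 q.2.2) =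
      ((ENNReal.ofReal (Real.sqrt (2 * Real.pi)))⁻¹ ^ (N * N)) ^ m * seqWeight X := by
  simp_rw [gaussianPDF_zero_one]
  rw [Finset.prod_mul_distrib, Finset.prod_const, Finset.card_univ, Fintype.card_prod,
    Fintype.card_prod, Fintype.card_fin, Fintype.card_fin, ← pow_mul, mul_comm m]
  congr 1
  rw [Fintype.prod_prod_type, seqWeight]
  refine Finset.prod_congr rfl fun l _ => ?_
  rw [Fintype.prod_prod_type, gaussWeight, Matrix.frobSq]
  rw [← Finset.sum_neg_distrib, Finset.sum_div, Real.exp_sum, ENNReal.ofReal_prod_of_nonneg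
    fun _ _ => (Real.exp_pos _).le]
  refine Finset.prod_congr rfl fun i _ => ?_
  rw [← Finset.sum_neg_distrib, Finset.sum_div, Real.exp_sum, ENNReal.ofReal_prod_of_nonneg
    fun _ _ => (Real.exp_pos _).le]

/-- The law of a sequence of independent standard Gaussian matrices. -/
theorem measure_gaussian_matrices {X : Fin m → Ω → Matrix (Fin N) (Fin N) ℝ}
    (hlaw : ∀ l i j, HasLaw (fun ω => X l ω i j) (gaussianReal 0 1) P)
    (hind : iIndepFun (fun (q : Fin m × Fin N × Fin N) ω => X q.1 ω q.2.1 q.2.2) P)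
    {S : Set (Fin m → Matrix (Fin N) (Fin N) ℝ)} (hS : MeasurableSet S) :
    P {ω | (fun l => X l ω) ∈ S} = ((ENNReal.ofReal (Real.sqrt (2 * Real.pi)))⁻¹ ^ (N * N)) ^ m *
      ∫⁻ Y, S.indicator (fun _ => 1) Y * seqWeight Y := by
  have hae : ∀ q : Fin m × Fin N × Fin N, AEMeasurable (fun ω => X q.1 ω q.2.1 q.2.2) P :=
    fun q => (hlaw q.1 q.2.1 q.2.2).aemeasurable
  have hmap := (iIndepFun_iff_map_fun_eq_pi_map hae).1 hind
  have hmarg : ∀ q : Fin m × Fin N × Fin N, P.map (fun ω => X q.1 ω q.2.1 q.2.2) =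
      volume.withDensity (gaussianPDF 0 1) := fun q => by
    rw [(hlaw q.1 q.2.1 q.2.2).map_eq, gaussianReal_of_var_ne_zero _ one_ne_zero]
  simp_rw [hmarg] at hmap
  have hfin : IsProbabilityMeasure ((volume : Measure ℝ).withDensity (gaussianPDF 0 1)) := by
    rw [← gaussianReal_of_var_ne_zero _ one_ne_zero]
    infer_instance
  rw [pi_withDensity (measurable_gaussianPDF 0 1)] at hmap
  let c : (Fin m × Fin N × Fin N → ℝ) → Fin m → Matrix (Fin N) (Fin N) ℝ :=
    fun v l => Matrix.of fun i j => v (l, i, j)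
  have hc : Measurable c := by
    have : Measurable fun (v : Fin m × Fin N × Fin N → ℝ) (l : Fin m) (i j : Fin N) =>
      v (l, i, j) := by fun_prop
    exact this
  have hSc : MeasurableSet (c ⁻¹' S) := hc hS
  have h1 : P {ω | (fun l => X l ω) ∈ S} =
      P.map (fun ω (q : Fin m × Fin N × Fin N) => X q.1 ω q.2.1 q.2.2) (c ⁻¹' S) := by
    rw [Measure.map_apply_of_aemeasurable (aemeasurable_pi_iff.2 hae) hSc]
    rfl
  have hu : MeasurePreserving
      fun (Y : Fin m → Matrix (Fin N) (Fin N) ℝ) (q : Fin m × Fin N × Fin N) => Y q.1 q.2.1 q.2.2 := by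
    have h2 : MeasurePreserving fun (Y : Fin m → Fin N → Fin N → ℝ) (l : Fin m)
        (q : Fin N × Fin N) => Y l q.1 q.2 :=
      volume_preserving_pi fun _ => volume_preserving_uncurry (Fin N) (Fin N) ℝ
    exact (volume_preserving_uncurry (Fin m) (Fin N × Fin N) ℝ).comp h2
  have hd : Measurable fun v : Fin m × Fin N × Fin N → ℝ => ∏ q, gaussianPDF 0 1 (v q) :=
    Finset.measurable_fun_prod _ fun q _ => (measurable_gaussianPDF 0 1).comp (measurable_pi_apply q)
  rw [h1, hmap, withDensity_apply _ hSc, ← lintegral_indicator hSc]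
  change ∫⁻ v : Fin m × Fin N × Fin N → ℝ, (c ⁻¹' S).indicator
    (fun v => ∏ q, gaussianPDF 0 1 (v q)) v = _
  rw [← hu.lintegral_comp (hd.indicator hSc), ← lintegral_const_mul' _ _ (by
    refine ENNReal.pow_ne_top (ENNReal.pow_ne_top (ENNReal.inv_ne_top.2 ?_))
    exact (ENNReal.ofReal_pos.2 (Real.sqrt_pos.2 (by positivity))).ne')]
  refine lintegral_congr fun Y => ?_
  classical
  rw [Set.indicator_apply, Set.indicator_apply]
  have h3 : (fun q : Fin m × Fin N × Fin N => Y q.1 q.2.1 q.2.2) ∈ c ⁻¹' S ↔ Y ∈ S := Iff.rfl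
  by_cases hY : Y ∈ S
  · rw [if_pos (h3.2 hY), if_pos hY, one_mul, prod_gaussianPDF]
  · rw [if_neg fun h => hY (h3.1 h), if_neg hY, zero_mul, mul_zero]

/-- By label invariance the event depends only on `charEval` of the product, so `HasJointDensity` is
applied to the indicator of a set of sequences. The Gaussian normalisation cancels the powers of
`√(2π)`. -/
theorem measure_isEigCoord {r k K : ℕ} (hN : N = k + 2 * K)
    {X : Fin (r + 1) → Ω → Matrix (Fin N) (Fin N) ℝ}
    (hlaw : ∀ l i j, HasLaw (fun ω => X l ω i j) (gaussianReal 0 1) P)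
    (hind : iIndepFun (fun (q : Fin (r + 1) × Fin N × Fin N) ω => X q.1 ω q.2.1 q.2.2) P)
    {B : Set (EigCoord k K)} (hB : MeasurableSet B) (hinv : LabelInvariant B) :
    P {ω | ∃ p ∈ B, IsEigCoord (List.ofFn fun l => X l ω).prod p} =
      ∫⁻ p in B ∩ upperCoord k K, jointDensity (r + 1) N k K p := by
  subst hN
  set D := EigCoord.eval '' (B ∩ upperCoord k K) with hD_def
  have hD : MeasurableSet D := measurableSet_eval_image hB hinv
  let S : Set (Fin (r + 1) → Matrix (Fin (k + 2 * K)) (Fin (k + 2 * K)) ℝ) :=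
    {Y | (List.ofFn Y).prod.charEval ∈ D}
  have hS : MeasurableSet S := by
    have h := measurable_charEval.comp (continuous_ofFn_prod (ι := Fin (k + 2 * K)) (r + 1)).measurable
    exact h hD
  have hset : {ω | ∃ p ∈ B, IsEigCoord (List.ofFn fun l => X l ω).prod p} =
      {ω | (fun l => X l ω) ∈ S} := by
    ext ω
    simp only [Set.mem_ofPred_eq, S, hD_def, Set.mem_image, isEigCoord_iff,
      eq_comm (b := Matrix.charEval _), charEval_eq_iff]
    constructor
    · rintro ⟨p, hpB, hpu, h⟩
      exact ⟨p, ⟨hpB, hpu⟩, h⟩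
    · rintro ⟨p, ⟨hpB, hpu⟩, h⟩
      exact ⟨p, hpB, hpu, h⟩
  have hjoint := hasJointDensity r k K (D.indicator fun _ => 1) (measurable_const.indicator hD)
  have hind1 : (eigRange k K).indicator (D.indicator fun _ => (1 : ℝ≥0∞)) = D.indicator fun _ => 1 := by
    have hsub : D ⊆ eigRange k K := Set.image_mono Set.inter_subset_right
    rw [Set.indicator_indicator, Set.inter_eq_right.2 hsub]
  rw [hind1] at hjoint
  have hint : ∫⁻ p in upperCoord k K, jointDensity (r + 1) (k + 2 * K) k K p *
      D.indicator (fun _ => 1) p.eval =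
      ∫⁻ p in B ∩ upperCoord k K, jointDensity (r + 1) (k + 2 * K) k K p := by
    rw [← Measure.restrict_restrict hB, ← lintegral_indicator hB]
    refine setLIntegral_congr_fun isOpen_upperCoord.measurableSet fun p hp => ?_
    classical
    rw [Set.indicator_apply, Set.indicator_apply]
    by_cases h : p ∈ B
    · rw [if_pos h, if_pos ((EigCoord.eval_mem_image_iff hinv hp).2 h), mul_one]
    · rw [if_neg h, if_neg fun h' => h ((EigCoord.eval_mem_image_iff hinv hp).1 h'), mul_zero]
  rw [hset, measure_gaussian_matrices hlaw hind hS]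
  have hconv : ∀ Y : Fin (r + 1) → Matrix (Fin (k + 2 * K)) (Fin (k + 2 * K)) ℝ,
      S.indicator (fun _ => (1 : ℝ≥0∞)) Y = D.indicator (fun _ => 1) (List.ofFn Y).prod.charEval :=
    fun Y => rfl
  simp_rw [hconv]
  have hpos : ENNReal.ofReal (Real.sqrt (2 * Real.pi)) ≠ 0 :=
    (ENNReal.ofReal_pos.2 (Real.sqrt_pos.2 (by positivity))).ne'
  rw [hjoint, hint, ← mul_assoc, ← mul_pow, ← mul_pow,
    ENNReal.inv_mul_cancel hpos ENNReal.ofReal_ne_top, one_pow, one_pow, one_mul]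

end GaussianMatrices

/-! ### The real weight as a Meijer G-function. -/

section MellinBarnes

open Complex (I)

theorem norm_Gamma_le {s : ℂ} (hs : 0 < s.re) : ‖Complex.Gamma s‖ ≤ Real.Gamma s.re := by
  rw [Complex.Gamma_eq_integral hs, Real.Gamma_eq_integral hs, Complex.GammaIntegral]
  refine (norm_integral_le_integral_norm _).trans (le_of_eq ?_)
  refine setIntegral_congr_fun measurableSet_Ioi fun x hx => ?_
  have hx0 : (0 : ℝ) < x := hx
  rw [norm_mul, Complex.norm_real, Real.norm_of_nonneg (Real.exp_pos _).le,
    Complex.norm_cpow_eq_rpow_re_of_pos hx0]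
  simp

theorem continuous_Gamma_vertical {σ : ℝ} (hσ : 0 < σ) :
    Continuous fun u : ℝ => Complex.Gamma (σ + u * I) := by
  refine continuous_iff_continuousAt.2 fun u => ?_
  have h1 : ContinuousAt Complex.Gamma (σ + u * I) := by
    refine (Complex.differentiableAt_Gamma _ fun m h => ?_).continuousAt
    have := congrArg Complex.re h
    simp at this
    have hm : (0 : ℝ) ≤ m := Nat.cast_nonneg m
    linarith
  have h2 : Continuous fun u : ℝ => (σ + u * I : ℂ) := by fun_prop
  exact ContinuousAt.comp (f := fun u : ℝ => (σ + u * I : ℂ)) h1 h2.continuousAt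

/-- Applying the functional equation twice, together with the bound of `|Γ(s + 2)|` by its value on
the real axis, gives quadratic decay. -/
theorem integrable_Gamma_vertical {σ : ℝ} (hσ : 0 < σ) :
    Integrable fun u : ℝ => Complex.Gamma (σ + u * I) := by
  have hb : Integrable fun u : ℝ => Real.Gamma (σ + 2) / σ ^ 2 * (1 + (u / σ) ^ 2)⁻¹ :=
    (integrable_inv_one_add_sq.comp_div hσ.ne').const_mul _
  refine hb.mono' (continuous_Gamma_vertical hσ).aestronglyMeasurable
    (Filter.Eventually.of_forall fun u => ?_)
  set s : ℂ := σ + u * I with hs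
  have hre : s.re = σ := by simp [hs]
  have hs0 : s ≠ 0 := fun h => by rw [h] at hre; simp at hre; linarith
  have hs1 : s + 1 ≠ 0 := fun h => by
    have := congrArg Complex.re h
    rw [Complex.add_re, hre] at this
    simp at this
    linarith
  have hG : Complex.Gamma (s + 1 + 1) = (s + 1) * (s * Complex.Gamma s) := by
    rw [Complex.Gamma_add_one _ hs1, Complex.Gamma_add_one _ hs0]
  have hn : ‖s‖ ^ 2 = σ ^ 2 + u ^ 2 := by
    rw [← Complex.normSq_eq_norm_sq, Complex.normSq_apply]
    simp [hs]
    ring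
  have hn1 : ‖s‖ ≤ ‖s + 1‖ := by
    rw [← sq_le_sq₀ (norm_nonneg _) (norm_nonneg _), ← Complex.normSq_eq_norm_sq,
      ← Complex.normSq_eq_norm_sq, Complex.normSq_apply, Complex.normSq_apply]
    simp [hs]
    nlinarith
  have hle := norm_Gamma_le (s := s + 1 + 1) (by simp [hre]; linarith)
  rw [hG, norm_mul, norm_mul] at hle
  have hre2 : (s + 1 + 1).re = σ + 2 := by simp [hre]; ring
  rw [hre2] at hle
  have hpos : 0 < σ ^ 2 + u ^ 2 := by positivity
  have h3 : (σ ^ 2 + u ^ 2) * ‖Complex.Gamma s‖ ≤ Real.Gamma (σ + 2) := by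
    rw [← hn, sq, mul_assoc]
    exact (mul_le_mul_of_nonneg_right hn1 (by positivity)).trans hle
  have h4 : Real.Gamma (σ + 2) / σ ^ 2 * (1 + (u / σ) ^ 2)⁻¹ = Real.Gamma (σ + 2) / (σ ^ 2 + u ^ 2) := by
    field_simp
  rw [h4, le_div_iff₀ hpos, mul_comm]
  exact h3

/-- Mellin inversion for the exponential function. -/
theorem integral_Gamma_mul_cpow {σ : ℝ} (hσ : 0 < σ) {z : ℝ} (hz : 0 < z) :
    ∫ u : ℝ, Complex.Gamma (σ + u * I) * (z : ℂ) ^ (-(σ + u * I)) =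
      2 * Real.pi * (Real.exp (-z) : ℂ) := by
  let f : ℝ → ℂ := fun x => (Real.exp (-x) : ℂ)
  have hmel : ∀ u : ℝ, mellin f (σ + u * I) = Complex.Gamma (σ + u * I) := fun u => by
    rw [Complex.Gamma_eq_integral (by simpa using hσ), Complex.GammaIntegral_eq_mellin]
  have hconv : MellinConvergent f σ := by
    have := Complex.GammaIntegral_convergent (s := (σ : ℂ)) (by simpa using hσ)
    refine this.congr_fun (fun x _ => ?_) measurableSet_Ioi
    simp [f, mul_comm]
  have hvert : Complex.VerticalIntegrable (mellin f) σ := by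
    refine (integrable_Gamma_vertical hσ).congr (Filter.Eventually.of_forall fun u => (hmel u).symm)
  have h := mellinInv_mellin_eq σ f hz hconv hvert (by fun_prop)
  rw [mellinInv] at h
  simp_rw [hmel, smul_eq_mul, mul_comm _ (Complex.Gamma _)] at h
  have h2 : (2 * Real.pi : ℂ) ≠ 0 := by simp [Real.pi_ne_zero]
  rw [show (Real.exp (-z) : ℂ) = f z from rfl, ← h]
  have h3 : (2 * Real.pi : ℂ) * ((1 / (2 * Real.pi) : ℝ) : ℂ) = 1 := by
    push_cast
    exact mul_one_div_cancel h2
  rw [Complex.real_smul, ← mul_assoc, h3, one_mul]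

/-- The integrand of the moment of order `2 s - 1` of the Gaussian weight. -/
noncomputable def gaussMellin (s : ℂ) (t : ℝ) : ℂ :=
  (Real.exp (-t ^ 2 / 2) : ℂ) * ((|t| : ℝ) : ℂ) ^ (2 * s - 1)

theorem measurable_gaussMellin : Measurable fun x : ℂ × ℝ => gaussMellin x.1 x.2 := by
  unfold gaussMellin
  fun_prop

theorem norm_gaussMellin (s : ℂ) {t : ℝ} (ht : t ≠ 0) :
    ‖gaussMellin s t‖ = Real.exp (-t ^ 2 / 2) * |t| ^ (2 * s.re - 1) := by
  rw [gaussMellin, norm_mul, Complex.norm_real, Real.norm_of_nonneg (Real.exp_pos _).le,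
    Complex.norm_cpow_eq_rpow_re_of_pos (abs_pos.2 ht)]
  simp

theorem integrable_comp_abs {E : Type*} [NormedAddCommGroup E] {f : ℝ → E}
    (hf : IntegrableOn f (Set.Ioi 0)) : Integrable fun x => f |x| := by
  have h1 : IntegrableOn (fun x => f |x|) (Set.Ioi 0) :=
    hf.congr_fun (fun x hx => by rw [abs_of_pos hx]) measurableSet_Ioi
  have h2 : IntegrableOn (fun x => f |x|) (Set.Iic 0) := by
    rw [← Measure.map_neg_eq_self (volume : Measure ℝ)]
    have m : MeasurableEmbedding fun x : ℝ => -x := (Homeomorph.neg ℝ).measurableEmbedding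
    rw [m.integrableOn_map_iff]
    simp_rw [Function.comp_def, abs_neg, Set.neg_preimage, Set.neg_Iic, neg_zero]
    exact Iff.mpr integrableOn_Ici_iff_integrableOn_Ioi h1
  rw [← integrableOn_univ, ← Set.Iic_union_Ioi (a := (0 : ℝ))]
  exact h2.union h1

theorem integral_comp_abs_eq {E : Type*} [NormedAddCommGroup E] [NormedSpace ℝ E] {f : ℝ → E}
    (hf : IntegrableOn f (Set.Ioi 0)) :
    ∫ x, f |x| = (∫ x in Set.Ioi (0 : ℝ), f x) + ∫ x in Set.Ioi (0 : ℝ), f x := by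
  have h := integrable_comp_abs hf
  have h1 : ∫ x in Set.Ioi (0 : ℝ), f |x| = ∫ x in Set.Ioi (0 : ℝ), f x :=
    setIntegral_congr_fun measurableSet_Ioi fun x hx => by rw [abs_of_pos hx]
  have h2 : ∫ x in Set.Iic (0 : ℝ), f |x| = ∫ x in Set.Ioi (0 : ℝ), f x := by
    rw [← h1, ← neg_zero, ← integral_comp_neg_Iic, neg_zero]
    simp_rw [abs_neg]
  rw [← setIntegral_univ, ← Set.Iic_union_Ioi (a := (0 : ℝ)),
    setIntegral_union (Set.Iic_disjoint_Ioi le_rfl) measurableSet_Ioi h.integrableOn h.integrableOn,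
    h1, h2]

theorem integrable_gaussMellin_norm {σ : ℝ} (hσ : 0 < σ) :
    Integrable fun t : ℝ => Real.exp (-t ^ 2 / 2) * |t| ^ (2 * σ - 1) := by
  have h := integrable_comp_abs (integrableOn_rpow_mul_exp_neg_mul_sq (b := 1 / 2) (by norm_num)
    (s := 2 * σ - 1) (by linarith))
  refine h.congr (Filter.Eventually.of_forall fun t => ?_)
  simp only
  rw [sq_abs, mul_comm]
  congr 2
  ring

/-- The two half-lines contribute equally, and the substitution `v = t²` gives a Gamma integral; the
factor 2 and the Jacobian 1/2 cancel. -/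
theorem integral_gaussMellin {s : ℂ} (hs : 0 < s.re) :
    ∫ t, gaussMellin s t = 2 ^ s * Complex.Gamma s := by
  let f : ℝ → ℂ := fun t => (Real.exp (-t ^ 2 / 2) : ℂ) * (t : ℂ) ^ (2 * s - 1)
  have hfm : Measurable f := by fun_prop
  have hf : IntegrableOn f (Set.Ioi 0) := by
    refine (integrable_gaussMellin_norm hs).integrableOn.mono' hfm.aestronglyMeasurable
      ((ae_restrict_iff' measurableSet_Ioi).2 (Filter.Eventually.of_forall fun t ht => ?_))
    have ht0 : (0 : ℝ) < t := ht
    rw [norm_mul, Complex.norm_real, Real.norm_of_nonneg (Real.exp_pos _).le,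
      Complex.norm_cpow_eq_rpow_re_of_pos ht0, abs_of_pos ht0]
    simp
  have h1 : ∀ t, gaussMellin s t = f |t| := fun t => by
    simp only [gaussMellin, f]
    rw [sq_abs]
  let g : ℝ → ℂ := fun v => Complex.exp (-(((1 / 2 : ℝ) : ℂ) * v))
  have h2 : ∫ t in Set.Ioi (0 : ℝ), f t = mellin (fun t => g (t ^ (2 : ℝ))) (2 * s) := by
    rw [mellin]
    refine setIntegral_congr_fun measurableSet_Ioi fun t ht => ?_
    simp only [f, g, smul_eq_mul, Real.rpow_two]
    rw [mul_comm]
    congr 1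
    push_cast
    congr 1
    ring
  have h3 : mellin g s = 2 ^ s * Complex.Gamma s := by
    have h := Complex.integral_cpow_mul_exp_neg_mul_Ioi hs (r := 1 / 2) (by norm_num)
    rw [mellin]
    simp only [g, smul_eq_mul]
    rw [h]
    norm_num
  simp_rw [h1]
  rw [integral_comp_abs_eq hf, h2, mellin_comp_rpow]
  have h4 : 2 * s / ((2 : ℝ) : ℂ) = s := by
    push_cast
    rw [mul_div_cancel_left₀ _ two_ne_zero]
  rw [h4, h3, ← two_smul ℝ, smul_smul, abs_two, mul_inv_cancel₀ two_ne_zero, one_smul]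

theorem ofReal_cpow_eq_exp {a : ℝ} (ha : 0 < a) (w : ℂ) :
    (a : ℂ) ^ w = Complex.exp (Real.log a * w) := by
  rw [Complex.cpow_def_of_ne_zero (by exact_mod_cast ha.ne'), Complex.ofReal_log ha.le]

theorem prod_ofReal_cpow {ι : Type*} (s : Finset ι) (a : ι → ℝ) (ha : ∀ i, 0 ≤ a i) (w : ℂ) :
    ∏ i ∈ s, (a i : ℂ) ^ w = ((∏ i ∈ s, a i : ℝ) : ℂ) ^ w := by
  classical
  induction s using Finset.induction_on with
  | empty => simp
  | insert i s hi ih =>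
    rw [Finset.prod_insert hi, Finset.prod_insert hi, ih, Complex.ofReal_mul,
      Complex.mul_cpow_ofReal_nonneg (ha i) (Finset.prod_nonneg fun i _ => ha i)]

variable {r : ℕ}

/-- The integrand of the real weight. -/
noncomputable def realWeightIntegrand (x : ℝ) (t : Fin r → ℝ) : ℝ :=
  (∏ l, Real.exp (-t l ^ 2 / 2)) * Real.exp (-(x / ∏ l, t l) ^ 2 / 2) * |∏ l, t l|⁻¹

theorem realWeight_eq_lintegral (x : ℝ) :
    realWeight (r + 1) x = ∫⁻ t : Fin r → ℝ, ENNReal.ofReal (realWeightIntegrand x t) := by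
  rw [realWeight]
  refine lintegral_congr_ae ((ae_prod_ne_zero r).mono fun t ht => ?_)
  have ht' : ∏ l, t l ≠ 0 := ht
  simp only [realWeightIntegrand, scalarGauss]
  rw [ENNReal.ofReal_mul (by positivity), ENNReal.ofReal_mul (by positivity),
    ENNReal.ofReal_prod_of_nonneg fun _ _ => (Real.exp_pos _).le,
    ENNReal.ofReal_inv_of_pos (abs_pos.2 ht')]
  rfl

/-- With `p` the product of the `t l`, the powers combine to `|p|⁻¹ (x² / (2p²))^(-s)`. The vertical
integral then restores the Gaussian weight at `x / p` of the eliminated factor. -/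
theorem integral_mellin_kernel_vertical {σ : ℝ} (hσ : 0 < σ) {x : ℝ} (hx : x ≠ 0) {t : Fin r → ℝ}
    (ht : ∏ l, t l ≠ 0) :
    ∫ u : ℝ, (∏ l, gaussMellin (σ + u * I) (t l)) *
        (Complex.Gamma (σ + u * I) * ((x ^ 2 / 2 : ℝ) : ℂ) ^ (-(σ + u * I))) =
      2 * Real.pi * (realWeightIntegrand x t : ℂ) := by
  set p := ∏ l, t l with hp
  have hz : 0 < x ^ 2 / 2 := by positivity
  have hp2 : 0 < p ^ 2 := by positivity
  have hpa : 0 < |p| := abs_pos.2 ht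
  have h1 : ∀ s : ℂ, (∏ l, gaussMellin s (t l)) * (Complex.Gamma s * ((x ^ 2 / 2 : ℝ) : ℂ) ^ (-s)) =
      ((∏ l, Real.exp (-t l ^ 2 / 2) : ℝ) : ℂ) * ((|p|⁻¹ : ℝ) : ℂ) *
        (Complex.Gamma s * ((x ^ 2 / 2 / p ^ 2 : ℝ) : ℂ) ^ (-s)) := fun s => by
    simp only [gaussMellin]
    rw [Finset.prod_mul_distrib, prod_ofReal_cpow _ _ (fun l => abs_nonneg _), ← Finset.abs_prod,
      ← hp, ofReal_cpow_eq_exp hpa, ofReal_cpow_eq_exp hz, ofReal_cpow_eq_exp (div_pos hz hp2),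
      Real.log_div hz.ne' hp2.ne', Real.log_pow, ← Real.log_abs p]
    have h2 : ((|p|⁻¹ : ℝ) : ℂ) = Complex.exp (-(Real.log |p| : ℂ)) := by
      rw [← Complex.ofReal_neg, ← Complex.ofReal_exp, Real.exp_neg, Real.exp_log hpa]
    rw [h2]
    push_cast
    have h3 : Complex.exp (Real.log |p| * (2 * s - 1)) * Complex.exp (Real.log (x ^ 2 / 2) * -s) =
        Complex.exp (-(Real.log |p| : ℂ)) *
          Complex.exp ((Real.log (x ^ 2 / 2) - 2 * Real.log |p|) * -s) := by
      rw [← Complex.exp_add, ← Complex.exp_add]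
      congr 1
      ring
    linear_combination (∏ l, Complex.exp (-(t l : ℂ) ^ 2 / 2)) * Complex.Gamma s * h3
  simp_rw [h1]
  rw [integral_const_mul, integral_Gamma_mul_cpow hσ (div_pos hz hp2), realWeightIntegrand, ← hp]
  have h4 : -(x ^ 2 / 2 / p ^ 2) = -(x / p) ^ 2 / 2 := by
    field_simp
  rw [h4]
  push_cast
  ring

/-- The norm of a power of a positive number depends only on the real part of the exponent, so
almost everywhere the norm of the kernel is a function of `t` times a function of `u`. -/
theorem integrable_mellin_kernel {σ : ℝ} (hσ : 0 < σ) {x : ℝ} (hx : x ≠ 0) :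
    Integrable fun y : (Fin r → ℝ) × ℝ => (∏ l, gaussMellin (σ + y.2 * I) (y.1 l)) *
      (Complex.Gamma (σ + y.2 * I) * ((x ^ 2 / 2 : ℝ) : ℂ) ^ (-(σ + y.2 * I))) := by
  have hz : 0 < x ^ 2 / 2 := by positivity
  have hb1 : Integrable fun t : Fin r → ℝ =>
      ∏ l, (Real.exp (-t l ^ 2 / 2) * |t l| ^ (2 * σ - 1)) :=
    Integrable.fintype_prod (f := fun _ (t : ℝ) => Real.exp (-t ^ 2 / 2) * |t| ^ (2 * σ - 1))
      fun _ => integrable_gaussMellin_norm hσ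
  have hb2 : Integrable fun u : ℝ => ‖Complex.Gamma (σ + u * I)‖ * (x ^ 2 / 2) ^ (-σ) :=
    (integrable_Gamma_vertical hσ).norm.mul_const _
  refine (hb1.mul_prod hb2).mono' ?_ ?_
  · refine AEStronglyMeasurable.mul ?_ ?_
    · refine (Finset.measurable_fun_prod _ fun l _ => ?_).aestronglyMeasurable
      have h1 : Measurable fun y : (Fin r → ℝ) × ℝ => ((σ + y.2 * I : ℂ), y.1 l) := by fun_prop
      have h2 := measurable_gaussMellin.comp h1
      exact h2
    · have h1 := (continuous_Gamma_vertical hσ).measurable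
      have h2 : Measurable fun u : ℝ => ((x ^ 2 / 2 : ℝ) : ℂ) ^ (-(σ + u * I)) := by fun_prop
      have h3 : Measurable fun y : (Fin r → ℝ) × ℝ => Complex.Gamma (σ + y.2 * I) *
          ((x ^ 2 / 2 : ℝ) : ℂ) ^ (-(σ + y.2 * I)) := by
        have h := (h1.mul h2).comp (measurable_snd : Measurable (Prod.snd : (Fin r → ℝ) × ℝ → ℝ))
        exact h
      exact h3.aestronglyMeasurable
  · have hae : ∀ᵐ y : (Fin r → ℝ) × ℝ, ∏ l, y.1 l ≠ 0 :=
      Measure.quasiMeasurePreserving_fst.ae (ae_prod_ne_zero r)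
    filter_upwards [hae] with y hy
    have hy' : ∀ l, y.1 l ≠ 0 := fun l h => hy (Finset.prod_eq_zero (Finset.mem_univ l) h)
    rw [norm_mul, norm_prod, norm_mul, Complex.norm_cpow_eq_rpow_re_of_pos hz]
    refine le_of_eq ?_
    congr 1
    · refine Finset.prod_congr rfl fun l _ => ?_
      rw [norm_gaussMellin _ (hy' l)]
      simp
    · simp

theorem integral_mellin_kernel {σ : ℝ} (hσ : 0 < σ) {x : ℝ} (hx : x ≠ 0) (u : ℝ) :
    ∫ t : Fin r → ℝ, (∏ l, gaussMellin (σ + u * I) (t l)) *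
        (Complex.Gamma (σ + u * I) * ((x ^ 2 / 2 : ℝ) : ℂ) ^ (-(σ + u * I))) =
      Complex.Gamma (σ + u * I) ^ (r + 1) *
        ((x ^ 2 / 2 ^ (r + 1) : ℝ) : ℂ) ^ (-(σ + u * I)) := by
  have hz : 0 < x ^ 2 / 2 := by positivity
  have hz' : 0 < x ^ 2 / 2 ^ (r + 1) := by positivity
  set s : ℂ := σ + u * I with hs
  have hre : 0 < s.re := by simpa [hs] using hσ
  rw [integral_mul_const, integral_fintype_prod_volume_eq_pow, integral_gaussMellin hre,
    Fintype.card_fin]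
  have h1 : (x ^ 2 / 2 : ℝ) = x ^ 2 / 2 ^ (r + 1) * 2 ^ r := by
    field_simp
    ring
  rw [ofReal_cpow_eq_exp hz, ofReal_cpow_eq_exp hz', h1, Real.log_mul hz'.ne' (by positivity),
    Real.log_pow]
  have h2 : (2 : ℂ) ^ s = Complex.exp (Real.log 2 * s) := by
    exact_mod_cast ofReal_cpow_eq_exp (a := 2) two_pos s
  rw [h2, mul_pow, ← Complex.exp_nat_mul]
  have h3 : Complex.exp (r * (Real.log 2 * s)) *
      Complex.exp (((Real.log (x ^ 2 / 2 ^ (r + 1)) + r * Real.log 2 : ℝ) : ℂ) * -s) =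
      Complex.exp (Real.log (x ^ 2 / 2 ^ (r + 1)) * -s) := by
    rw [← Complex.exp_add]
    congr 1
    push_cast
    ring
  linear_combination Complex.Gamma s ^ (r + 1) * h3

/-- The contour variable changes sign: the line with real part `c < 0` becomes the line with real
part `-c > 0` for the Gamma function. -/
theorem meijerIntegrand_eq (x c t : ℝ) :
    meijerIntegrand (r + 1) 0 (fun _ : Fin 0 => 0) (fun _ : Fin (r + 1) => 0)
      ((x ^ 2 / 2 ^ (r + 1) : ℝ) : ℂ) (c + t * I) =
    Complex.Gamma ((-c : ℝ) + (-t : ℝ) * I) ^ (r + 1) *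
        ((x ^ 2 / 2 ^ (r + 1) : ℝ) : ℂ) ^ (-((-c : ℝ) + (-t : ℝ) * I)) := by
  have h1 : (Finset.univ.filter fun j : Fin (r + 1) => j.1 < r + 1) = Finset.univ :=
    Finset.filter_true_of_mem fun j _ => j.2
  have h2 : (Finset.univ.filter fun j : Fin (r + 1) => r + 1 ≤ j.1) = ∅ :=
    Finset.filter_false_of_mem fun j _ => not_le.2 j.2
  have h3 : (0 : ℂ) - (c + t * I) = (-c : ℝ) + (-t : ℝ) * I := by push_cast; ring
  have h4 : -(((-c : ℝ) : ℂ) + (-t : ℝ) * I) = c + t * I := by push_cast; ring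
  rw [meijerIntegrand, h1, h2, h3, h4]
  simp

/-- The kernel is integrated in both orders: the vertical integral first gives the real weight, the
Gaussian integrals first give the Mellin-Barnes integral. Its joint integrability also yields the
finiteness and the absolute convergence. -/
theorem realWeight_meijerG {x : ℝ} (hx : x ≠ 0) {c : ℝ} (hc : c < 0) :
    realWeight (r + 1) x ≠ ∞ ∧
    Integrable (fun t : ℝ => meijerIntegrand (r + 1) 0 (fun _ : Fin 0 => 0)
      (fun _ : Fin (r + 1) => 0) ((x ^ 2 / 2 ^ (r + 1) : ℝ) : ℂ) (c + t * I)) ∧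
    meijerG (r + 1) 0 (fun _ : Fin 0 => 0) (fun _ : Fin (r + 1) => 0) c
      ((x ^ 2 / 2 ^ (r + 1) : ℝ) : ℂ) = ((realWeight (r + 1) x).toReal : ℂ) := by
  have hσ : 0 < -c := neg_pos.2 hc
  have hF := integrable_mellin_kernel (r := r) hσ hx
  rw [Measure.volume_eq_prod] at hF
  let H : ℝ → ℂ := fun u => Complex.Gamma ((-c : ℝ) + u * I) ^ (r + 1) *
        ((x ^ 2 / 2 ^ (r + 1) : ℝ) : ℂ) ^ (-((-c : ℝ) + u * I))
  have hH : Integrable H := by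
    refine hF.integral_prod_right.congr (Filter.Eventually.of_forall fun u => ?_)
    exact integral_mellin_kernel hσ hx u
  have h2pi : (2 * Real.pi : ℂ) ≠ 0 := by simp [Real.pi_ne_zero]
  have hJc : Integrable fun t : Fin r → ℝ => 2 * Real.pi * (realWeightIntegrand x t : ℂ) := by
    refine hF.integral_prod_left.congr ((ae_prod_ne_zero r).mono fun t ht => ?_)
    exact integral_mellin_kernel_vertical hσ hx ht
  have hJ : Integrable fun t : Fin r → ℝ => realWeightIntegrand x t := by
    have h := (hJc.const_mul (2 * Real.pi : ℂ)⁻¹).re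
    refine h.congr (Filter.Eventually.of_forall fun t => ?_)
    simp only [← mul_assoc, inv_mul_cancel₀ h2pi, one_mul]
    simp
  have hJ0 : ∀ t : Fin r → ℝ, 0 ≤ realWeightIntegrand x t := fun t => by
    rw [realWeightIntegrand]; positivity
  have hrw : realWeight (r + 1) x = ENNReal.ofReal (∫ t : Fin r → ℝ, realWeightIntegrand x t) := by
    rw [realWeight_eq_lintegral, ofReal_integral_eq_lintegral_ofReal hJ
      (Filter.Eventually.of_forall hJ0)]
  have hswap : ∫ u, H u = 2 * Real.pi * ((∫ t : Fin r → ℝ, realWeightIntegrand x t : ℝ) : ℂ) := by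
    have h1 := integral_integral_swap (f := fun (t : Fin r → ℝ) (u : ℝ) =>
      (∏ l, gaussMellin ((-c : ℝ) + u * I) (t l)) *
      (Complex.Gamma ((-c : ℝ) + u * I) * ((x ^ 2 / 2 : ℝ) : ℂ) ^ (-((-c : ℝ) + u * I)))) hF
    simp_rw [integral_mellin_kernel hσ hx] at h1
    rw [← h1, integral_congr_ae ((ae_prod_ne_zero r).mono fun t ht =>
      integral_mellin_kernel_vertical hσ hx ht), integral_const_mul, integral_complex_ofReal]
  refine ⟨by rw [hrw]; exact ENNReal.ofReal_ne_top, ?_, ?_⟩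
  · simp_rw [meijerIntegrand_eq]
    exact hH.comp_neg
  · rw [meijerG]
    simp_rw [meijerIntegrand_eq]
    have h1 : ∫ t : ℝ, H (-t) * I = (∫ u, H u) * I := by
      rw [integral_mul_const, integral_neg_eq_self]
    change 1 / (2 * Real.pi * I) * ∫ t : ℝ, H (-t) * I = _
    rw [h1, hswap, hrw, ENNReal.toReal_ofReal (integral_nonneg hJ0)]
    have := Complex.I_ne_zero
    field_simp

end MellinBarnes

/-! ### Assembly of the theorem. -/

theorem theorem3 (m : ℕ) (hm : 1 ≤ m) :
    -- the real weight is a Meijer G-function (away from the possible singularity at `0`),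
    -- for every vertical contour that has all poles on its right
    (∀ x : ℝ, x ≠ 0 → ∀ c : ℝ, c < 0 →
      realWeight m x ≠ ∞ ∧
      Integrable (fun t : ℝ =>
        meijerIntegrand m 0 (fun _ : Fin 0 => 0) (fun _ : Fin m => 0)
          ((x ^ 2 / 2 ^ m : ℝ) : ℂ) (c + t * Complex.I)) ∧
      meijerG m 0 (fun _ : Fin 0 => 0) (fun _ : Fin m => 0) c ((x ^ 2 / 2 ^ m : ℝ) : ℂ) =
        ((realWeight m x).toReal : ℂ)) ∧
    -- the real weight is the density of the product of `m` scalars with weight `e^{-t²/2}`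
    ((volume.withDensity fun t : Fin m → ℝ => ∏ l, scalarGauss (t l)).map
        (fun t => ∏ l, t l) = volume.withDensity (realWeight m)) ∧
    -- the matrix weight is the density of the product of `m` real `2 × 2` matrices with weight
    -- `e^{-tr(G Gᵀ)/2} / √(2π³)`
    ((volume.withDensity fun H : Fin m → Fin 2 → Fin 2 → ℝ =>
          ∏ l, matrixGauss (Matrix.of (H l))).map
        (fun H => fun i j => prodTwo H i j) =
      volume.withDensity fun G : Fin 2 → Fin 2 → ℝ => matrixWeight m (Matrix.of G)) ∧
    -- the joint eigenvalue density of the product of `m` independent standard real Gaussian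
    -- `N × N` matrices on the event that there are exactly `k` real eigenvalues
    (∀ (N k K : ℕ), N = k + 2 * K →
      ∀ {Ω : Type*} [MeasurableSpace Ω] (P : Measure Ω) [IsProbabilityMeasure P]
        (X : Fin m → Ω → Matrix (Fin N) (Fin N) ℝ),
        (∀ l i j, HasLaw (fun ω => X l ω i j) (gaussianReal 0 1) P) →
        iIndepFun (fun (q : Fin m × Fin N × Fin N) ω => X q.1 ω q.2.1 q.2.2) P →
        ∀ B : Set (EigCoord k K), MeasurableSet B → LabelInvariant B →
          P {ω | ∃ p ∈ B, IsEigCoord (List.ofFn fun l => X l ω).prod p} =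
            ∫⁻ p in B ∩ upperCoord k K, jointDensity m N k K p) := by
  obtain ⟨r, rfl⟩ := Nat.exists_eq_add_of_le' hm
  refine ⟨fun x hx c hc => realWeight_meijerG hx hc, map_scalarGauss _ hm, map_matrixGauss _ hm, ?_⟩
  intro N k K hN Ω _ P _ X hlaw hind B hB hinv
  exact measure_isEigCoord hN hlaw hind hB hinv
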